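/- Fix an integer $q\ge 2$. A formula in the variables $x_1,\dots,x_n,z$ is an arithmetic circuit with $\times$ gates of fan-in two, $+$ gates of unbounded fan-in (each taking any given terminal node at most once as an input), and terminal nodes that are variables or the constant $1$, in which every gate has fan-out at most one; its size $s$ is the number of its gates, and it computes a polynomial $F(x_1,\dots,x_n,z)$ with integer coefficients. A monomial in $x_1,\dots,x_n$ is a $q$-monomial if every variable occurring in it has exponent between $1$ and $q-1$. There are a deterministic algorithm (a random access machine program, with time measured by the logarithmic, i.e. bit-length, cost) and constants $C,c$, all depending only on $q$, such that for all integers $n,k,t\ge 0$ and every formula of size $s$ computing $F(x_1,\dots,x_n,z)$, the algorithm, given $n$, $k$, $t$ and the formula, decides whether the expansion of $F$ into a sum of monomials contains, with nonzero coefficient, a monomial $z^t\pi$ where $\pi$ is a $q$-monomial of degree $k$ in the $x$-variables, and does so in time at most $$C\,(n+k+1)^{c}\cdot \max(t,1)^2\cdot 5.44^{k}\cdot \max(s,1)^4 .$$ In other words, the running time is $O^*(t^2\,5.44^k s^4)$, where $O^*$ suppresses factors polynomial in $n$ and $k$. -/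

import Mathlib

/-! ### Arithmetic formulas -/

/-- Formulas in the variables `x_1, …, x_n, z`: `×` gates of fan-in two, `+` gates of unbounded
fan-in, and terminal nodes. Only terminals may have fan-out larger than one, so a formula is a tree
of gates whose leaves are occurrences of terminals. A terminal is a variable or the constant `1`. -/
inductive Formula (n : ℕ) : Type
  | one : Formula n
  | z : Formula n
  | x (i : Fin n) : Formula n
  | mul (a b : Formula n) : Formula n
  | add (m : ℕ) (f : Fin m → Formula n) : Formula n

namespace Formula

/-- The size of a formula: the number of its gates (terminals are not gates). -/
def size {n : ℕ} : Formula n → ℕ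
  | one => 0
  | z => 0
  | x _ => 0
  | mul a b => a.size + b.size + 1
  | add _ f => (∑ i, (f i).size) + 1

/-- The underlying directed graph has no parallel edges into a `+` gate: no `+` gate takes the same
terminal (a subformula without gates) twice as an input. -/
def IsSimple {n : ℕ} : Formula n → Prop
  | one => True
  | z => True
  | x _ => True
  | mul a b => a.IsSimple ∧ b.IsSimple
  | add _ f => (∀ i, (f i).IsSimple) ∧ ∀ i j, (f i).size = 0 → f i = f j → i = j

/-- The polynomial computed by a formula; the variable `z` has index `none` and `x_i` has index
`some i`. -/
noncomputable def poly {n : ℕ} : Formula n → MvPolynomial (Option (Fin n)) ℤ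
  | one => 1
  | z => MvPolynomial.X none
  | x i => MvPolynomial.X (some i)
  | mul a b => a.poly * b.poly
  | add _ f => ∑ i, (f i).poly

/-- The description of a formula in prefix notation, as a list of natural numbers. -/
def encode {n : ℕ} : Formula n → List ℕ
  | one => [0]
  | z => [1]
  | x i => [2, (i : ℕ)]
  | mul a b => 3 :: (a.encode ++ b.encode)
  | add m f => 4 :: m :: (List.ofFn fun i => (f i).encode).flatten

end Formula

/-! ### Monomials -/

/-- A monomial, given by its exponents, is a `q`-monomial if every variable that occurs in it has
an exponent between `1` and `q - 1`. -/
def IsQMonomial (q : ℕ) {n : ℕ} (p : Fin n →₀ ℕ) : Prop :=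
  ∀ i ∈ p.support, 1 ≤ p i ∧ p i ≤ q - 1

/-- The expansion of `F` contains a monomial `z ^ t * π` with `π` a `q`-monomial of degree `k` in
the `x`-variables. -/
def HasMarkedQMonomial (q k t : ℕ) {n : ℕ} (F : MvPolynomial (Option (Fin n)) ℤ) : Prop :=
  ∃ p : Fin n →₀ ℕ, IsQMonomial q p ∧ p.degree = k ∧
    Finsupp.single none t + p.mapDomain some ∈ F.support

/-! ### Random access machines with logarithmic cost -/

namespace RAM

/-- Registers and main memory, both holding natural numbers. A program refers to finitely many
registers, by fixed names; memory cells are addressed by register contents. -/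
structure State where
  reg : ℕ → ℕ
  mem : ℕ → ℕ

/-- The length charged for a number, its number of bits plus one. -/
def len (a : ℕ) : ℕ := Nat.size a + 1

/-- The arithmetic operations: addition, truncated subtraction, multiplication, and integer
quotient. -/
inductive Op
  | add
  | sub
  | mul
  | div

/-- The result of an arithmetic operation. -/
def Op.eval : Op → ℕ → ℕ → ℕ
  | add, a, b => a + b
  | sub, a, b => a - b
  | mul, a, b => a * b
  | div, a, b => a / b

/-- The bit cost of an arithmetic operation: linear for addition and subtraction, that of the
schoolbook algorithms for multiplication and division. -/
def Op.cost : Op → ℕ → ℕ → ℕ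
  | add, a, b => len a + len b
  | sub, a, b => len a + len b
  | mul, a, b => len a * len b
  | div, a, b => len a * len b

/-- Programs. `const r c` puts the constant `c` into register `r`; `op o r a b` puts the result of
`o` on registers `a`, `b` into register `r`; `load r a` reads into register `r` the memory cell whose
address is in register `a`; `store a r` writes register `r` to the cell whose address is in register
`a`; `ite r P Q` runs `P` if register `r` is nonzero and `Q` otherwise; `loop r P` repeats `P` as long
as register `r` is nonzero. -/
inductive Prog
  | skip
  | const (r c : ℕ)
  | op (o : Op) (r a b : ℕ)
  | load (r a : ℕ)
  | store (a r : ℕ)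
  | seq (P Q : Prog)
  | ite (r : ℕ) (P Q : Prog)
  | loop (r : ℕ) (P : Prog)

/-- The state after register `r` has been set to `v`. -/
def State.setReg (s : State) (r v : ℕ) : State := ⟨Function.update s.reg r v, s.mem⟩

/-- The state after memory cell `a` has been set to `v`. -/
def State.setMem (s : State) (a v : ℕ) : State := ⟨s.reg, Function.update s.mem a v⟩

/-- `Exec P s s' T`: program `P`, started in state `s`, halts in state `s'` after time `T`, where
every step is charged the lengths of the numbers and memory addresses that it handles. -/
inductive Exec : Prog → State → State → ℕ → Prop
  | skip (s) : Exec .skip s s 1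
  | const (s r c) : Exec (.const r c) s (s.setReg r c) (len c)
  | op (s o r a b) : Exec (.op o r a b) s
      (s.setReg r (o.eval (s.reg a) (s.reg b))) (o.cost (s.reg a) (s.reg b))
  | load (s r a) : Exec (.load r a) s
      (s.setReg r (s.mem (s.reg a))) (len (s.reg a) + len (s.mem (s.reg a)))
  | store (s a r) : Exec (.store a r) s
      (s.setMem (s.reg a) (s.reg r)) (len (s.reg a) + len (s.reg r))
  | seq {P Q s s₁ s₂ T₁ T₂} : Exec P s s₁ T₁ → Exec Q s₁ s₂ T₂ → Exec (.seq P Q) s s₂ (T₁ + T₂)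
  | ite_true {r P Q s s' T} : s.reg r ≠ 0 → Exec P s s' T →
      Exec (.ite r P Q) s s' (len (s.reg r) + T)
  | ite_false {r P Q s s' T} : s.reg r = 0 → Exec Q s s' T →
      Exec (.ite r P Q) s s' (len (s.reg r) + T)
  | loop_done {r P s} : s.reg r = 0 → Exec (.loop r P) s s (len (s.reg r))
  | loop_step {r P s s₁ s₂ T₁ T₂} : s.reg r ≠ 0 → Exec P s s₁ T₁ → Exec (.loop r P) s₁ s₂ T₂ →
      Exec (.loop r P) s s₂ (len (s.reg r) + T₁ + T₂)

/-- Programs are deterministic: the final state and the running time are determined by the program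
and the initial state. -/
theorem Exec.deterministic {P : Prog} {s s₁ s₂ : State} {T₁ T₂ : ℕ}
    (h₁ : Exec P s s₁ T₁) (h₂ : Exec P s s₂ T₂) : s₁ = s₂ ∧ T₁ = T₂ := by
  induction h₁ generalizing s₂ T₂ with
  | skip | const | op | load | store => cases h₂; exact ⟨rfl, rfl⟩
  | seq _ _ ih₁ ih₂ =>
    cases h₂ with
    | seq h h' =>
      obtain ⟨rfl, rfl⟩ := ih₁ h
      obtain ⟨rfl, rfl⟩ := ih₂ h'
      exact ⟨rfl, rfl⟩
  | ite_true hr _ ih =>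
    cases h₂ with
    | ite_true _ h => obtain ⟨rfl, rfl⟩ := ih h; exact ⟨rfl, rfl⟩
    | ite_false h0 _ => exact absurd h0 hr
  | ite_false hr _ ih =>
    cases h₂ with
    | ite_true h0 _ => exact absurd hr h0
    | ite_false _ h => obtain ⟨rfl, rfl⟩ := ih h; exact ⟨rfl, rfl⟩
  | loop_done hr =>
    cases h₂ with
    | loop_done _ => exact ⟨rfl, rfl⟩
    | loop_step h0 _ _ => exact absurd hr h0
  | loop_step hr _ _ ih₁ ih₂ =>
    cases h₂ with
    | loop_done h0 => exact absurd h0 hr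
    | loop_step _ h h' =>
      obtain ⟨rfl, rfl⟩ := ih₁ h
      obtain ⟨rfl, rfl⟩ := ih₂ h'
      exact ⟨rfl, rfl⟩

/-- The initial state on an input word: the input stands at the beginning of the memory, and
everything else is zero. -/
def State.init (w : List ℕ) : State := ⟨fun _ => 0, fun a => w.getD a 0⟩

end RAM

/-- The input of the testing problem: `n`, `k`, `t` and the description of the formula. -/
def inputWord {n : ℕ} (k t : ℕ) (φ : Formula n) : List ℕ := n :: k :: t :: φ.encode

/-!
Expand `F` into words, choosing a summand at every `+` gate and one of `q - 1` numbered copies at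
every occurrence of a variable. A monomial `z ^ t * π` with `π` a `q`-monomial of degree `k` occurs
in `F` if and only if some word consists, apart from factors `1`, of `t` letters `z` and `k`
pairwise distinct copies.

To detect such a word, send the copy with number `α` to `v ⊗ v`, where `v = (1, α, …, α ^ (k - 1))`,
in the tensor square of the exterior algebra on `k` generators. The top coefficient of a word with
`k` copies is then the square of a Vandermonde determinant, and so it is positive if the copies are
distinct and zero otherwise. The coefficients of `F` being nonnegative, nothing cancels in the sum
over all words. The top coefficient at `z ^ t` is bounded, so it can be computed modulo a large
number.

The multiplications are all by single letters: every formula becomes a network of edges labelled by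
letters, in which a product is a path through a new node and a sum is a bundle of parallel
connections. The vectors at the nodes have `(t + 1) * 4 ^ k` coefficients each.
-/

section ExteriorPairs

open Finset

/-- The binary digit of `a` of weight `w * 2 ^ j`. For `w = 0` it is `0`, since `a / 0 = 0`. -/
def bitAt (w j a : ℕ) : ℕ := a / (w * 2 ^ j) % 2

/-- The sign of moving a new factor past the factors recorded by the lowest `j` binary digits of
`a`, counted from the digit of weight `w`. -/
def bitSign (R : Type*) [CommRing R] (w j a : ℕ) : R :=
  ∏ i ∈ range j, if bitAt w i a = 0 then 1 else -1

/-- A linear map between blocks of coefficients, as the machine applies it along an edge: for every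
`j < bits` and every cell `a` whose digit of weight `weight * 2 ^ j` is `0`, the cell
`a + offset * 2 ^ j` receives `base ^ j` times the entry of the cell `a`, with the sign `bitSign`.
Weight `0` makes every digit `0`, so that with `bits = 1` the map is a shift by `offset`. -/
structure EdgeLabel where
  weight : ℕ
  offset : ℕ
  base : ℕ
  bits : ℕ

theorem bitAt_eq_sub (w j a : ℕ) :
    bitAt w j a = a / (w * 2 ^ j) - a / (w * 2 ^ j) / 2 * 2 := by
  unfold bitAt
  omega

theorem bitAt_two_pow (e j a : ℕ) : bitAt (2 ^ e) j a = (a.testBit (e + j)).toNat := by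
  rw [Nat.toNat_testBit, bitAt, ← pow_add]

theorem bitAt_add_two_pow_self (e j a : ℕ) :
    bitAt (2 ^ e) j (a + 2 ^ e * 2 ^ j) = (bitAt (2 ^ e) j a + 1) % 2 := by
  unfold bitAt
  rw [Nat.add_div_right _ (by positivity)]
  omega

theorem bitAt_add_two_pow_of_lt (e : ℕ) {i j : ℕ} (hij : i < j) (a : ℕ) :
    bitAt (2 ^ e) i (a + 2 ^ e * 2 ^ j) = bitAt (2 ^ e) i a := by
  obtain ⟨d, rfl⟩ := Nat.exists_eq_add_of_lt hij
  unfold bitAt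
  rw [show 2 ^ e * 2 ^ (i + d + 1) = 2 ^ e * 2 ^ i * (2 * 2 ^ d) by ring,
    Nat.add_mul_div_left _ _ (by positivity)]
  omega

theorem le_of_bitAt_ne_zero {w j a : ℕ} (h : bitAt w j a ≠ 0) : w * 2 ^ j ≤ a := by
  contrapose! h
  rw [bitAt, Nat.div_eq_of_lt h, Nat.zero_mod]

variable {R : Type*} [CommRing R]

theorem bitSign_succ (w j a : ℕ) :
    bitSign R w (j + 1) a = bitSign R w j a * if bitAt w j a = 0 then 1 else -1 :=
  prod_range_succ ..

theorem bitSign_add_two_pow_self (e j a : ℕ) :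
    bitSign R (2 ^ e) j (a + 2 ^ e * 2 ^ j) = bitSign R (2 ^ e) j a :=
  prod_congr rfl fun i hi => by rw [bitAt_add_two_pow_of_lt e (mem_range.1 hi)]

theorem bitSign_eq_neg_one_pow {w j y : ℕ} {I : Finset ℕ}
    (h : ∀ i < j, bitAt w i y = if i ∈ I then 1 else 0) :
    bitSign R w j y = (-1) ^ #{i ∈ I | i < j} := by
  have hfactor : ∀ i ∈ range j, (if bitAt w i y = 0 then (1 : R) else -1) =
      if i ∈ I then -1 else 1 := by
    intro i hi
    rw [h i (mem_range.1 hi)]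
    split_ifs <;> simp_all
  rw [bitSign, prod_congr rfl hfactor, prod_ite, prod_const, prod_const_one, mul_one]
  congr 2
  ext i
  simp [and_comm]

namespace EdgeLabel

/-- The part of an edge map that reads the cell `a`, writing to a block at address `v`. -/
noncomputable def scatter (R : Type*) [CommRing R] (ℓ : EdgeLabel) (v a : ℕ) : R →ₗ[R] (ℕ → R) :=
  ∑ j ∈ range ℓ.bits, if bitAt ℓ.weight j a = 0 then
    (bitSign R ℓ.weight j a * (ℓ.base : R) ^ j) •
      LinearMap.single R (fun _ => R) (v + a + ℓ.offset * 2 ^ j)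
  else 0

theorem scatter_apply (ℓ : EdgeLabel) (v a : ℕ) (x : R) (y : ℕ) :
    ℓ.scatter R v a x y = ∑ j ∈ range ℓ.bits,
      if bitAt ℓ.weight j a = 0 ∧ y = v + a + ℓ.offset * 2 ^ j then
        bitSign R ℓ.weight j a * (ℓ.base : R) ^ j * x else 0 := by
  rw [scatter, LinearMap.sum_apply, Finset.sum_apply]
  refine sum_congr rfl fun j _ => ?_
  split_ifs <;> simp_all

/-- The label whose map sums only over the lowest `j` digits. -/
def truncate (ℓ : EdgeLabel) (j : ℕ) : EdgeLabel := { ℓ with bits := j }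

theorem scatter_truncate_zero (ℓ : EdgeLabel) (v a : ℕ) (x : R) :
    (ℓ.truncate 0).scatter R v a x = 0 := by
  simp [truncate, scatter]

theorem scatter_truncate_succ (ℓ : EdgeLabel) (j v a : ℕ) (x : R) :
    (ℓ.truncate (j + 1)).scatter R v a x = (ℓ.truncate j).scatter R v a x +
      if bitAt ℓ.weight j a = 0 then
        Pi.single (v + a + ℓ.offset * 2 ^ j) (bitSign R ℓ.weight j a * (ℓ.base : R) ^ j * x)
      else 0 := by
  rw [scatter, scatter, truncate, truncate, sum_range_succ, LinearMap.add_apply]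
  split_ifs <;> simp [← Pi.single_smul]

/-- The edge map on blocks of which only the first `S` cells are read. -/
noncomputable def op (R : Type*) [CommRing R] (ℓ : EdgeLabel) (S : ℕ) : Module.End R (ℕ → R) :=
  ∑ a ∈ range S, ℓ.scatter R 0 a ∘ₗ LinearMap.proj a

theorem op_apply (ℓ : EdgeLabel) (S : ℕ) (f : ℕ → R) :
    ℓ.op R S f = ∑ a ∈ range S, ℓ.scatter R 0 a (f a) := by
  rw [op, LinearMap.sum_apply]
  rfl

/-- Multiplication by a power of `z`, in the encoding of blocks where it shifts by `o` cells. -/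
def shift (o : ℕ) : EdgeLabel := ⟨0, o, 1, 1⟩

/-- Multiplication by the vector `(1, α, …, α ^ (k - 1))` in an exterior algebra whose basis vectors
are encoded by the digits `e, …, e + k - 1` of the cells. -/
def wedge (k e α : ℕ) : EdgeLabel := ⟨2 ^ e, 2 ^ e, α, k⟩

theorem scatter_shift_apply (o v a : ℕ) (x : R) (y : ℕ) :
    (shift o).scatter R v a x y = if y = v + a + o then x else 0 := by
  simp [scatter_apply, shift, bitAt, bitSign]

theorem op_shift_apply_add {o S y : ℕ} (f : ℕ → R) (hy : y < S) :
    (shift o).op R S f (y + o) = f y := by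
  simp [op_apply, scatter_shift_apply, hy]

theorem op_shift_apply_of_lt {o S y : ℕ} (f : ℕ → R) (hy : y < o) :
    (shift o).op R S f y = 0 := by
  simp only [op_apply, Finset.sum_apply, scatter_shift_apply]
  exact sum_eq_zero fun a _ => if_neg (by omega)

theorem op_wedge_apply {k e α S y : ℕ} (f : ℕ → R) (hy : y < S) :
    (wedge k e α).op R S f y = ∑ j ∈ range k, if bitAt (2 ^ e) j y = 0 then 0 else
      bitSign R (2 ^ e) j y * (α : R) ^ j * f (y - 2 ^ e * 2 ^ j) := by
  simp only [op_apply, Finset.sum_apply, scatter_apply, wedge]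
  rw [sum_comm]
  refine sum_congr rfl fun j _ => ?_
  have flip := bitAt_add_two_pow_self e j
  split_ifs with hbit
  · refine sum_eq_zero fun a _ => if_neg ?_
    rintro ⟨ha, rfl⟩
    rw [zero_add, flip, ha] at hbit
    omega
  · obtain ⟨a, rfl⟩ := Nat.exists_eq_add_of_le' (le_of_bitAt_ne_zero hbit)
    have ha : bitAt (2 ^ e) j a = 0 := by
      have : bitAt (2 ^ e) j a < 2 := Nat.mod_lt _ two_pos
      rw [flip] at hbit
      omega
    rw [sum_eq_single_of_mem a (mem_range.2 (by omega)) fun b _ hba => if_neg (by omega),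
      if_pos ⟨ha, by rw [zero_add]⟩, bitSign_add_two_pow_self, Nat.add_sub_cancel]

theorem op_wedge_apply_of_bits {k e α S y : ℕ} {I : Finset ℕ} (hI : I ⊆ range k) (f : ℕ → R)
    (hy : y < S) (h : ∀ i < k, bitAt (2 ^ e) i y = if i ∈ I then 1 else 0) :
    (wedge k e α).op R S f y =
      ∑ j ∈ I, (-1) ^ #{i ∈ I | i < j} * (α : R) ^ j * f (y - 2 ^ e * 2 ^ j) := by
  rw [op_wedge_apply f hy, ← sum_subset hI]
  · refine sum_congr rfl fun j hj => ?_
    have hjk := mem_range.1 (hI hj)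
    rw [h j hjk, if_pos hj, if_neg one_ne_zero,
      bitSign_eq_neg_one_pow fun i hi => h i (hi.trans hjk)]
  · intro j hj hjI
    rw [h j (mem_range.1 hj), if_neg hjI, if_pos rfl]

end EdgeLabel

/-- The number whose binary digits `1` are at the positions in `I`. -/
def mask (I : Finset ℕ) : ℕ := ∑ i ∈ I, 2 ^ i

theorem mask_lt {k : ℕ} {I : Finset ℕ} (hI : I ⊆ range k) : mask I < 2 ^ k :=
  Nat.geomSum_lt le_rfl fun _ hi => mem_range.1 (hI hi)

theorem mask_erase_add {I : Finset ℕ} {j : ℕ} (hj : j ∈ I) : mask (I.erase j) + 2 ^ j = mask I :=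
  sum_erase_add I _ hj

theorem testBit_mask (I : Finset ℕ) (j : ℕ) : (mask I).testBit j = decide (j ∈ I) := by
  rw [Bool.eq_iff_iff, decide_eq_true_iff, ← Nat.mem_bitIndices, ← List.mem_toFinset, mask,
    toFinset_bitIndices_sum_two_pow]

/-- The position in a block of the coefficient of `z ^ d ⊗ e_I ⊗ e_J`, for subsets `I` and `J` of
`{0, …, k - 1}`. -/
def cell (k d : ℕ) (I J : Finset ℕ) : ℕ := mask I + 2 ^ k * (mask J + 2 ^ k * d)

section Cell

variable {k d j : ℕ} {I J : Finset ℕ}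

theorem cell_lt {t : ℕ} (hI : I ⊆ range k) (hJ : J ⊆ range k) (hd : d ≤ t) :
    cell k d I J < (t + 1) * 4 ^ k :=
  calc cell k d I J < 2 ^ k * (mask J + 2 ^ k * d + 1) := by
        rw [cell, mul_add_one]
        linarith [mask_lt hI]
    _ ≤ 2 ^ k * (2 ^ k * (t + 1)) := by
        refine Nat.mul_le_mul_left _ ?_
        nlinarith [mask_lt hJ, Nat.mul_le_mul_left (2 ^ k) hd]
    _ = (t + 1) * 4 ^ k := by
        rw [show (4 : ℕ) = 2 * 2 from rfl, mul_pow]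
        ring

theorem bitAt_cell_left (hI : I ⊆ range k) (hj : j < k) :
    bitAt (2 ^ 0) j (cell k d I J) = if j ∈ I then 1 else 0 := by
  rw [bitAt_two_pow, cell, add_comm (mask I), Nat.testBit_two_pow_mul_add _ (mask_lt hI), zero_add,
    if_pos hj, testBit_mask]
  split_ifs with h <;> simp [h]

theorem bitAt_cell_right (hI : I ⊆ range k) (hJ : J ⊆ range k) (hj : j < k) :
    bitAt (2 ^ k) j (cell k d I J) = if j ∈ J then 1 else 0 := by
  rw [bitAt_two_pow, cell, add_comm (mask I), Nat.testBit_two_pow_mul_add _ (mask_lt hI),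
    if_neg (by omega), Nat.add_sub_cancel_left, add_comm (mask J),
    Nat.testBit_two_pow_mul_add _ (mask_lt hJ), if_pos hj, testBit_mask]
  split_ifs with h <;> simp [h]

theorem cell_erase_left (hj : j ∈ I) : cell k d I J - 2 ^ 0 * 2 ^ j = cell k d (I.erase j) J := by
  rw [cell, cell, ← mask_erase_add hj]
  omega

theorem cell_erase_right (hj : j ∈ J) : cell k d I J - 2 ^ k * 2 ^ j = cell k d I (J.erase j) := by
  rw [cell, cell, ← mask_erase_add hj]
  refine Nat.sub_eq_of_eq_add ?_
  ring

theorem cell_succ : cell k (d + 1) I J = cell k d I J + 4 ^ k := by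
  rw [cell, cell, show (4 : ℕ) = 2 * 2 from rfl, mul_pow]
  ring

end Cell

/-- The coefficient of `e_I` in the exterior product of the vectors `(1, α, α ^ 2, …)`, for `α` in
the list, as given by the Laplace expansion along the first vector. -/
def wedgeCoeff (R : Type*) [CommRing R] : List ℕ → Finset ℕ → R
  | [], I => if I = ∅ then 1 else 0
  | α :: A, I => ∑ j ∈ I, (-1) ^ #{i ∈ I | i < j} * (α : R) ^ j * wedgeCoeff R A (I.erase j)

theorem wedgeCoeff_cons (α : ℕ) (A : List ℕ) (I : Finset ℕ) : wedgeCoeff R (α :: A) I =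
    ∑ j ∈ I, (-1) ^ #{i ∈ I | i < j} * (α : R) ^ j * wedgeCoeff R A (I.erase j) := rfl

theorem wedgeCoeff_eq_zero {A : List ℕ} {I : Finset ℕ} (h : #I ≠ A.length) :
    wedgeCoeff R A I = 0 := by
  induction A generalizing I with
  | nil => exact if_neg fun hI => h (by simp [hI])
  | cons α A ih =>
    refine sum_eq_zero fun j hj => ?_
    rw [ih, mul_zero]
    intro hcard
    rw [← card_erase_add_one hj, hcard] at h
    exact h rfl

theorem intCast_wedgeCoeff (A : List ℕ) (I : Finset ℕ) :
    ((wedgeCoeff ℤ A I : ℤ) : R) = wedgeCoeff R A I := by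
  induction A generalizing I with
  | nil => unfold wedgeCoeff; split_ifs <;> simp
  | cons α A ih => simp [wedgeCoeff_cons, ih]

theorem card_filter_lt_image_univ {m : ℕ} {f : Fin m → ℕ} (hf : StrictMono f) (c : Fin m) :
    #{i ∈ univ.image f | i < f c} = c := by
  have h : {i ∈ univ.image f | i < f c} = (Finset.Iio c).image f := by
    ext i
    simp only [mem_filter, mem_image, mem_univ, true_and, mem_Iio]
    constructor
    · rintro ⟨⟨a, rfl⟩, h⟩
      exact ⟨a, hf.lt_iff_lt.1 h, rfl⟩
    · rintro ⟨a, h, rfl⟩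
      exact ⟨⟨a, rfl⟩, hf h⟩
  rw [h, card_image_of_injective _ hf.injective, Fin.card_Iio]

theorem image_univ_erase {m : ℕ} {f : Fin (m + 1) → ℕ} (hf : f.Injective) (c : Fin (m + 1)) :
    (univ.image f).erase (f c) = univ.image (f ∘ c.succAbove) := by
  rw [← image_image, Fin.image_succAbove_univ, compl_eq_univ_sdiff, image_sdiff _ _ hf,
    image_singleton, sdiff_singleton_eq_erase]

theorem wedgeCoeff_image_eq_det {m : ℕ} (v : Fin m → ℕ) {f : Fin m → ℕ} (hf : StrictMono f) :
    wedgeCoeff R (List.ofFn v) (univ.image f) = (Matrix.of fun i j => (v i : R) ^ f j).det := by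
  induction m with
  | zero => simp [wedgeCoeff]
  | succ m ih =>
    rw [List.ofFn_succ, wedgeCoeff_cons, Matrix.det_succ_row_zero,
      sum_image fun _ _ _ _ h => hf.injective h]
    refine sum_congr rfl fun c _ => ?_
    rw [card_filter_lt_image_univ hf, image_univ_erase hf.injective,
      ih _ (hf.comp (Fin.strictMono_succAbove c))]
    rfl

theorem wedgeCoeff_range_eq_det_vandermonde (A : List ℕ) :
    wedgeCoeff R A (range A.length) =
      (Matrix.vandermonde fun i : Fin A.length => (A.get i : R)).det := by
  have h := wedgeCoeff_image_eq_det (R := R) A.get Fin.val_strictMono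
  rwa [List.ofFn_get, show univ.image (Fin.val : Fin A.length → ℕ) = range A.length by
    simp [← Fin.range_val, ← coe_inj]] at h

theorem wedgeCoeff_range_ne_zero_iff {A : List ℕ} {k : ℕ} :
    wedgeCoeff ℤ A (range k) ≠ 0 ↔ A.length = k ∧ A.Nodup := by
  by_cases h : A.length = k
  · subst h
    rw [wedgeCoeff_range_eq_det_vandermonde, Matrix.det_vandermonde_ne_zero_iff,
      List.nodup_iff_injective_get]
    simp only [true_and]
    exact ⟨fun h => Function.Injective.of_comp (f := fun a : ℕ => (a : ℤ)) h,
      fun h => Nat.cast_injective.comp h⟩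
  · simp [h, wedgeCoeff_eq_zero (R := ℤ) (A := A) (I := range k) (by simpa using Ne.symm h)]

theorem abs_det_vandermonde_le {m : ℕ} {v : Fin m → ℤ} {B : ℤ} (hB : 1 ≤ B)
    (hv : ∀ i j, |v j - v i| ≤ B) : |(Matrix.vandermonde v).det| ≤ B ^ (m * m) := by
  have row_le (i : Fin m) : ∏ j ∈ Finset.Ioi i, |v j - v i| ≤ B ^ m :=
    calc ∏ j ∈ Finset.Ioi i, |v j - v i| ≤ ∏ _j ∈ Finset.Ioi i, B :=
          prod_le_prod (fun _ _ => abs_nonneg _) fun j _ => hv i j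
      _ ≤ B ^ m := by
          rw [prod_const]
          exact pow_le_pow_right₀ hB (by simpa using card_le_univ (Finset.Ioi i))
  calc |(Matrix.vandermonde v).det| = ∏ i, ∏ j ∈ Finset.Ioi i, |v j - v i| := by
        simp only [Matrix.det_vandermonde, abs_prod]
    _ ≤ ∏ _i : Fin m, B ^ m :=
        prod_le_prod (fun _ _ => prod_nonneg fun _ _ => abs_nonneg _) fun i _ => row_le i
    _ = B ^ (m * m) := by simp [pow_mul]

theorem wedgeCoeff_range_sq_le {A : List ℕ} {k B : ℕ} (hA : ∀ α ∈ A, α ≤ B) (hB : 0 < B) :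
    wedgeCoeff ℤ A (range k) ^ 2 ≤ (B : ℤ) ^ (2 * (k * k)) := by
  by_cases h : A.length = k
  · subst h
    rw [wedgeCoeff_range_eq_det_vandermonde, ← sq_abs, mul_comm, pow_mul]
    refine pow_le_pow_left₀ (abs_nonneg _) (abs_det_vandermonde_le (by exact_mod_cast hB) ?_) 2
    intro i j
    have hi := hA _ (A.get_mem i)
    have hj := hA _ (A.get_mem j)
    rw [abs_le]
    omega
  · rw [wedgeCoeff_eq_zero (by simpa using Ne.symm h)]
    positivity

/-- The action of `∧ (1, α, …, α ^ (k - 1))` on a block, in both exterior algebras. -/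
noncomputable def opX (R : Type*) [CommRing R] (k t α : ℕ) : Module.End R (ℕ → R) :=
  (EdgeLabel.wedge k k α).op R ((t + 1) * 4 ^ k) ∘ₗ (EdgeLabel.wedge k 0 α).op R ((t + 1) * 4 ^ k)

theorem opX_apply_cell {k t α d : ℕ} {f : ℕ → R} {c : R} {A : List ℕ} (hd : d ≤ t)
    (hf : ∀ I J : Finset ℕ, I ⊆ range k → J ⊆ range k →
      f (cell k d I J) = c * (wedgeCoeff R A I * wedgeCoeff R A J))
    {I J : Finset ℕ} (hI : I ⊆ range k) (hJ : J ⊆ range k) :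
    opX R k t α f (cell k d I J) = c * (wedgeCoeff R (α :: A) I * wedgeCoeff R (α :: A) J) := by
  have left (J : Finset ℕ) (hJ : J ⊆ range k) :
      (EdgeLabel.wedge k 0 α).op R ((t + 1) * 4 ^ k) f (cell k d I J) =
        c * (wedgeCoeff R (α :: A) I * wedgeCoeff R A J) := by
    rw [EdgeLabel.op_wedge_apply_of_bits hI f (cell_lt hI hJ hd)
      fun i hi => bitAt_cell_left hI hi, wedgeCoeff_cons, sum_mul, mul_sum]
    refine sum_congr rfl fun j hj => ?_
    rw [cell_erase_left hj, hf _ _ ((erase_subset _ _).trans hI) hJ]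
    ring
  rw [opX, LinearMap.comp_apply, EdgeLabel.op_wedge_apply_of_bits hJ _ (cell_lt hI hJ hd)
    fun i hi => bitAt_cell_right hI hJ hi, wedgeCoeff_cons α A J, mul_sum, mul_sum]
  refine sum_congr rfl fun j hj => ?_
  rw [cell_erase_right hj, left _ ((erase_subset _ _).trans hJ)]
  ring

end ExteriorPairs

section Words

open Finset

/-- The letters of which the monomials of a formula are made up: `1`, `z`, and numbered copies of
the variables. With `r` copies per variable, the copies of `x i` are `i * r, …, i * r + (r - 1)`. -/
inductive Letter
  | one
  | z
  | x (α : ℕ)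

namespace Letter

/-- The number of letters `z` of a word: the exponent of `z` in its monomial. -/
@[simp]
def zCount : List Letter → ℕ
  | [] => 0
  | one :: w => zCount w
  | z :: w => zCount w + 1
  | x _ :: w => zCount w

/-- The copies of variables that occur in a word. -/
@[simp]
def copies : List Letter → List ℕ
  | [] => []
  | one :: w => copies w
  | z :: w => copies w
  | x α :: w => α :: copies w

/-- The terminal that a letter stands for when every variable has `r` copies. -/
@[simp]
def terminal (r : ℕ) : Letter → Letter
  | one => one
  | z => z
  | x α => x (α / r)

theorem copies_append (u v : List Letter) : copies (u ++ v) = copies u ++ copies v := by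
  induction u with
  | nil => rfl
  | cons l u ih => cases l <;> simp [ih]

theorem zCount_map_terminal (r : ℕ) (w : List Letter) :
    zCount (w.map (terminal r)) = zCount w := by
  induction w with
  | nil => rfl
  | cons l w ih => cases l <;> simp [ih]

theorem copies_map_terminal (r : ℕ) (w : List Letter) :
    copies (w.map (terminal r)) = (copies w).map (· / r) := by
  induction w with
  | nil => rfl
  | cons l w ih => cases l <;> simp [ih]

variable (R : Type*) [CommRing R]

/-- The action of a letter on a block. -/
noncomputable def act (k t : ℕ) : Letter → Module.End R (ℕ → R)
  | one => (EdgeLabel.shift 0).op R ((t + 1) * 4 ^ k)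
  | z => (EdgeLabel.shift (4 ^ k)).op R ((t + 1) * 4 ^ k)
  | x α => opX R k t α

/-- The action of a word on a block; the last letter acts first. -/
noncomputable def wordAct (k t : ℕ) (w : List Letter) : Module.End R (ℕ → R) :=
  (w.map (act R k t)).prod

theorem wordAct_append (k t : ℕ) (u v : List Letter) :
    wordAct R k t (u ++ v) = wordAct R k t u * wordAct R k t v := by
  rw [wordAct, List.map_append, List.prod_append, wordAct, wordAct]

theorem single_zero_apply_cell (k d : ℕ) (I J : Finset ℕ) :
    (Pi.single 0 1 : ℕ → R) (cell k d I J) =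
      (if d = 0 then 1 else 0) * (wedgeCoeff R [] I * wedgeCoeff R [] J) := by
  have mask_eq_zero_iff (I : Finset ℕ) : mask I = 0 ↔ I = ∅ := by
    simp [mask, sum_eq_zero_iff, eq_empty_iff_forall_notMem]
  have cell_eq_zero_iff : cell k d I J = 0 ↔ I = ∅ ∧ J = ∅ ∧ d = 0 := by
    simp [cell, mask_eq_zero_iff]
  simp only [Pi.single_apply, cell_eq_zero_iff, wedgeCoeff]
  split_ifs <;> simp_all

theorem wordAct_apply_cell {k t d : ℕ} (w : List Letter) (hd : d ≤ t) {I J : Finset ℕ}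
    (hI : I ⊆ range k) (hJ : J ⊆ range k) :
    wordAct R k t w (Pi.single 0 1) (cell k d I J) =
      (if d = zCount w then 1 else 0) *
        (wedgeCoeff R (copies w) I * wedgeCoeff R (copies w) J) := by
  induction w generalizing d I J with
  | nil => exact single_zero_apply_cell R k d I J
  | cons l w ih =>
    rw [wordAct, List.map_cons, List.prod_cons, Module.End.mul_apply, ← wordAct]
    cases l with
    | one => exact (EdgeLabel.op_shift_apply_add _ (cell_lt hI hJ hd)).trans (ih hd hI hJ)
    | z =>
      cases d with
      | zero =>
        rw [act, EdgeLabel.op_shift_apply_of_lt _ (by simpa using cell_lt (t := 0) hI hJ le_rfl)]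
        simp
      | succ d =>
        rw [act, cell_succ, EdgeLabel.op_shift_apply_add _ (cell_lt hI hJ (by omega)),
          ih (by omega) hI hJ]
        simp
    | x α => exact opX_apply_cell hd (fun I J hI hJ => ih hd hI hJ) hI hJ

theorem count_map_div_eq_card {l : List ℕ} {r : ℕ} (hr : 0 < r) (hl : l.Nodup) (i : ℕ) :
    (l.map (· / r)).count i = #{a ∈ Ico (i * r) (i * r + r) | a ∈ l} := by
  rw [List.count_eq_countP, List.countP_map, List.countP_eq_length_filter,
    ← List.toFinset_card_of_nodup (hl.filter _)]
  congr 1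
  ext a
  simp only [List.mem_toFinset, List.mem_filter, Function.comp_apply, beq_iff_eq,
    Nat.div_eq_iff hr, Nat.le_sub_one_iff_lt (Nat.add_pos_right _ hr), mem_filter, mem_Ico,
    and_comm]

theorem count_map_div_le {l : List ℕ} {r : ℕ} (hr : 0 < r) (hl : l.Nodup) (i : ℕ) :
    (l.map (· / r)).count i ≤ r := by
  rw [count_map_div_eq_card hr hl]
  exact (card_filter_le _ _).trans (by simp)

theorem exists_div_eq_notMem {l : List ℕ} {r i : ℕ} (hl : l.Nodup)
    (h : (l.map (· / r)).count i < r) : ∃ a, a / r = i ∧ a ∉ l := by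
  have hr : 0 < r := by omega
  contrapose! h
  rw [count_map_div_eq_card hr hl, filter_true_of_mem, Nat.card_Ico, Nat.add_sub_cancel_left]
  intro a ha
  rw [mem_Ico] at ha
  exact h a ((Nat.div_eq_iff hr).2 (by omega))

theorem exists_map_terminal_eq_nodup {r : ℕ} (w : List Letter)
    (h : ∀ i, ((copies w).map (· / r)).count i ≤ r) :
    ∃ w', w'.map (terminal r) = w.map (terminal r) ∧ (copies w').Nodup := by
  induction w with
  | nil => exact ⟨[], rfl, List.nodup_nil⟩
  | cons l w ih =>
    cases l with
    | one =>
      obtain ⟨w', hw', hnodup⟩ := ih h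
      exact ⟨one :: w', congrArg (List.cons _) hw', hnodup⟩
    | z =>
      obtain ⟨w', hw', hnodup⟩ := ih h
      exact ⟨z :: w', congrArg (List.cons _) hw', hnodup⟩
    | x α =>
      have hcount : ∀ i, ((copies w).map (· / r)).count i + (if α / r = i then 1 else 0) ≤ r := by
        simpa [List.count_cons] using h
      obtain ⟨w', hw', hnodup⟩ := ih fun i => (Nat.le_add_right _ _).trans (hcount i)
      obtain ⟨β, hβ, hβw'⟩ : ∃ β, β / r = α / r ∧ β ∉ copies w' := by
        refine exists_div_eq_notMem hnodup ?_
        rw [← copies_map_terminal, hw', copies_map_terminal]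
        simpa using hcount (α / r)
      exact ⟨x β :: w', by simp [hβ, hw'], List.nodup_cons.2 ⟨hβw', hnodup⟩⟩

/-- The exponents that a letter contributes to a monomial in `z` and `n` variables with `r` copies
each; `none` stands for `z`. -/
noncomputable def exponent (n r : ℕ) : Letter → Option (Fin n) →₀ ℕ
  | one => 0
  | z => Finsupp.single none 1
  | x α => if h : α / r < n then Finsupp.single (some ⟨α / r, h⟩) 1 else 0

/-- The exponents of the monomial of a word. -/
noncomputable def exponents (n r : ℕ) (w : List Letter) : Option (Fin n) →₀ ℕ :=
  (w.map (exponent n r)).sum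

theorem exponents_cons (n r : ℕ) (l : Letter) (w : List Letter) :
    exponents n r (l :: w) = exponent n r l + exponents n r w := by simp [exponents]

theorem exponents_append (n r : ℕ) (u v : List Letter) :
    exponents n r (u ++ v) = exponents n r u + exponents n r v := by simp [exponents]

theorem exponents_none (n r : ℕ) (w : List Letter) : exponents n r w none = zCount w := by
  induction w with
  | nil => rfl
  | cons l w ih =>
    rw [exponents_cons, Finsupp.add_apply, ih]
    cases l with
    | x α => rw [exponent]; split_ifs <;> simp
    | _ => simp [exponent, add_comm]

theorem exponents_some (n r : ℕ) (w : List Letter) (i : Fin n) :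
    exponents n r w (some i) = ((copies w).map (· / r)).count ↑i := by
  induction w with
  | nil => rfl
  | cons l w ih =>
    rw [exponents_cons, Finsupp.add_apply, ih]
    cases l with
    | x α =>
      rw [exponent]
      split_ifs with h
      · simp [List.count_cons, Finsupp.single_apply, Fin.ext_iff, add_comm]
      · have hne : α / r ≠ i := by omega
        simp [hne]
    | _ => simp [exponent]

theorem degree_exponents_some {n r : ℕ} {w : List Letter} (h : ∀ α ∈ copies w, α / r < n) :
    (exponents n r w).some.degree = (copies w).length := by
  induction w with
  | nil => simp [exponents]
  | cons l w ih =>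
    rw [exponents_cons, Finsupp.some_add, map_add]
    cases l with
    | x α =>
      have hα : α / r < n := h α (by simp)
      rw [ih fun β hβ => h β (List.mem_cons_of_mem _ hβ)]
      simp [exponent, hα, add_comm]
    | _ => simpa [exponent] using ih h

theorem exponents_eq_iff {n r t : ℕ} {w : List Letter} {p : Fin n →₀ ℕ} :
    exponents n r w = Finsupp.single none t + p.mapDomain some ↔
      zCount w = t ∧ (exponents n r w).some = p := by
  have at_none : (Finsupp.single none t + p.mapDomain some : Option (Fin n) →₀ ℕ) none = t := by
    rw [Finsupp.add_apply, Finsupp.mapDomain_of_notMem_range _ _ (by simp)]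
    simp
  have at_some (i : Fin n) :
      (Finsupp.single none t + p.mapDomain some : Option (Fin n) →₀ ℕ) (some i) = p i := by
    rw [Finsupp.add_apply, Finsupp.mapDomain_apply (Option.some_injective _)]
    simp
  rw [Finsupp.ext_iff, Option.forall, at_none, exponents_none, Finsupp.ext_iff]
  simp only [at_some, Finsupp.some_apply]

end Letter

end Words

section FormulaWords

open Finset Letter

namespace Formula

variable {n : ℕ}

/-- The action of a formula on a block of coefficients; every variable acts through the sum of its
`r` copies. -/
noncomputable def act (R : Type*) [CommRing R] (k t r : ℕ) : Formula n → Module.End R (ℕ → R)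
  | one => Letter.one.act R k t
  | z => Letter.z.act R k t
  | x i => ∑ j ∈ range r, (Letter.x (i * r + j)).act R k t
  | mul a b => b.act R k t r ∘ₗ a.act R k t r
  | add _ f => ∑ i, (f i).act R k t r

/-- The words of a formula, one for every way to choose a summand at every `+` gate and a copy at
every variable, written from right to left. -/
def words (r : ℕ) : Formula n → List (List Letter)
  | one => [[.one]]
  | z => [[.z]]
  | x i => (List.range r).map fun j => [.x (i * r + j)]
  | mul a b => (b.words r).flatMap fun v => (a.words r).map fun u => v ++ u
  | add _ f => (List.ofFn fun i => (f i).words r).flatten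

variable {r : ℕ} {w : List Letter}

theorem mem_words_one : w ∈ (one : Formula n).words r ↔ w = [.one] := List.mem_singleton

theorem mem_words_z : w ∈ (z : Formula n).words r ↔ w = [.z] := List.mem_singleton

theorem mem_words_x {i : Fin n} : w ∈ (x i).words r ↔ ∃ j < r, w = [.x (i * r + j)] := by
  simp [words, eq_comm]

theorem mem_words_mul {a b : Formula n} :
    w ∈ (mul a b).words r ↔ ∃ v ∈ b.words r, ∃ u ∈ a.words r, w = v ++ u := by
  simp [words, eq_comm]

theorem mem_words_add {m : ℕ} {f : Fin m → Formula n} :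
    w ∈ (add m f).words r ↔ ∃ i, w ∈ (f i).words r := by
  simp [words, List.mem_ofFn]

theorem length_words_mul (a b : Formula n) :
    ((mul a b).words r).length = (b.words r).length * (a.words r).length := by
  simp [words, List.length_flatMap]

theorem length_words_add {m : ℕ} (f : Fin m → Formula n) :
    ((add m f).words r).length = ∑ i, ((f i).words r).length := by
  simp [words, List.length_flatten, List.map_ofFn, List.sum_ofFn]

theorem length_encode_add {m : ℕ} (f : Fin m → Formula n) :
    (add m f).encode.length = ∑ i, (f i).encode.length + 2 := by
  simp [encode, List.length_flatten, List.map_ofFn, List.sum_ofFn]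

theorem length_encode_pos (φ : Formula n) : 0 < φ.encode.length := by
  cases φ <;> simp [encode]

theorem act_eq_sum_words (R : Type*) [CommRing R] (k t r : ℕ) (φ : Formula n) :
    φ.act R k t r = ((φ.words r).map (wordAct R k t)).sum := by
  induction φ with
  | one => simp [words, act, wordAct]
  | z => simp [words, act, wordAct]
  | x i =>
    rw [words, act, List.map_map]
    simp only [Function.comp_def, wordAct, List.map_singleton, List.prod_singleton]
    rfl
  | mul a b iha ihb =>
    rw [act, iha, ihb, words, ← Module.End.mul_eq_comp, List.flatMap, List.map_flatten,
      List.sum_flatten, ← List.sum_map_mul_right]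
    simp only [List.map_map, Function.comp_def, wordAct_append, List.sum_map_mul_left]
  | add m f ih =>
    rw [act, words, List.map_flatten, List.sum_flatten, List.map_map, List.map_ofFn, List.sum_ofFn]
    exact sum_congr rfl fun i _ => ih i

end Formula

theorem sum_add_one_le_pow {ι : Type*} {s : Finset ι} {a e : ι → ℕ} {B : ℕ} (hB : 2 ≤ B)
    (he : ∀ i ∈ s, 0 < e i) (ha : ∀ i ∈ s, a i ≤ B ^ e i) :
    ∑ i ∈ s, a i + 1 ≤ B ^ (1 + ∑ i ∈ s, e i) := by
  classical
  induction s using Finset.induction_on with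
  | empty => simp; omega
  | insert i s hi ih =>
    rw [forall_mem_insert] at he ha
    rw [sum_insert hi, sum_insert hi, add_left_comm, pow_add]
    have hs := ih he.2 ha.2
    have hi : B ≤ B ^ e i := Nat.le_self_pow he.1.ne' B
    have hs' : B ≤ B ^ (1 + ∑ i ∈ s, e i) := Nat.le_self_pow (by omega) B
    nlinarith [ha.1]

theorem mul_add_div_eq {r j : ℕ} (i : ℕ) (hj : j < r) : (i * r + j) / r = i := by
  rw [mul_comm, Nat.mul_add_div (by omega), Nat.div_eq_of_lt hj, add_zero]

namespace Formula

variable {n r : ℕ} {w : List Letter}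

theorem length_words_le {B : ℕ} (hr : r ≤ B) (hB : 2 ≤ B) (φ : Formula n) :
    (φ.words r).length ≤ B ^ φ.encode.length := by
  induction φ with
  | one => simpa [words, encode] using (by omega : 1 ≤ B)
  | z => simpa [words, encode] using (by omega : 1 ≤ B)
  | x i => simpa [words, encode] using hr.trans (Nat.le_self_pow two_ne_zero B)
  | mul a b iha ihb =>
    rw [length_words_mul, encode, List.length_cons, List.length_append]
    calc _ ≤ B ^ b.encode.length * B ^ a.encode.length := Nat.mul_le_mul ihb iha
      _ = B ^ (a.encode.length + b.encode.length) := by rw [← pow_add, add_comm]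
      _ ≤ _ := Nat.pow_le_pow_right (by omega) (by omega)
  | add m f ih =>
    rw [length_words_add, length_encode_add]
    calc _ ≤ ∑ i, ((f i).words r).length + 1 := Nat.le_succ _
      _ ≤ B ^ (1 + ∑ i, (f i).encode.length) :=
        sum_add_one_le_pow hB (fun i _ => (f i).length_encode_pos) fun i _ => ih i
      _ ≤ _ := Nat.pow_le_pow_right (by omega) (by omega)

theorem lt_of_mem_words (φ : Formula n) (hw : w ∈ φ.words r) : ∀ α ∈ copies w, α < n * r := by
  induction φ generalizing w with
  | one => simp [mem_words_one.1 hw]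
  | z => simp [mem_words_z.1 hw]
  | x i =>
    obtain ⟨j, hj, rfl⟩ := mem_words_x.1 hw
    have hi : (i + 1) * r ≤ n * r := Nat.mul_le_mul_right r i.2
    simp only [copies, List.mem_singleton, forall_eq]
    linarith
  | mul a b iha ihb =>
    obtain ⟨v, hv, u, hu, rfl⟩ := mem_words_mul.1 hw
    simpa only [copies_append, List.forall_mem_append] using ⟨ihb hv, iha hu⟩
  | add m f ih =>
    obtain ⟨i, hi⟩ := mem_words_add.1 hw
    exact ih i hi

theorem mem_words_of_map_terminal_eq (φ : Formula n) {w' : List Letter}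
    (h : w'.map (terminal r) = w.map (terminal r)) (hw : w ∈ φ.words r) : w' ∈ φ.words r := by
  induction φ generalizing w w' with
  | one =>
    obtain rfl := mem_words_one.1 hw
    obtain ⟨l, rfl, hl⟩ := List.map_eq_singleton_iff.1 h
    cases l <;> simp_all [mem_words_one]
  | z =>
    obtain rfl := mem_words_z.1 hw
    obtain ⟨l, rfl, hl⟩ := List.map_eq_singleton_iff.1 h
    cases l <;> simp_all [mem_words_z]
  | x i =>
    obtain ⟨j, hj, rfl⟩ := mem_words_x.1 hw
    obtain ⟨l, rfl, hl⟩ := List.map_eq_singleton_iff.1 h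
    cases l with
    | x α =>
      rw [terminal, terminal, mul_add_div_eq _ hj, Letter.x.injEq] at hl
      exact mem_words_x.2 ⟨α % r, Nat.mod_lt _ (by omega), by rw [← hl, Nat.div_add_mod']⟩
    | _ => simp at hl
  | mul a b iha ihb =>
    obtain ⟨v, hv, u, hu, rfl⟩ := mem_words_mul.1 hw
    rw [List.map_append] at h
    obtain ⟨v', u', rfl, hv', hu'⟩ := List.map_eq_append_iff.1 h
    exact mem_words_mul.2 ⟨v', ihb hv' hv, u', iha hu' hu, rfl⟩
  | add m f ih =>
    obtain ⟨i, hi⟩ := mem_words_add.1 hw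
    exact mem_words_add.2 ⟨i, ih i h hi⟩

theorem coeff_poly_nonneg (φ : Formula n) (μ : Option (Fin n) →₀ ℕ) : 0 ≤ φ.poly.coeff μ := by
  induction φ generalizing μ with
  | one => rw [poly, MvPolynomial.coeff_one]; split_ifs <;> simp
  | z => rw [poly, MvPolynomial.coeff_X]; split_ifs <;> simp
  | x i => rw [poly, MvPolynomial.coeff_X]; split_ifs <;> simp
  | mul a b iha ihb =>
    rw [poly, MvPolynomial.coeff_mul]
    exact sum_nonneg fun _ _ => mul_nonneg (iha _) (ihb _)
  | add m f ih =>
    rw [poly, MvPolynomial.coeff_sum]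
    exact sum_nonneg fun i _ => ih i μ

theorem exists_mem_words_x_iff (hr : 0 < r) (i : Fin n) (μ : Option (Fin n) →₀ ℕ) :
    (∃ w ∈ (x i).words r, exponents n r w = μ) ↔ Finsupp.single (some i) 1 = μ := by
  have exponents_copy {j : ℕ} (hj : j < r) :
      exponents n r [.x (i * r + j)] = Finsupp.single (some i) 1 := by
    simp [exponents, exponent, mul_add_div_eq _ hj]
  constructor
  · rintro ⟨w, hw, rfl⟩
    obtain ⟨j, hj, rfl⟩ := mem_words_x.1 hw
    exact (exponents_copy hj).symm
  · rintro rfl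
    exact ⟨_, mem_words_x.2 ⟨0, hr, rfl⟩, exponents_copy hr⟩

/-- Nothing cancels in the expansion, since no coefficient is negative. -/
theorem coeff_poly_ne_zero_iff (hr : 0 < r) (φ : Formula n) (μ : Option (Fin n) →₀ ℕ) :
    φ.poly.coeff μ ≠ 0 ↔ ∃ w ∈ φ.words r, exponents n r w = μ := by
  induction φ generalizing μ with
  | one => simp [poly, MvPolynomial.coeff_one, mem_words_one, exponents, exponent]
  | z => simp [poly, MvPolynomial.coeff_X, mem_words_z, exponents, exponent]
  | x i => simp [poly, MvPolynomial.coeff_X, exists_mem_words_x_iff hr]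
  | mul a b iha ihb =>
    rw [poly, MvPolynomial.coeff_mul, ne_eq, sum_eq_zero_iff_of_nonneg
      fun _ _ => mul_nonneg (a.coeff_poly_nonneg _) (b.coeff_poly_nonneg _)]
    push Not
    simp only [mul_ne_zero_iff, iha, ihb, Prod.exists, HasAntidiagonal.mem_antidiagonal]
    constructor
    · rintro ⟨_, _, rfl, ⟨u, hu, rfl⟩, v, hv, rfl⟩
      exact ⟨v ++ u, mem_words_mul.2 ⟨v, hv, u, hu, rfl⟩, by rw [exponents_append, add_comm]⟩
    · rintro ⟨w, hw, rfl⟩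
      obtain ⟨v, hv, u, hu, rfl⟩ := mem_words_mul.1 hw
      exact ⟨_, _, by rw [exponents_append, add_comm], ⟨u, hu, rfl⟩, v, hv, rfl⟩
  | add m f ih =>
    rw [poly, MvPolynomial.coeff_sum, ne_eq, sum_eq_zero_iff_of_nonneg
      fun i _ => (f i).coeff_poly_nonneg μ]
    push Not
    simp only [mem_univ, true_and, ih, mem_words_add]
    exact ⟨fun ⟨i, w, hw, h⟩ => ⟨w, ⟨i, hw⟩, h⟩, fun ⟨w, ⟨i, hw⟩, h⟩ => ⟨i, w, hw, h⟩⟩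

variable {q k t : ℕ}

theorem div_lt_of_mem_words (hr : 0 < r) (φ : Formula n) (hw : w ∈ φ.words r) :
    ∀ α ∈ copies w, α / r < n := fun α hα =>
  (Nat.div_lt_iff_lt_mul hr).2 (φ.lt_of_mem_words hw α hα)

theorem mem_support_poly_iff (hr : 0 < r) (φ : Formula n) (p : Fin n →₀ ℕ) :
    Finsupp.single none t + p.mapDomain some ∈ φ.poly.support ↔
      ∃ w ∈ φ.words r, zCount w = t ∧ (exponents n r w).some = p := by
  rw [MvPolynomial.mem_support_iff, coeff_poly_ne_zero_iff hr]
  simp only [exponents_eq_iff]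

/-- The machine may look for words without repeated copies: a variable of exponent at most `q - 1`
has enough copies for its occurrences to be told apart. -/
theorem hasMarkedQMonomial_iff (hq : 2 ≤ q) (φ : Formula n) :
    HasMarkedQMonomial q k t φ.poly ↔
      ∃ w ∈ φ.words (q - 1), zCount w = t ∧ (copies w).length = k ∧ (copies w).Nodup := by
  have hr : 0 < q - 1 := by omega
  simp only [HasMarkedQMonomial, φ.mem_support_poly_iff hr]
  constructor
  · rintro ⟨_, hp, hk, w, hw, ht, rfl⟩
    have hdiv := φ.div_lt_of_mem_words hr hw
    rw [degree_exponents_some hdiv] at hk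
    have hcount (i : ℕ) : ((copies w).map (· / (q - 1))).count i ≤ q - 1 := by
      by_contra! hi
      obtain ⟨α, hα, rfl⟩ := List.mem_map.1 (List.count_pos_iff.1 (hr.trans hi))
      have hpα := hp ⟨α / (q - 1), hdiv α hα⟩
      rw [Finsupp.mem_support_iff, Finsupp.some_apply, exponents_some] at hpα
      exact hi.not_ge (hpα (hr.trans hi).ne').2
    obtain ⟨w', hw', hnodup⟩ := exists_map_terminal_eq_nodup w hcount
    refine ⟨w', φ.mem_words_of_map_terminal_eq hw' hw, ?_, ?_, hnodup⟩
    · rw [← zCount_map_terminal, hw', zCount_map_terminal, ht]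
    · simpa [copies_map_terminal, hk] using congrArg (fun u => (copies u).length) hw'
  · rintro ⟨w, hw, ht, hk, hnodup⟩
    refine ⟨_, fun i hi => ⟨Nat.one_le_iff_ne_zero.2 (Finsupp.mem_support_iff.1 hi), ?_⟩,
      (degree_exponents_some (φ.div_lt_of_mem_words hr hw)).trans hk, w, hw, ht, rfl⟩
    rw [Finsupp.some_apply, exponents_some]
    exact count_map_div_le hr hnodup i

/-- The contribution of a word to the top cell of the block. It is a square because both exterior
algebras receive the same product, so that contributions of different words cannot cancel. -/
def wordValue (k t : ℕ) (w : List Letter) : ℤ :=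
  if t = zCount w then wedgeCoeff ℤ (copies w) (range k) ^ 2 else 0

theorem wordValue_nonneg : 0 ≤ wordValue k t w := by
  rw [wordValue]
  split_ifs <;> positivity

theorem wordValue_le {B : ℕ} (hw : ∀ α ∈ copies w, α ≤ B) (hB : 0 < B) :
    wordValue k t w ≤ (B : ℤ) ^ (2 * (k * k)) := by
  rw [wordValue]
  split_ifs
  · exact wedgeCoeff_range_sq_le hw hB
  · positivity

theorem wordValue_eq_zero_iff :
    wordValue k t w = 0 ↔ ¬ (zCount w = t ∧ (copies w).length = k ∧ (copies w).Nodup) := by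
  rw [wordValue, ite_eq_right_iff, sq_eq_zero_iff, eq_comm (a := t), ← wedgeCoeff_range_ne_zero_iff,
    not_and, not_not]

theorem act_apply_top_cell (R : Type*) [CommRing R] (k t r : ℕ) (φ : Formula n) :
    φ.act R k t r (Pi.single 0 1) (cell k t (range k) (range k)) =
      (((φ.words r).map (wordValue k t)).sum : ℤ) := by
  rw [act_eq_sum_words]
  induction φ.words r with
  | nil => simp
  | cons w L ih =>
    rw [List.map_cons, List.sum_cons, LinearMap.add_apply, Pi.add_apply, ih, List.map_cons,
      List.sum_cons, Int.cast_add, wordAct_apply_cell R w le_rfl subset_rfl subset_rfl, wordValue]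
    congr 1
    split_ifs
    · rw [Int.cast_pow, intCast_wedgeCoeff, one_mul, pow_two]
    · rw [zero_mul, Int.cast_zero]

theorem sum_wordValue_le {B : ℕ} (φ : Formula n) (hrn : n * r ≤ B) (hr : r ≤ B) (hB : 2 ≤ B) :
    ((φ.words r).map (wordValue k t)).sum ≤ (B : ℤ) ^ (φ.encode.length + 2 * (k * k)) := by
  have hword : ∀ v ∈ (φ.words r).map (wordValue k t), v ≤ (B : ℤ) ^ (2 * (k * k)) := by
    simp only [List.forall_mem_map]
    exact fun w hw =>
      wordValue_le (fun α hα => (φ.lt_of_mem_words hw α hα).le.trans hrn) (by omega)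
  calc ((φ.words r).map (wordValue k t)).sum
      ≤ ((φ.words r).length : ℤ) * (B : ℤ) ^ (2 * (k * k)) := by
        simpa using List.sum_le_card_nsmul _ _ hword
    _ ≤ (B : ℤ) ^ φ.encode.length * (B : ℤ) ^ (2 * (k * k)) := by
        gcongr
        exact_mod_cast φ.length_words_le hr hB
    _ = (B : ℤ) ^ (φ.encode.length + 2 * (k * k)) := (pow_add _ _ _).symm

theorem sum_wordValue_eq_zero_iff (L : List (List Letter)) :
    (L.map (wordValue k t)).sum = 0 ↔ ∀ w ∈ L, wordValue k t w = 0 := by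
  induction L with
  | nil => simp
  | cons w L ih =>
    have hL : 0 ≤ (L.map (wordValue k t)).sum := List.sum_nonneg (by simp [wordValue_nonneg])
    rw [List.map_cons, List.sum_cons, List.forall_mem_cons,
      add_eq_zero_iff_of_nonneg wordValue_nonneg hL, ih]

theorem act_apply_top_cell_eq_zero_iff {M B : ℕ} (hq : 2 ≤ q) (φ : Formula n)
    (hB : n * (q - 1) ≤ B) (hqB : q ≤ B) (hM : B ^ (φ.encode.length + 2 * (k * k)) < M) :
    φ.act (ZMod M) k t (q - 1) (Pi.single 0 1) (cell k t (range k) (range k)) = 0 ↔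
      ¬ HasMarkedQMonomial q k t φ.poly := by
  have hlt : ((φ.words (q - 1)).map (wordValue k t)).sum < M :=
    (φ.sum_wordValue_le hB (by omega) (by omega)).trans_lt (by exact_mod_cast hM)
  have hnonneg : 0 ≤ ((φ.words (q - 1)).map (wordValue k t)).sum :=
    List.sum_nonneg (by simp [wordValue_nonneg])
  have hdvd : (M : ℤ) ∣ ((φ.words (q - 1)).map (wordValue k t)).sum ↔
      ((φ.words (q - 1)).map (wordValue k t)).sum = 0 :=
    ⟨Int.eq_zero_of_dvd_of_nonneg_of_lt hnonneg hlt, fun h => h ▸ dvd_zero _⟩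
  rw [act_apply_top_cell, ZMod.intCast_zmod_eq_zero_iff_dvd, hdvd, sum_wordValue_eq_zero_iff,
    hasMarkedQMonomial_iff hq]
  simp only [wordValue_eq_zero_iff, not_exists, not_and]

end Formula

end FormulaWords

section EncodingLength

open Finset

namespace Formula

theorem length_le_length_flatten_encode {n : ℕ} (L : List (Formula n)) :
    L.length ≤ (L.map encode).flatten.length := by
  induction L with
  | nil => exact Nat.zero_le _
  | cons φ L ih =>
    have := φ.length_encode_pos
    simp only [List.map_cons, List.flatten_cons, List.length_append, List.length_cons]
    omega

theorem le_of_mem_encode {n a : ℕ} {φ : Formula n} (ha : a ∈ φ.encode) :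
    a ≤ n + φ.encode.length + 4 := by
  induction φ with
  | one => simp_all [encode]
  | z => simp_all [encode]
  | x i =>
    have := i.2
    simp only [encode, List.mem_cons, List.not_mem_nil, or_false, List.length_cons,
      List.length_nil] at ha ⊢
    omega
  | mul φ ψ ihφ ihψ =>
    simp only [encode, List.mem_cons, List.mem_append, List.length_cons, List.length_append] at ha ⊢
    rcases ha with rfl | ha | ha
    · omega
    · have := ihφ ha
      omega
    · have := ihψ ha
      omega
  | add m f ih =>
    rw [length_encode_add]
    simp only [encode, List.mem_cons, List.mem_flatten, List.mem_ofFn'] at ha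
    rcases ha with rfl | rfl | ⟨_, ⟨i, rfl⟩, ha⟩
    · omega
    · have : a ≤ ∑ i, (f i).encode.length := by
        simpa using sum_le_sum fun i (_ : i ∈ univ) => Nat.succ_le_of_lt (f i).length_encode_pos
      omega
    · have : (f i).encode.length ≤ ∑ i, (f i).encode.length :=
        single_le_sum (f := fun i => (f i).encode.length) (fun _ _ => Nat.zero_le _) (mem_univ i)
      have := ih i ha
      omega

theorem card_terminal_le {n m : ℕ} {f : Fin m → Formula n} (h : (add m f).IsSimple) :
    #{i | (f i).size = 0} ≤ n + 2 := by
  let name : Formula n → Option (Option (Fin n))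
    | z => some none
    | x i => some (some i)
    | _ => none
  have name_inj : ∀ φ ψ : Formula n, φ.size = 0 → ψ.size = 0 → name φ = name ψ → φ = ψ := by
    intro φ ψ hφ hψ
    cases φ <;> cases ψ <;> simp_all [name, size]
  calc #{i | (f i).size = 0} ≤ #(univ : Finset (Option (Option (Fin n)))) := by
        refine card_le_card_of_injOn (fun i => name (f i)) (fun _ _ => mem_univ _) ?_
        intro i hi j hj hij
        simp only [coe_filter, mem_univ, true_and, Set.mem_ofPred_eq] at hi hj
        exact h.2 i j hi (name_inj _ _ hi hj hij)
    _ = n + 2 := by simp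

theorem length_encode_le {n : ℕ} {φ : Formula n} (h : φ.IsSimple) :
    φ.encode.length ≤ (2 * n + 6) * φ.size + if φ.size = 0 then 2 else 0 := by
  induction φ with
  | one => simp [encode, size]
  | z => simp [encode, size]
  | x i => simp [encode, size]
  | mul φ ψ ihφ ihψ =>
    have hlength : (mul φ ψ).encode.length = φ.encode.length + ψ.encode.length + 1 := by
      simp [encode]
    have hφ := ihφ h.1
    have hψ := ihψ h.2
    have : (if φ.size = 0 then 2 else 0) ≤ 2 := by split_ifs <;> omega
    have : (if ψ.size = 0 then 2 else 0) ≤ 2 := by split_ifs <;> omega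
    rw [hlength, size, if_neg (by omega)]
    nlinarith
  | add m f ih =>
    have hsum : ∑ i, (f i).encode.length ≤
        ∑ i, ((2 * n + 6) * (f i).size + if (f i).size = 0 then 2 else 0) :=
      sum_le_sum fun i _ => ih i (h.1 i)
    rw [sum_add_distrib, ← mul_sum, ← sum_filter, sum_const, smul_eq_mul] at hsum
    have := card_terminal_le h
    rw [length_encode_add, size, if_neg (by omega), mul_add]
    omega

theorem length_encode_le_mul {n : ℕ} {φ : Formula n} (h : φ.IsSimple) :
    φ.encode.length ≤ (2 * n + 6) * max φ.size 1 := by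
  refine (length_encode_le h).trans ?_
  split_ifs with h0
  · rw [h0, max_eq_right zero_le_one]
    omega
  · rw [max_eq_left (by omega), add_zero]

end Formula

end EncodingLength

namespace RAM

theorem len_mono {a b : ℕ} (h : a ≤ b) : len a ≤ len b :=
  Nat.add_le_add_right (Nat.size_le_size h) 1

theorem two_le_len {a : ℕ} (h : 0 < a) : 2 ≤ len a :=
  Nat.succ_le_succ (Nat.size_pos.2 h)

theorem len_le_sq {Y a : ℕ} (h : a < Y) : len a ≤ len Y ^ 2 := by
  have := len_mono h.le
  nlinarith [two_le_len (Nat.zero_lt_of_lt h)]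

theorem len_add_len_le_sq {Y a b : ℕ} (ha : a < Y) (hb : b < Y) : len a + len b ≤ len Y ^ 2 := by
  have := len_mono ha.le
  have := len_mono hb.le
  nlinarith [two_le_len (Nat.zero_lt_of_lt ha)]

theorem Op.cost_le_sq {Y a b : ℕ} (o : Op) (ha : a < Y) (hb : b < Y) : o.cost a b ≤ len Y ^ 2 := by
  have hmul : len a * len b ≤ len Y ^ 2 := by
    rw [pow_two]
    exact Nat.mul_le_mul (len_mono ha.le) (len_mono hb.le)
  cases o
  exacts [len_add_len_le_sq ha hb, len_add_len_le_sq ha hb, hmul, hmul]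

namespace State

@[simp] theorem setReg_reg (s : State) (r v x : ℕ) :
    (s.setReg r v).reg x = if x = r then v else s.reg x :=
  Function.update_apply ..

@[simp] theorem setReg_mem (s : State) (r v : ℕ) : (s.setReg r v).mem = s.mem := rfl

@[simp] theorem setMem_reg (s : State) (a v : ℕ) : (s.setMem a v).reg = s.reg := rfl

@[simp] theorem setMem_mem (s : State) (a v : ℕ) :
    (s.setMem a v).mem = Function.update s.mem a v := rfl

theorem setReg_eq_self {s : State} {r v : ℕ} (h : s.reg r = v) : s.setReg r v = s := by
  rw [setReg, ← h, Function.update_eq_self]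

theorem setReg_setReg (s : State) (r v w : ℕ) : (s.setReg r v).setReg r w = s.setReg r w := by
  simp only [setReg, Function.update_idem]

/-- All registers and memory cells hold numbers below `Y`; such a state charges at most `len Y ^ 2`
for a step. -/
structure Bounded (Y : ℕ) (s : State) : Prop where
  reg_lt (r : ℕ) : s.reg r < Y
  mem_lt (a : ℕ) : s.mem a < Y

theorem Bounded.setReg {Y : ℕ} {s : State} (h : s.Bounded Y) {r v : ℕ} (hv : v < Y) :
    (s.setReg r v).Bounded Y where
  reg_lt x := by
    rw [setReg_reg]
    split_ifs
    exacts [hv, h.reg_lt x]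
  mem_lt := h.mem_lt

theorem Bounded.setMem {Y : ℕ} {s : State} (h : s.Bounded Y) {a v : ℕ} (hv : v < Y) :
    (s.setMem a v).Bounded Y where
  reg_lt := h.reg_lt
  mem_lt x := by
    rw [setMem_mem, Function.update_apply]
    split_ifs
    exacts [hv, h.mem_lt x]

end State

/-- From a state with all numbers below `Y`, the program halts in such a state, after `N` steps of
cost at most `len Y ^ 2` each, and the final state and `N` satisfy `Q`. -/
def HaltsWith (Y : ℕ) (P : Prog) (s : State) (Q : State → ℕ → Prop) : Prop :=
  s.Bounded Y → ∃ s' N T, Exec P s s' T ∧ T ≤ N * len Y ^ 2 ∧ s'.Bounded Y ∧ Q s' N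

theorem HaltsWith.mono {Y : ℕ} {P : Prog} {s : State} {Q Q' : State → ℕ → Prop}
    (h : HaltsWith Y P s Q) (hQ : ∀ s' n, s'.Bounded Y → Q s' n → Q' s' n) :
    HaltsWith Y P s Q' := fun hs => by
  obtain ⟨s', N, T, exec, cost, hs', hfinal⟩ := h hs
  exact ⟨s', N, T, exec, cost, hs', hQ _ _ hs' hfinal⟩

/-- A weakest precondition for `HaltsWith`, computed along the structure of the program down to its
loops. -/
def Prog.wp (Y : ℕ) : Prog → State → (State → ℕ → Prop) → Prop
  | .skip, s, Q => Q s 1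
  | .const r c, s, Q => c < Y ∧ Q (s.setReg r c) 1
  | .op .add r a b, s, Q => s.reg a + s.reg b < Y ∧ Q (s.setReg r (s.reg a + s.reg b)) 1
  | .op .mul r a b, s, Q => s.reg a * s.reg b < Y ∧ Q (s.setReg r (s.reg a * s.reg b)) 1
  | .op .sub r a b, s, Q => Q (s.setReg r (s.reg a - s.reg b)) 1
  | .op .div r a b, s, Q => Q (s.setReg r (s.reg a / s.reg b)) 1
  | .load r a, s, Q => Q (s.setReg r (s.mem (s.reg a))) 1
  | .store a r, s, Q => Q (s.setMem (s.reg a) (s.reg r)) 1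
  | .seq P R, s, Q => P.wp Y s fun s₁ n₁ => R.wp Y s₁ fun s₂ n₂ => Q s₂ (n₁ + n₂)
  | .ite r P R, s, Q => (s.reg r ≠ 0 → P.wp Y s fun s' n => Q s' (n + 1)) ∧
      (s.reg r = 0 → R.wp Y s fun s' n => Q s' (n + 1))
  | .loop r P, s, Q => HaltsWith Y (.loop r P) s Q

section

variable {Y r : ℕ} {P : Prog} {s : State} {Q Q' : State → ℕ → Prop}

theorem Prog.wp_op_eval {o : Op} {r a b : ℕ} (hs : s.Bounded Y) (h : (Prog.op o r a b).wp Y s Q) :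
    o.eval (s.reg a) (s.reg b) < Y ∧ Q (s.setReg r (o.eval (s.reg a) (s.reg b))) 1 := by
  cases o with
  | add => exact h
  | mul => exact h
  | sub => exact ⟨(Nat.sub_le _ _).trans_lt (hs.reg_lt a), h⟩
  | div => exact ⟨(Nat.div_le_self _ _).trans_lt (hs.reg_lt a), h⟩

theorem Prog.haltsWith_of_wp (h : P.wp Y s Q) : HaltsWith Y P s Q := by
  intro hs
  have one_step {a} (ha : a ≤ len Y ^ 2) : a ≤ 1 * len Y ^ 2 := by rwa [one_mul]
  induction P generalizing s Q with
  | skip =>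
    have := two_le_len (Nat.zero_lt_of_lt (hs.reg_lt 0))
    exact ⟨s, 1, 1, .skip s, one_step (by nlinarith), hs, h⟩
  | const r c =>
    exact ⟨_, 1, _, .const s r c, one_step (len_le_sq h.1), hs.setReg h.1, h.2⟩
  | op o r a b =>
    obtain ⟨hlt, hQ⟩ := wp_op_eval hs h
    exact ⟨_, 1, _, .op s o r a b, one_step (o.cost_le_sq (hs.reg_lt a) (hs.reg_lt b)),
      hs.setReg hlt, hQ⟩
  | load r a =>
    exact ⟨_, 1, _, .load s r a, one_step (len_add_len_le_sq (hs.reg_lt _) (hs.mem_lt _)),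
      hs.setReg (hs.mem_lt _), h⟩
  | store a r =>
    exact ⟨_, 1, _, .store s a r, one_step (len_add_len_le_sq (hs.reg_lt _) (hs.reg_lt _)),
      hs.setMem (hs.reg_lt _), h⟩
  | seq P R ihP ihR =>
    obtain ⟨s₁, N₁, T₁, exec₁, cost₁, hs₁, h₁⟩ := ihP h hs
    obtain ⟨s₂, N₂, T₂, exec₂, cost₂, hs₂, h₂⟩ := ihR h₁ hs₁
    exact ⟨s₂, N₁ + N₂, _, .seq exec₁ exec₂, by rw [add_mul]; omega, hs₂, h₂⟩
  | ite r P R ihP ihR =>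
    have := len_le_sq (hs.reg_lt r)
    by_cases h0 : s.reg r = 0
    · obtain ⟨s', N, T, exec, cost, hs', h'⟩ := ihR (h.2 h0) hs
      exact ⟨s', N + 1, _, .ite_false h0 exec, by rw [add_mul]; omega, hs', h'⟩
    · obtain ⟨s', N, T, exec, cost, hs', h'⟩ := ihP (h.1 h0) hs
      exact ⟨s', N + 1, _, .ite_true h0 exec, by rw [add_mul]; omega, hs', h'⟩
  | loop r P => exact h hs

theorem Prog.wp_mono (hs : s.Bounded Y) (h : P.wp Y s Q)
    (hQ : ∀ s' n, s'.Bounded Y → Q s' n → Q' s' n) : P.wp Y s Q' := by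
  induction P generalizing s Q Q' with
  | skip => exact hQ _ _ hs h
  | const r c => exact ⟨h.1, hQ _ _ (hs.setReg h.1) h.2⟩
  | op o r a b =>
    have h' := wp_op_eval hs h
    have hQ' := hQ _ _ (hs.setReg h'.1) h'.2
    cases o
    exacts [⟨h.1, hQ'⟩, hQ', ⟨h.1, hQ'⟩, hQ']
  | load r a => exact hQ _ _ (hs.setReg (hs.mem_lt _)) h
  | store a r => exact hQ _ _ (hs.setMem (hs.reg_lt _)) h
  | seq P R ihP ihR =>
    exact ihP hs h fun s₁ n₁ h₁ h' => ihR h₁ h' fun s₂ n₂ h₂ h'' => hQ _ _ h₂ h''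
  | ite r P R ihP ihR =>
    exact ⟨fun h0 => ihP hs (h.1 h0) fun _ _ => hQ _ _, fun h0 => ihR hs (h.2 h0) fun _ _ => hQ _ _⟩
  | loop r P => exact HaltsWith.mono h hQ

theorem HaltsWith.loop_done (h0 : s.reg r = 0) (h : Q s 1) : HaltsWith Y (.loop r P) s Q :=
  fun hs => ⟨s, 1, _, .loop_done h0, by rw [one_mul]; exact len_le_sq (hs.reg_lt r), hs, h⟩

theorem HaltsWith.loop_step (h0 : s.reg r ≠ 0)
    (h : s.Bounded Y → P.wp Y s fun s₁ n₁ =>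
      HaltsWith Y (.loop r P) s₁ fun s₂ n₂ => Q s₂ (1 + n₁ + n₂)) :
    HaltsWith Y (.loop r P) s Q := fun hs => by
  obtain ⟨s₁, N₁, T₁, exec₁, cost₁, hs₁, h₁⟩ := Prog.haltsWith_of_wp (h hs) hs
  obtain ⟨s₂, N₂, T₂, exec₂, cost₂, hs₂, h₂⟩ := h₁ hs₁
  have := len_le_sq (hs.reg_lt r)
  exact ⟨s₂, _, _, .loop_step h0 exec₁ exec₂, by rw [add_mul, add_mul]; omega, hs₂, h₂⟩

theorem HaltsWith.countdown (Inv : ℕ → State → Prop) (b N : ℕ)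
    (hr : ∀ i s, Inv i s → s.reg r = i)
    (hb : ∀ i s, i < N → Inv (i + 1) s → s.Bounded Y → P.wp Y s fun s' n => Inv i s' ∧ n ≤ b)
    (h0 : Inv N s) (hQ : ∀ s' n, Inv 0 s' → n ≤ N * (b + 1) + 1 → Q s' n) :
    HaltsWith Y (.loop r P) s Q := by
  induction N generalizing s Q with
  | zero => exact .loop_done (hr _ _ h0) (hQ _ _ h0 (by omega))
  | succ N ih =>
    have hr0 := hr _ _ h0
    refine .loop_step (by omega) fun hs => Prog.wp_mono hs (hb N s (by omega) h0 hs) ?_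
    rintro s₁ n₁ - ⟨h₁, hn₁⟩
    refine ih (fun i s hi => hb i s (by omega)) h₁ fun s₂ n₂ h₂ hn₂ => hQ _ _ h₂ ?_
    rw [add_mul]
    omega

end

end RAM

section Programs

local infixr:60 ";;" => RAM.Prog.seq
local notation "rZero" => (0 : ℕ)
local notation "rN" => (1 : ℕ)
local notation "rK" => (2 : ℕ)
local notation "rT" => (3 : ℕ)
local notation "rQPred" => (4 : ℕ)
local notation "rOne" => (5 : ℕ)
local notation "rTwo" => (6 : ℕ)
local notation "rMod" => (7 : ℕ)
local notation "rTwoPowK" => (8 : ℕ)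
local notation "rFourPowK" => (9 : ℕ)
local notation "rSources" => (10 : ℕ)
local notation "rBlock" => (11 : ℕ)
local notation "rLen" => (12 : ℕ)
local notation "rPtr" => (14 : ℕ)
local notation "rDepth" => (15 : ℕ)
local notation "rNext" => (16 : ℕ)
local notation "rFrom" => (17 : ℕ)
local notation "rTo" => (18 : ℕ)
local notation "rToken" => (19 : ℕ)
local notation "rSrc" => (20 : ℕ)
local notation "rDst" => (21 : ℕ)
local notation "rPos" => (22 : ℕ)
local notation "rOff" => (23 : ℕ)
local notation "rLetter" => (24 : ℕ)
local notation "rCount" => (25 : ℕ)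
local notation "rCell" => (26 : ℕ)
local notation "rVal" => (27 : ℕ)
local notation "rBit" => (28 : ℕ)
local notation "rShift" => (29 : ℕ)
local notation "rPow" => (30 : ℕ)
local notation "rIter" => (31 : ℕ)
local notation "rTmp₁" => (32 : ℕ)
local notation "rTmp₂" => (33 : ℕ)
local notation "rTmp₃" => (34 : ℕ)
local notation "rStack" => (35 : ℕ)
local notation "rNode" => (36 : ℕ)
local notation "rFirst" => (37 : ℕ)
local notation "rIndex" => (38 : ℕ)
local notation "rArg" => (39 : ℕ)

section Edges

open Finset EdgeLabel

namespace RAM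

/-- The body of the inner loop of `edge`: the `j`-th summand of `EdgeLabel.scatter`. -/
def edgeStep : Prog :=
  .op .sub rIter rIter rOne ;;
  .op .div rTmp₁ rCell rBit ;; .op .div rTmp₂ rTmp₁ rTwo ;; .op .mul rTmp₂ rTmp₂ rTwo ;;
  .op .sub rTmp₁ rTmp₁ rTmp₂ ;;
  .ite rTmp₁ (.op .sub rVal rMod rVal)
    (.op .add rTmp₁ rDst rCell ;; .op .add rTmp₁ rTmp₁ rShift ;; .load rTmp₂ rTmp₁ ;;
      .op .mul rTmp₃ rVal rPow ;; .op .add rTmp₂ rTmp₂ rTmp₃ ;;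
      .op .div rTmp₃ rTmp₂ rMod ;; .op .mul rTmp₃ rTmp₃ rMod ;; .op .sub rTmp₂ rTmp₂ rTmp₃ ;;
      .store rTmp₁ rTmp₂) ;;
  .op .mul rBit rBit rTwo ;; .op .mul rShift rShift rTwo ;; .op .mul rPow rPow rLetter

/-- The body of the outer loop of `edge`: `EdgeLabel.scatter` at one cell. -/
def edgeCell : Prog :=
  .op .sub rCell rCell rOne ;; .op .add rTmp₁ rSrc rCell ;; .load rVal rTmp₁ ;;
  .op .add rBit rPos rZero ;; .op .add rShift rOff rZero ;; .const rPow 1 ;;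
  .op .add rIter rCount rZero ;; .loop rIter edgeStep

/-- Applies the edge label given by the registers `rPos`, `rOff`, `rLetter` and `rCount` to the
block at the address `rSrc`, and adds the result to the block at the address `rDst`. -/
def edge : Prog :=
  .op .add rCell rSources rZero ;; .loop rCell edgeCell

/-- From the address `lo` on, the memory cells hold the residues below `M` given by `m`. -/
def Cells (lo M : ℕ) (mem : ℕ → ℕ) (m : ℕ → ZMod M) : Prop :=
  ∀ a, lo ≤ a → mem a < M ∧ (mem a : ZMod M) = m a

theorem Cells.update_add {lo M b w : ℕ} {mem : ℕ → ℕ} {m : ℕ → ZMod M} (h : Cells lo M mem m)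
    (hM : 0 < M) (hb : lo ≤ b) :
    Cells lo M (Function.update mem b ((mem b + w) % M)) (m + Pi.single b (w : ZMod M)) := by
  intro a ha
  rcases eq_or_ne a b with rfl | hab
  · rw [Function.update_self, Pi.add_apply, Pi.single_eq_same, ZMod.natCast_mod, Nat.cast_add,
      (h a ha).2]
    exact ⟨Nat.mod_lt _ hM, rfl⟩
  · rw [Function.update_of_ne hab, Pi.add_apply, Pi.single_eq_of_ne hab, add_zero]
    exact h a ha

/-- The contents of the registers that `edge` reads, for `S` source cells of a block at address `u`
and a target block at address `v`. -/
structure EdgeRegs (M S u v : ℕ) (ℓ : EdgeLabel) (s : State) : Prop where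
  zero : s.reg rZero = 0
  one : s.reg rOne = 1
  two : s.reg rTwo = 2
  mod : s.reg rMod = M
  sources : s.reg rSources = S
  src : s.reg rSrc = u
  dst : s.reg rDst = v
  pos : s.reg rPos = ℓ.weight
  off : s.reg rOff = ℓ.offset
  letter : s.reg rLetter = ℓ.base
  count : s.reg rCount = ℓ.bits

/-- The conditions under which `edge` stays below `Y`, leaves the memory below `lo` alone, and
writes to no source cell. -/
structure EdgeBounds (Y M S lo u v : ℕ) (ℓ : EdgeLabel) : Prop where
  mod_pos : 0 < M
  le_src : lo ≤ u
  le_dst : lo ≤ v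
  weight_lt : ℓ.weight * 2 ^ ℓ.bits < Y
  offset_lt : ℓ.offset * 2 ^ ℓ.bits < Y
  base_le : ∀ j ≤ ℓ.bits, M * ℓ.base ^ j + M ≤ Y
  src_le : u + S ≤ Y
  dst_lt : ∀ a < S, ∀ j < ℓ.bits, bitAt ℓ.weight j a = 0 → v + a + ℓ.offset * 2 ^ j < Y
  dst_ne : ∀ a < S, ∀ j < ℓ.bits, bitAt ℓ.weight j a = 0 → ∀ b < S,
    u + b ≠ v + a + ℓ.offset * 2 ^ j

/-- The registers other than the working registers of `edge` and the memory below `lo` are as in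
`s₀`. -/
structure EdgeFrame (lo : ℕ) (s₀ s : State) : Prop where
  reg_eq : ∀ r, ¬ (rCell ≤ r ∧ r ≤ rTmp₃) → s.reg r = s₀.reg r
  mem_eq : ∀ b < lo, s.mem b = s₀.mem b

variable {Y M S lo u v : ℕ} {ℓ : EdgeLabel} {s₀ s : State}

theorem EdgeRegs.of_frame (h : EdgeRegs M S u v ℓ s₀) (hs : EdgeFrame lo s₀ s) :
    EdgeRegs M S u v ℓ s := by
  constructor <;> rw [hs.reg_eq _ (by omega)]
  exacts [h.zero, h.one, h.two, h.mod, h.sources, h.src, h.dst, h.pos, h.off, h.letter, h.count]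

theorem EdgeBounds.base_pow_lt (h : EdgeBounds Y M S lo u v ℓ) {j : ℕ} (hj : j ≤ ℓ.bits) :
    ℓ.base ^ j < Y := by
  have := h.base_le j hj
  have := h.mod_pos
  nlinarith [Nat.le_mul_of_pos_left (ℓ.base ^ j) h.mod_pos]

theorem EdgeBounds.weight_mul_lt (h : EdgeBounds Y M S lo u v ℓ) {j : ℕ} (hj : j < ℓ.bits) :
    ℓ.weight * 2 ^ j * 2 < Y := by
  rw [mul_assoc, ← pow_succ]
  exact (Nat.mul_le_mul_left _ (Nat.pow_le_pow_right zero_lt_two hj)).trans_lt h.weight_lt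

theorem EdgeBounds.offset_mul_lt (h : EdgeBounds Y M S lo u v ℓ) {j : ℕ} (hj : j < ℓ.bits) :
    ℓ.offset * 2 ^ j * 2 < Y := by
  rw [mul_assoc, ← pow_succ]
  exact (Nat.mul_le_mul_left _ (Nat.pow_le_pow_right zero_lt_two hj)).trans_lt h.offset_lt

/-- The state of the inner loop of `edge` after `j` rounds for the source cell `a` with content `x`,
where `m` is the memory before the first round. -/
structure EdgeStepInv (lo M : ℕ) (s₀ : State) (ℓ : EdgeLabel) (v a : ℕ) (x : ZMod M)
    (m : ℕ → ZMod M) (j : ℕ) (s : State) : Prop where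
  frame : EdgeFrame lo s₀ s
  cell : s.reg rCell = a
  bit : s.reg rBit = ℓ.weight * 2 ^ j
  shift : s.reg rShift = ℓ.offset * 2 ^ j
  pow : s.reg rPow = ℓ.base ^ j
  val_le : s.reg rVal ≤ M
  val : (s.reg rVal : ZMod M) = bitSign (ZMod M) ℓ.weight j a * x
  cells : Cells lo M s.mem (m + (ℓ.truncate j).scatter (ZMod M) v a x)

theorem EdgeFrame.trans {s₁ : State} (h : EdgeFrame lo s₀ s) (h₁ : EdgeFrame lo s s₁) :
    EdgeFrame lo s₀ s₁ where
  reg_eq r hr := (h₁.reg_eq r hr).trans (h.reg_eq r hr)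
  mem_eq b hb := (h₁.mem_eq b hb).trans (h.mem_eq b hb)

/-- What a round of the inner loop of `edge` does in any case, from `s` to `s'`. -/
structure EdgeStepScaled (lo : ℕ) (ℓ : EdgeLabel) (s s' : State) : Prop
    extends EdgeFrame lo s s' where
  cell : s'.reg rCell = s.reg rCell
  bit : s'.reg rBit = s.reg rBit * 2
  shift : s'.reg rShift = s.reg rShift * 2
  pow : s'.reg rPow = s.reg rPow * ℓ.base

section

variable {s' : State} {a i j : ℕ} {x : ZMod M} {m : ℕ → ZMod M}

theorem EdgeStepInv.succ_of_bitAt_ne_zero (h : EdgeStepInv lo M s₀ ℓ v a x m j s)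
    (hbit : bitAt ℓ.weight j a ≠ 0) (hscale : EdgeStepScaled lo ℓ s s')
    (hval : s'.reg rVal = M - s.reg rVal) (hmem : s'.mem = s.mem) :
    EdgeStepInv lo M s₀ ℓ v a x m (j + 1) s' where
  frame := h.frame.trans hscale.toEdgeFrame
  cell := hscale.cell.trans h.cell
  bit := by rw [hscale.bit, h.bit, pow_succ, mul_assoc]
  shift := by rw [hscale.shift, h.shift, pow_succ, mul_assoc]
  pow := by rw [hscale.pow, h.pow, pow_succ]
  val_le := hval ▸ Nat.sub_le _ _
  val := by
    rw [hval, Nat.cast_sub h.val_le, h.val, bitSign_succ, if_neg hbit, ZMod.natCast_self]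
    ring
  cells := by
    rw [hmem, scatter_truncate_succ, if_neg hbit, add_zero]
    exact h.cells

theorem EdgeStepInv.succ_of_bitAt_eq_zero (h : EdgeStepInv lo M s₀ ℓ v a x m j s) (hM : 0 < M)
    (hv : lo ≤ v) (hbit : bitAt ℓ.weight j a = 0) (hscale : EdgeStepScaled lo ℓ s s')
    (hval : s'.reg rVal = s.reg rVal)
    (hmem : s'.mem = Function.update s.mem (v + a + ℓ.offset * 2 ^ j)
      ((s.mem (v + a + ℓ.offset * 2 ^ j) + s.reg rVal * s.reg rPow) % M)) :
    EdgeStepInv lo M s₀ ℓ v a x m (j + 1) s' where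
  frame := h.frame.trans hscale.toEdgeFrame
  cell := hscale.cell.trans h.cell
  bit := by rw [hscale.bit, h.bit, pow_succ, mul_assoc]
  shift := by rw [hscale.shift, h.shift, pow_succ, mul_assoc]
  pow := by rw [hscale.pow, h.pow, pow_succ]
  val_le := hval ▸ h.val_le
  val := by rw [hval, h.val, bitSign_succ, if_pos hbit, mul_one]
  cells := by
    have hterm : bitSign (ZMod M) ℓ.weight j a * (ℓ.base : ZMod M) ^ j * x =
        ((s.reg rVal * s.reg rPow : ℕ) : ZMod M) := by
      rw [Nat.cast_mul, h.val, h.pow, Nat.cast_pow]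
      ring
    rw [hmem, scatter_truncate_succ, if_pos hbit, ← add_assoc, hterm]
    exact h.cells.update_add hM (by omega)

theorem EdgeStepInv.sum_lt (h : EdgeStepInv lo M s₀ ℓ v a x m j s)
    (hb : EdgeBounds Y M S lo u v ℓ) (hj : j ≤ ℓ.bits) (o : ℕ) :
    s.mem (v + a + o) + s.reg rVal * ℓ.base ^ j < Y :=
  calc s.mem (v + a + o) + s.reg rVal * ℓ.base ^ j < M + M * ℓ.base ^ j := by
        have := hb.le_dst
        exact Nat.add_lt_add_of_lt_of_le (h.cells _ (by omega)).1 (Nat.mul_le_mul_right _ h.val_le)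
    _ ≤ Y := by
        rw [add_comm]
        exact hb.base_le j hj

theorem edgeStep_wp (hr : EdgeRegs M S u v ℓ s₀) (hb : EdgeBounds Y M S lo u v ℓ)
    (hs : s.Bounded Y) (ha : a < S) (hj : j < ℓ.bits) (hi : s.reg rIter = i + 1)
    (h : EdgeStepInv lo M s₀ ℓ v a x m j s) :
    edgeStep.wp Y s fun s' n =>
      s'.reg rIter = i ∧ EdgeStepInv lo M s₀ ℓ v a x m (j + 1) s' ∧ n ≤ 19 := by
  have hr := hr.of_frame h.frame
  have hbit := hb.weight_mul_lt hj
  have hshift := hb.offset_mul_lt hj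
  have hpow : ℓ.base ^ j * ℓ.base < Y := pow_succ ℓ.base j ▸ hb.base_pow_lt hj
  have hdigit : a / (ℓ.weight * 2 ^ j) / 2 * 2 < Y := by
    have := h.cell ▸ hs.reg_lt rCell
    have := Nat.div_le_self a (ℓ.weight * 2 ^ j)
    omega
  simp only [edgeStep, Prog.wp, State.setReg_reg, State.setMem_reg, State.setReg_mem,
    Nat.reduceEqDiff, if_true, if_false, hr.one, hr.two, hr.mod, hr.dst, hr.letter, hi, h.cell,
    h.bit, h.shift, h.pow, ← bitAt_eq_sub]
  refine ⟨hdigit, fun hne => ⟨hbit, hshift, hpow, by simp, ?_, by simp⟩, fun h0 => ?_⟩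
  · refine h.succ_of_bitAt_ne_zero hne ⟨⟨fun r hr => ?_, fun b _ => rfl⟩, ?_, ?_, ?_, ?_⟩ ?_ rfl
    · simp only [State.setReg_reg]
      split_ifs <;> omega
    all_goals simp [h.bit, h.shift, h.pow]
  have hdst := hb.le_dst
  have htarget := hb.dst_lt a ha j hj h0
  have hsum := h.sum_lt hb hj.le (ℓ.offset * 2 ^ j)
  have hquot := (Nat.div_mul_le_self _ M).trans_lt hsum
  refine ⟨by omega, htarget, by omega, hsum, hquot, hbit, hshift, hpow, by simp, ?_, by simp⟩
  refine h.succ_of_bitAt_eq_zero hb.mod_pos hdst h0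
    ⟨⟨fun r hr => ?_, fun b hb' => ?_⟩, ?_, ?_, ?_, ?_⟩ ?_ ?_
  · simp only [State.setReg_reg, State.setMem_reg]
    split_ifs <;> omega
  · exact Function.update_of_ne (by omega) ..
  all_goals simp [h.bit, h.shift, h.pow, Nat.mod_eq_sub_div_mul]

theorem edgeCell_wp (hr : EdgeRegs M S u v ℓ s₀) (hb : EdgeBounds Y M S lo u v ℓ)
    (hs₀ : s₀.Bounded Y) (ha : a < S) (hframe : EdgeFrame lo s₀ s)
    (hcell : s.reg rCell = a + 1) (hm : Cells lo M s.mem m) :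
    edgeCell.wp Y s fun s' n => (EdgeFrame lo s₀ s' ∧ s'.reg rCell = a ∧
      Cells lo M s'.mem (m + ℓ.scatter (ZMod M) v a (m (u + a)))) ∧ n ≤ 20 * ℓ.bits + 8 := by
  have hr' := hr.of_frame hframe
  have hsrc := hb.src_le
  have hbase := hb.base_pow_lt (Nat.zero_le _)
  simp only [edgeCell, Prog.wp, State.setReg_reg, State.setReg_mem, Nat.reduceEqDiff, if_true,
    if_false, hcell, hr'.zero, hr'.one, hr'.src, hr'.pos, hr'.off, hr'.count, add_zero,
    Nat.add_sub_cancel]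
  refine ⟨by omega, hr.pos ▸ hs₀.reg_lt _, hr.off ▸ hs₀.reg_lt _, hbase,
    hr.count ▸ hs₀.reg_lt _, ?_⟩
  refine HaltsWith.countdown (fun i s' => s'.reg rIter = i ∧ i ≤ ℓ.bits ∧
    EdgeStepInv lo M s₀ ℓ v a (m (u + a)) m (ℓ.bits - i) s') 19 ℓ.bits (fun i s' h => h.1) ?_ ?_ ?_
  · rintro i s₁ hi ⟨hiter, -, h⟩ hs₁
    refine Prog.wp_mono hs₁ (edgeStep_wp hr hb hs₁ ha (by omega) hiter h) ?_
    rintro s₂ n - ⟨hiter', h', hn⟩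
    rw [show ℓ.bits - (i + 1) + 1 = ℓ.bits - i by omega] at h'
    exact ⟨⟨hiter', hi.le, h'⟩, hn⟩
  · have hload := hm (u + a) (by have := hb.le_src; omega)
    rw [Nat.sub_self]
    refine ⟨by simp, le_rfl, ⟨fun r hr => ?_, hframe.mem_eq⟩, ?_, ?_, ?_, ?_, ?_, ?_, ?_⟩
    · rw [← hframe.reg_eq r hr]
      simp only [State.setReg_reg]
      split_ifs <;> omega
    · simp
    · simp
    · simp
    · simp
    · simpa using hload.1.le
    · simpa [bitSign] using hload.2
    · rw [scatter_truncate_zero, add_zero]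
      exact hm
  · rintro s' n ⟨-, -, h⟩ hn
    exact ⟨⟨h.frame, h.cell, h.cells⟩, by omega⟩

theorem EdgeBounds.scatter_src_eq_zero (hb : EdgeBounds Y M S lo u v ℓ) {b : ℕ} (ha : a < S)
    (hbS : b < S) (x : ZMod M) : ℓ.scatter (ZMod M) v a x (u + b) = 0 := by
  rw [scatter_apply]
  refine sum_eq_zero fun j hj => if_neg fun h => ?_
  exact hb.dst_ne a ha j (mem_range.1 hj) h.1 b hbS h.2

theorem edge_wp (hr : EdgeRegs M S u v ℓ s) (hb : EdgeBounds Y M S lo u v ℓ) (hs : s.Bounded Y)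
    (hm : Cells lo M s.mem m) :
    edge.wp Y s fun s' n => EdgeFrame lo s s' ∧
      Cells lo M s'.mem (m + ∑ a ∈ range S, ℓ.scatter (ZMod M) v a (m (u + a))) ∧
      n ≤ S * (20 * ℓ.bits + 9) + 2 := by
  simp only [edge, Prog.wp, hr.zero, hr.sources, add_zero]
  refine ⟨hr.sources ▸ hs.reg_lt _, ?_⟩
  refine HaltsWith.countdown (fun i s' => EdgeFrame lo s s' ∧ s'.reg rCell = i ∧
    Cells lo M s'.mem (m + ∑ a ∈ Ico i S, ℓ.scatter (ZMod M) v a (m (u + a))))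
    (20 * ℓ.bits + 8) S (fun i s' h => h.2.1) ?_ ?_ ?_
  · rintro i s₁ hi ⟨hframe, hcell, hm₁⟩ -
    have hsource : (m + ∑ a ∈ Ico (i + 1) S, ℓ.scatter (ZMod M) v a (m (u + a))) (u + i) =
        m (u + i) := by
      rw [Pi.add_apply, Finset.sum_apply, sum_eq_zero, add_zero]
      exact fun a ha => hb.scatter_src_eq_zero (mem_Ico.1 ha).2 hi _
    have := edgeCell_wp hr hb hs hi hframe hcell hm₁
    rw [sum_eq_sum_Ico_succ_bot hi, add_comm (ℓ.scatter (ZMod M) v i (m (u + i))), ← add_assoc]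
    rwa [hsource] at this
  · refine ⟨⟨fun r hr => ?_, fun _ _ => rfl⟩, by simp, by simpa using hm⟩
    rw [State.setReg_reg, if_neg (by omega)]
  · rintro s' n ⟨hframe, -, hm'⟩ hn
    rw [← range_eq_Ico] at hm'
    have : S * (20 * ℓ.bits + 8 + 1) = S * (20 * ℓ.bits + 9) := rfl
    exact ⟨hframe, hm', by omega⟩

end

end RAM

end Edges

section Blocks

open Finset EdgeLabel

/-- The parameters of a run of the decision procedure: the numbers `n`, `k`, `t`, `q` of the problem
and the input word. -/
structure Params where
  (n k t q : ℕ)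
  input : List ℕ

namespace Params

variable (P : Params)

/-- A bound on the letters `α`, and the base of the modulus. -/
def letterBound : ℕ := (P.n + 1) * P.q + 1

/-- The modulus of the arithmetic; it exceeds the value that the procedure tests against zero. -/
def modulus : ℕ := P.letterBound ^ (P.input.length + 2 * (P.k * P.k) + 1)

/-- The number of cells `cell k d I J` with `d ≤ t`, which are those that the edges read. -/
def sourceCount : ℕ := (P.t + 1) * 4 ^ P.k

/-- The number of memory cells of a block; there is room for the products with `z ^ (t + 1)`, which
are never read. -/
def blockSize : ℕ := (P.t + 2) * 4 ^ P.k

/-- The address of the first block: the input and the stack, two cells an entry, come first. -/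
def blocksStart : ℕ := 3 * P.input.length

/-- A bound on the number of blocks: an input number creates at most `q` of them. -/
def maxBlocks : ℕ := P.q * P.input.length + 2

/-- The address of a block. -/
def addr (i : ℕ) : ℕ := P.blocksStart + i * P.blockSize

/-- A bound on all numbers in the computation. -/
def bound : ℕ := P.modulus * P.letterBound ^ P.k + P.modulus + P.addr (P.maxBlocks + 1)

/-- The memory contents when `vec i` is the contents of the `i`-th block. -/
def memory {R : Type*} (vec : ℕ → ℕ → R) (a : ℕ) : R :=
  vec ((a - P.blocksStart) / P.blockSize) ((a - P.blocksStart) % P.blockSize)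

theorem letterBound_pos : 0 < P.letterBound := Nat.succ_pos _

theorem modulus_pos : 0 < P.modulus := Nat.pow_pos P.letterBound_pos

theorem letterBound_le_modulus : P.letterBound ≤ P.modulus :=
  Nat.le_pow (Nat.succ_pos _)

theorem blockSize_pos : 0 < P.blockSize := Nat.mul_pos (Nat.succ_pos _) (Nat.pow_pos (by norm_num))

theorem sourceCount_add : P.sourceCount + 4 ^ P.k = P.blockSize := (Nat.succ_mul _ _).symm

theorem sourceCount_le_blockSize : P.sourceCount ≤ P.blockSize :=
  Nat.le.intro P.sourceCount_add

theorem two_mul_four_pow_le_blockSize : 2 * 4 ^ P.k ≤ P.blockSize :=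
  Nat.mul_le_mul_right _ (Nat.le_add_left 2 _)

theorem addr_mono : Monotone P.addr := fun _ _ h =>
  Nat.add_le_add_left (Nat.mul_le_mul_right _ h) _

theorem addr_succ (i : ℕ) : P.addr (i + 1) = P.addr i + P.blockSize := by
  rw [addr, addr, Nat.succ_mul, add_assoc]

theorem blocksStart_le_addr (i : ℕ) : P.blocksStart ≤ P.addr i := Nat.le_add_right _ _

theorem modulus_mul_pow_add_le : P.modulus * P.letterBound ^ P.k + P.modulus ≤ P.bound :=
  Nat.le_add_right _ _

theorem modulus_lt_bound : P.modulus < P.bound := by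
  have := P.modulus_mul_pow_add_le
  have := Nat.mul_pos P.modulus_pos (Nat.pow_pos P.letterBound_pos (n := P.k))
  omega

theorem letterBound_lt_bound : P.letterBound < P.bound :=
  P.letterBound_le_modulus.trans_lt P.modulus_lt_bound

theorem one_lt_bound : 1 < P.bound :=
  Nat.lt_of_le_of_lt P.letterBound_pos P.letterBound_lt_bound

variable {P} {i u v y a : ℕ} {ℓ : EdgeLabel}

theorem addr_add_lt_bound (hi : i ≤ P.maxBlocks) (hy : y ≤ P.blockSize) :
    P.addr i + y < P.bound := by
  have := P.addr_succ i
  have := P.addr_mono (Nat.add_le_add_right hi 1)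
  have := P.modulus_pos
  unfold bound
  omega

theorem addr_lt_bound (hi : i ≤ P.maxBlocks) : P.addr i < P.bound :=
  addr_add_lt_bound hi (Nat.zero_le _)

theorem blockSize_lt_bound : P.blockSize < P.bound :=
  (Nat.le_add_left _ _).trans_lt (addr_add_lt_bound (Nat.zero_le _) le_rfl)

theorem blocksStart_lt_bound : P.blocksStart < P.bound :=
  (P.blocksStart_le_addr 0).trans_lt (addr_lt_bound (Nat.zero_le _))

theorem addr_add_sub (i y : ℕ) : P.addr i + y - P.blocksStart = y + P.blockSize * i := by
  rw [addr, mul_comm]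
  omega

theorem memory_addr_add {R : Type*} (vec : ℕ → ℕ → R) (i : ℕ) (hy : y < P.blockSize) :
    P.memory vec (P.addr i + y) = vec i y := by
  rw [memory, addr_add_sub, Nat.add_mul_div_left _ _ P.blockSize_pos, Nat.add_mul_mod_self_left,
    Nat.mod_eq_of_lt hy, Nat.div_eq_of_lt hy, zero_add]

theorem exists_eq_addr_add (ha : P.blocksStart ≤ a) : ∃ i, ∃ y < P.blockSize, a = P.addr i + y := by
  refine ⟨(a - P.blocksStart) / P.blockSize, (a - P.blocksStart) % P.blockSize,
    Nat.mod_lt _ P.blockSize_pos, ?_⟩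
  rw [addr, add_assoc, Nat.div_add_mod', Nat.add_sub_cancel' ha]

theorem addr_add_eq_addr_add_iff {j z : ℕ} (hy : y < P.blockSize) (hz : z < P.blockSize) :
    P.addr i + y = P.addr j + z ↔ i = j ∧ y = z := by
  refine ⟨fun h => ?_, fun ⟨hij, hyz⟩ => by rw [hij, hyz]⟩
  have hpair := congrArg (P.memory fun i y => (i, y)) h
  rwa [memory_addr_add _ _ hy, memory_addr_add _ _ hz, Prod.mk.injEq] at hpair

/-- The edge map of the label stays inside a block, and the numbers in its computation are below
`P.bound`. -/
structure Fits (P : Params) (ℓ : EdgeLabel) : Prop where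
  bits_le : ℓ.bits ≤ P.k + 1
  weight_le : ℓ.weight * 2 ^ ℓ.bits ≤ P.blockSize
  offset_le : ℓ.offset * 2 ^ ℓ.bits ≤ P.blockSize
  base_pow_le : ∀ j ≤ ℓ.bits, ℓ.base ^ j ≤ P.letterBound ^ P.k
  target_lt : ∀ a < P.sourceCount, ∀ j < ℓ.bits, bitAt ℓ.weight j a = 0 →
    a + ℓ.offset * 2 ^ j < P.blockSize

theorem fits_shift {o : ℕ} (ho : o ≤ 4 ^ P.k) : P.Fits (shift o) where
  bits_le := Nat.le_add_left 1 _
  weight_le := (Nat.zero_mul _).trans_le (Nat.zero_le _)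
  offset_le := by
    have := P.two_mul_four_pow_le_blockSize
    simp only [shift]
    omega
  base_pow_le j _ := by
    simp only [shift, one_pow]
    exact Nat.pow_pos P.letterBound_pos
  target_lt a ha j hj _ := by
    have := P.sourceCount_add
    obtain rfl : j = 0 := Nat.lt_one_iff.1 hj
    simp only [shift]
    omega

theorem add_two_pow_lt_sourceCount {e j : ℕ} (hj : e + j < 2 * P.k) (ha : a < P.sourceCount)
    (hbit : bitAt (2 ^ e) j a = 0) : a + 2 ^ e * 2 ^ j < P.sourceCount := by
  obtain ⟨d, hd⟩ := Nat.exists_eq_add_of_lt hj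
  have hS : P.sourceCount = 2 * ((P.t + 1) * 2 ^ d) * (2 ^ e * 2 ^ j) := by
    rw [sourceCount, show (4 : ℕ) = 2 ^ 2 from rfl, ← pow_mul, hd, pow_succ, pow_add, pow_add]
    ring
  have hpos : 0 < 2 ^ e * 2 ^ j := by positivity
  rw [hS, ← Nat.div_lt_iff_lt_mul hpos] at ha ⊢
  rw [Nat.add_div_right _ hpos]
  unfold bitAt at hbit
  omega

theorem fits_wedge {e α : ℕ} (he : e ≤ P.k) (hα : α ≤ P.letterBound) :
    P.Fits (wedge P.k e α) := by
  have hsize : 2 ^ e * 2 ^ P.k ≤ P.blockSize :=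
    calc 2 ^ e * 2 ^ P.k ≤ 2 ^ P.k * 2 ^ P.k :=
          Nat.mul_le_mul_right _ (Nat.pow_le_pow_right two_pos he)
      _ = 4 ^ P.k := (mul_pow 2 2 P.k).symm
      _ ≤ P.blockSize := by have := P.two_mul_four_pow_le_blockSize; omega
  refine ⟨Nat.le_succ _, hsize, hsize, fun j hj => ?_, fun a ha j hj hbit => ?_⟩
  · exact (Nat.pow_le_pow_left hα j).trans (Nat.pow_le_pow_right P.letterBound_pos hj)
  · simp only [wedge] at hj
    exact (add_two_pow_lt_sourceCount (by omega) ha hbit).trans_le P.sourceCount_le_blockSize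

theorem Fits.edgeBounds (h : P.Fits ℓ) (hu : u ≤ P.maxBlocks) (hv : v ≤ P.maxBlocks)
    (huv : u ≠ v) :
    RAM.EdgeBounds P.bound P.modulus P.sourceCount P.blocksStart (P.addr u) (P.addr v) ℓ where
  mod_pos := P.modulus_pos
  le_src := P.blocksStart_le_addr u
  le_dst := P.blocksStart_le_addr v
  weight_lt := h.weight_le.trans_lt blockSize_lt_bound
  offset_lt := h.offset_le.trans_lt blockSize_lt_bound
  base_le j hj := (Nat.add_le_add_right (Nat.mul_le_mul_left _ (h.base_pow_le j hj)) _).trans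
    P.modulus_mul_pow_add_le
  src_le := (addr_add_lt_bound hu P.sourceCount_le_blockSize).le
  dst_lt a ha j hj hbit := by
    rw [add_assoc]
    exact addr_add_lt_bound hv (h.target_lt a ha j hj hbit).le
  dst_ne a ha j hj hbit b hb := by
    rw [add_assoc, ne_eq, addr_add_eq_addr_add_iff (hb.trans_le P.sourceCount_le_blockSize)
      (h.target_lt a ha j hj hbit)]
    exact fun h' => huv h'.1

theorem Fits.scatter_addr {R : Type*} [CommRing R] (h : P.Fits ℓ) (ha : a < P.sourceCount)
    (hy : y < P.blockSize) (x : R) :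
    ℓ.scatter R (P.addr v) a x (P.addr i + y) = if i = v then ℓ.scatter R 0 a x y else 0 := by
  have hiff : ∀ j ∈ range ℓ.bits, (bitAt ℓ.weight j a = 0 ∧
      P.addr i + y = P.addr v + a + ℓ.offset * 2 ^ j) ↔
      i = v ∧ bitAt ℓ.weight j a = 0 ∧ y = 0 + a + ℓ.offset * 2 ^ j := by
    intro j hj
    rw [zero_add, add_assoc, and_left_comm, and_congr_right_iff]
    exact fun hbit => addr_add_eq_addr_add_iff hy (h.target_lt a ha j (mem_range.1 hj) hbit)
  rw [scatter_apply, sum_congr rfl fun j hj => if_congr (hiff j hj) rfl rfl]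
  split_ifs with hiv <;> simp [hiv, scatter_apply]

theorem Fits.memory_add_sum_scatter {R : Type*} [CommRing R] (h : P.Fits ℓ) (vec : ℕ → ℕ → R)
    (ha : P.blocksStart ≤ a) :
    (P.memory vec + ∑ b ∈ range P.sourceCount,
      ℓ.scatter R (P.addr v) b (P.memory vec (P.addr u + b))) a =
      P.memory (Function.update vec v (vec v + ℓ.op R P.sourceCount (vec u))) a := by
  obtain ⟨i, y, hy, rfl⟩ := exists_eq_addr_add ha
  have hterm : ∀ b ∈ range P.sourceCount,
      ℓ.scatter R (P.addr v) b (P.memory vec (P.addr u + b)) (P.addr i + y) =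
        if i = v then ℓ.scatter R 0 b (vec u b) y else 0 := fun b hb => by
    have hb := mem_range.1 hb
    rw [h.scatter_addr hb hy, memory_addr_add _ _ (hb.trans_le P.sourceCount_le_blockSize)]
  rw [Pi.add_apply, Finset.sum_apply, sum_congr rfl hterm, memory_addr_add _ _ hy,
    memory_addr_add _ _ hy]
  rcases eq_or_ne i v with rfl | hiv
  · simp [op_apply]
  · simp [hiv]

end Params

end Blocks

section LoopState

open Finset EdgeLabel RAM

namespace RAM

/-- Removes the top entry of the stack, an edge to be processed, and reads the next number of the
input. -/
def fetch : Prog :=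
  .op .sub rDepth rDepth rOne ;; .op .mul rStack rDepth rTwo ;; .op .add rStack rStack rLen ;;
  .load rFrom rStack ;; .op .add rStack rStack rOne ;; .load rTo rStack ;;
  .load rToken rPtr ;; .op .add rPtr rPtr rOne

/-- Puts the edge between the nodes in the registers `a` and `b` on the stack. -/
def push (a b : ℕ) : Prog :=
  .op .mul rStack rDepth rTwo ;; .op .add rStack rStack rLen ;; .store rStack a ;;
  .op .add rStack rStack rOne ;; .store rStack b ;; .op .add rDepth rDepth rOne

/-- Creates a node, that is, starts using another block. -/
def allocate : Prog :=
  .op .add rNode rNext rZero ;; .op .add rNext rNext rBlock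

/-- Puts the contents of six registers into the registers that `edge` reads. -/
def loadEdge (src dst weight offset base bits : ℕ) : Prog :=
  .op .add rSrc src rZero ;; .op .add rDst dst rZero ;; .op .add rPos weight rZero ;;
  .op .add rOff offset rZero ;; .op .add rLetter base rZero ;; .op .add rCount bits rZero

/-- Runs `edge` on the contents of six registers. -/
def blockEdge (src dst weight offset base bits : ℕ) : Prog :=
  loadEdge src dst weight offset base bits ;; edge

end RAM

namespace Params

/-- The registers with fixed contents in the main loop. -/
structure Constants (P : Params) (s : State) : Prop where
  zero : s.reg rZero = 0
  k : s.reg rK = P.k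
  qPred : s.reg rQPred = P.q - 1
  one : s.reg rOne = 1
  two : s.reg rTwo = 2
  mod : s.reg rMod = P.modulus
  twoPowK : s.reg rTwoPowK = 2 ^ P.k
  fourPowK : s.reg rFourPowK = 4 ^ P.k
  sources : s.reg rSources = P.sourceCount
  block : s.reg rBlock = P.blockSize
  len : s.reg rLen = P.input.length

/-- The stack in the memory holds the given edges, the top one first. -/
def HoldsStack (P : Params) (mem : ℕ → ℕ) : List (ℕ × ℕ) → Prop
  | [] => True
  | e :: σ => mem (P.input.length + 2 * σ.length) = P.addr e.1 ∧
      mem (P.input.length + 2 * σ.length + 1) = P.addr e.2 ∧ P.HoldsStack mem σ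

/-- The states of the main loop: the input from `ptr` on is still to be read, the edges `σ` are to
be processed with it, the nodes below `N` exist, and the node `i` carries the vector `vec i`. -/
structure LoopInv (P : Params) (ptr : ℕ) (σ : List (ℕ × ℕ)) (N : ℕ)
    (vec : ℕ → ℕ → ZMod P.modulus) (s : State) : Prop extends P.Constants s where
  ptr : s.reg rPtr = ptr
  depth : s.reg rDepth = σ.length
  next : s.reg rNext = P.addr N
  depth_le : σ.length ≤ P.input.length
  next_le : N ≤ P.maxBlocks
  stack : P.HoldsStack s.mem σ
  input : ∀ a < P.input.length, s.mem a = P.input.getD a 0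
  cells : Cells P.blocksStart P.modulus s.mem (P.memory vec)
  fresh : ∀ i, N ≤ i → vec i = 0

/-- The states of the main loop in which the edge from the node `u` to the node `v` is being
processed. -/
structure AtEdge (P : Params) (ptr : ℕ) (σ : List (ℕ × ℕ)) (N : ℕ)
    (vec : ℕ → ℕ → ZMod P.modulus) (u v : ℕ) (s : State) : Prop
    extends P.LoopInv ptr σ N vec s where
  src : s.reg rFrom = P.addr u
  dst : s.reg rTo = P.addr v
  src_lt : u < N
  dst_lt : v < N
  ne : u ≠ v

variable {P : Params} {ptr N u v w : ℕ} {σ : List (ℕ × ℕ)} {vec vec' : ℕ → ℕ → ZMod P.modulus}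
  {s s' : State}

theorem Constants.congr (h : P.Constants s) (heq : ∀ r ≤ rLen, s'.reg r = s.reg r) :
    P.Constants s' := by
  constructor <;> rw [heq _ (by omega)]
  exacts [h.zero, h.k, h.qPred, h.one, h.two, h.mod, h.twoPowK, h.fourPowK, h.sources, h.block,
    h.len]

theorem HoldsStack.congr {mem mem' : ℕ → ℕ} (h : P.HoldsStack mem σ)
    (heq : ∀ a < P.input.length + 2 * σ.length, mem' a = mem a) : P.HoldsStack mem' σ := by
  induction σ with
  | nil => trivial
  | cons e σ ih =>
    simp only [List.length_cons] at heq
    obtain ⟨hsrc, hdst, hσ⟩ := h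
    exact ⟨(heq _ (by omega)).trans hsrc, (heq _ (by omega)).trans hdst,
      ih hσ fun a ha => heq a (by omega)⟩

theorem three_mul_length_lt_bound : 3 * P.input.length < P.bound := blocksStart_lt_bound

namespace LoopInv

theorem setReg {r : ℕ} (h : P.LoopInv ptr σ N vec s) (hr : rNext < r) (x : ℕ) :
    P.LoopInv ptr σ N vec (s.setReg r x) where
  toConstants := h.toConstants.congr fun r' hr' => by rw [State.setReg_reg, if_neg (by omega)]
  ptr := by rw [State.setReg_reg, if_neg (by omega), h.ptr]
  depth := by rw [State.setReg_reg, if_neg (by omega), h.depth]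
  next := by rw [State.setReg_reg, if_neg (by omega), h.next]
  depth_le := h.depth_le
  next_le := h.next_le
  stack := h.stack
  input := h.input
  cells := h.cells
  fresh := h.fresh

theorem setPtr (h : P.LoopInv ptr σ N vec s) (ptr' : ℕ) :
    P.LoopInv ptr' σ N vec (s.setReg rPtr ptr') :=
  { h with
    toConstants := h.toConstants.congr fun r hr => by rw [State.setReg_reg, if_neg (by omega)]
    ptr := by simp
    depth := by simp [h.depth]
    next := by simp [h.next] }

theorem setNext (h : P.LoopInv ptr σ N vec s) (hN : N + 1 ≤ P.maxBlocks) :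
    P.LoopInv ptr σ (N + 1) vec (s.setReg rNext (P.addr (N + 1))) :=
  { h with
    toConstants := h.toConstants.congr fun r hr => by rw [State.setReg_reg, if_neg (by omega)]
    ptr := by simp [h.ptr]
    depth := by simp [h.depth]
    next := by simp
    next_le := hN
    fresh := fun i hi => h.fresh i (by omega) }

theorem pop {e : ℕ × ℕ} (h : P.LoopInv ptr (e :: σ) N vec s) :
    P.LoopInv ptr σ N vec (s.setReg rDepth σ.length) :=
  { h with
    toConstants := h.toConstants.congr fun r hr => by rw [State.setReg_reg, if_neg (by omega)]
    ptr := by simp [h.ptr]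
    depth := by simp
    next := by simp [h.next]
    depth_le := (Nat.le_succ _).trans h.depth_le
    stack := h.stack.2.2 }

theorem push (h : P.LoopInv ptr σ N vec s) (hσ : σ.length < P.input.length) :
    P.LoopInv ptr ((u, v) :: σ) N vec
      (((s.setMem (P.input.length + 2 * σ.length) (P.addr u)).setMem
        (P.input.length + 2 * σ.length + 1) (P.addr v)).setReg rDepth (σ.length + 1)) where
  toConstants := h.toConstants.congr fun r hr => by
    rw [State.setReg_reg, if_neg (by omega), State.setMem_reg, State.setMem_reg]
  ptr := by simp [h.ptr]
  depth := by simp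
  next := by simp [h.next]
  depth_le := hσ
  next_le := h.next_le
  stack := by
    refine ⟨by simp, by simp, h.stack.congr fun a ha => ?_⟩
    simp only [State.setReg_mem, State.setMem_mem]
    rw [Function.update_of_ne (by omega), Function.update_of_ne (by omega)]
  input a ha := by
    simp only [State.setReg_mem, State.setMem_mem]
    rw [Function.update_of_ne (by omega), Function.update_of_ne (by omega), h.input a ha]
  cells a ha := by
    have : P.blocksStart = 3 * P.input.length := rfl
    simp only [State.setReg_mem, State.setMem_mem]
    rw [Function.update_of_ne (by omega), Function.update_of_ne (by omega)]
    exact h.cells a ha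
  fresh := h.fresh

theorem edge (h : P.LoopInv ptr σ N vec s) (hreg : ∀ r ≤ rNext, s'.reg r = s.reg r)
    (hmem : ∀ a < P.blocksStart, s'.mem a = s.mem a)
    (hcells : Cells P.blocksStart P.modulus s'.mem (P.memory vec'))
    (hfresh : ∀ i, N ≤ i → vec' i = 0) : P.LoopInv ptr σ N vec' s' := by
  have := h.depth_le
  have hstart : P.blocksStart = 3 * P.input.length := rfl
  exact
  { toConstants := h.toConstants.congr fun r hr => hreg r (by omega)
    ptr := (hreg _ (by omega)).trans h.ptr
    depth := (hreg _ (by omega)).trans h.depth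
    next := (hreg _ (by omega)).trans h.next
    depth_le := h.depth_le
    next_le := h.next_le
    stack := h.stack.congr fun a ha => hmem a (by omega)
    input := fun a ha => (hmem a (by omega)).trans (h.input a ha)
    cells := hcells
    fresh := hfresh }

theorem mem_eq {x : ℕ} (h : P.LoopInv ptr σ N vec s) (hx : P.input[ptr]? = some x) :
    s.mem ptr = x := by
  rw [h.input ptr (List.getElem?_eq_some_iff.1 hx).1, List.getD_eq_getElem?_getD, hx,
    Option.getD_some]

theorem addr_next_lt (h : P.LoopInv ptr σ N vec s) : P.addr N < P.bound :=
  addr_lt_bound h.next_le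

end LoopInv

theorem fetch_wp {x : ℕ} (h : P.LoopInv ptr ((u, v) :: σ) N vec s) (hu : u < N) (hv : v < N)
    (huv : u ≠ v) (hx : P.input[ptr]? = some x) :
    fetch.wp P.bound s fun s' n => P.AtEdge (ptr + 1) σ N vec u v s' ∧
      s'.reg rToken = x ∧ n = 8 := by
  have hlen := P.three_mul_length_lt_bound
  have := (List.getElem?_eq_some_iff.1 hx).1
  have hdepth : s.reg rDepth = σ.length + 1 := h.depth
  have hσ : σ.length + 1 ≤ P.input.length := h.depth_le
  have htop : σ.length * 2 + P.input.length = P.input.length + 2 * σ.length := by ring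
  simp only [fetch, Prog.wp, State.setReg_reg, State.setReg_mem, Nat.reduceEqDiff, if_true,
    if_false, h.one, h.two, h.len, h.ptr, hdepth, Nat.add_sub_cancel, htop, h.stack.1,
    h.stack.2.1, h.mem_eq hx]
  refine ⟨by omega, by omega, by omega, by omega, ⟨⟨?_, by simp, by simp, hu, hv, huv⟩, by simp⟩⟩
  exact ((((((h.pop.setReg (by omega) _).setReg (by omega) _).setReg (by omega) _).setReg
    (by omega) _).setReg (by omega) _).setReg (by omega) _).setPtr _

theorem AtEdge.of_loopInv {ptr' N' : ℕ} {σ' : List (ℕ × ℕ)} (h : P.AtEdge ptr σ N vec u v s)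
    (h' : P.LoopInv ptr' σ' N' vec' s') (hN : N ≤ N') (hsrc : s'.reg rFrom = s.reg rFrom)
    (hdst : s'.reg rTo = s.reg rTo) : P.AtEdge ptr' σ' N' vec' u v s' :=
  { h' with
    src := hsrc.trans h.src
    dst := hdst.trans h.dst
    src_lt := h.src_lt.trans_le hN
    dst_lt := h.dst_lt.trans_le hN
    ne := h.ne }

theorem AtEdge.setReg {r : ℕ} (h : P.AtEdge ptr σ N vec u v s) (hr : rTo < r) (x : ℕ) :
    P.AtEdge ptr σ N vec u v (s.setReg r x) :=
  h.of_loopInv (h.toLoopInv.setReg (by omega) x) le_rfl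
    (by rw [State.setReg_reg, if_neg (by omega)]) (by rw [State.setReg_reg, if_neg (by omega)])

theorem AtEdge.setPtr (h : P.AtEdge ptr σ N vec u v s) (ptr' : ℕ) :
    P.AtEdge ptr' σ N vec u v (s.setReg rPtr ptr') :=
  h.of_loopInv (h.toLoopInv.setPtr ptr') le_rfl (by simp) (by simp)

theorem push_wp {a b : ℕ} (h : P.LoopInv ptr σ N vec s) (hσ : σ.length < P.input.length)
    (ha : a ≠ rStack) (hb : b ≠ rStack) (hu : s.reg a = P.addr u) (hv : s.reg b = P.addr v) :
    (push a b).wp P.bound s fun s' n => P.LoopInv ptr ((u, v) :: σ) N vec s' ∧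
      (∀ r, r ≠ rDepth → r ≠ rStack → s'.reg r = s.reg r) ∧ n = 6 := by
  have hlen := P.three_mul_length_lt_bound
  have htop : σ.length * 2 + P.input.length = P.input.length + 2 * σ.length := by ring
  simp only [push, Prog.wp, State.setReg_reg, State.setMem_reg, Nat.reduceEqDiff, if_true,
    if_false, h.one, h.two, h.len, h.depth, htop, ha, hb, hu, hv]
  refine ⟨by omega, by omega, by omega, by omega, ?_, fun r hr hr' => by simp [hr, hr'], trivial⟩
  exact (((h.setReg (by omega) _).setReg (by omega) _).setReg (by omega) _).push hσ

theorem allocate_wp (h : P.LoopInv ptr σ N vec s) (hN : N + 1 ≤ P.maxBlocks) :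
    allocate.wp P.bound s fun s' n => P.LoopInv ptr σ (N + 1) vec s' ∧ s'.reg rNode = P.addr N ∧
      (∀ r, r ≠ rNode → r ≠ rNext → s'.reg r = s.reg r) ∧ n = 2 := by
  simp only [allocate, Prog.wp, State.setReg_reg, Nat.reduceEqDiff, if_false, h.zero, h.next,
    h.block, add_zero, ← addr_succ]
  exact ⟨h.addr_next_lt, addr_lt_bound hN, (h.setReg (by omega) _).setNext hN, by simp,
    fun r hr hr' => by simp [hr, hr'], trivial⟩

theorem loadEdge_wp {Y src dst weight offset base bits : ℕ} (hs : s.Bounded Y)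
    (hzero : s.reg rZero = 0)
    (hreg : ∀ r ∈ [src, dst, weight, offset, base, bits], r < rSrc ∨ rTmp₃ < r) :
    (loadEdge src dst weight offset base bits).wp Y s fun s' n => s'.mem = s.mem ∧
      (∀ r, ¬ (rSrc ≤ r ∧ r ≤ rCount) → s'.reg r = s.reg r) ∧
      s'.reg rSrc = s.reg src ∧ s'.reg rDst = s.reg dst ∧ s'.reg rPos = s.reg weight ∧
      s'.reg rOff = s.reg offset ∧ s'.reg rLetter = s.reg base ∧ s'.reg rCount = s.reg bits ∧
      n = 6 := by
  have hne : ∀ r ∈ [src, dst, weight, offset, base, bits], ∀ r', rSrc ≤ r' → r' ≤ rTmp₃ → r ≠ r' :=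
    fun r hr r' _ _ => by have := hreg r hr; omega
  simp only [List.forall_mem_cons, List.not_mem_nil, false_implies, implies_true, and_true] at hne
  obtain ⟨-, hdst, hweight, hoffset, hbase, hbits⟩ := hne
  simp (disch := norm_num) only [loadEdge, Prog.wp, State.setReg_reg, State.setReg_mem,
    Nat.reduceEqDiff, if_true, if_false, OfNat.zero_ne_ofNat, hzero, add_zero, hs.reg_lt, hdst,
    hweight, hoffset, hbase, hbits, true_and, and_true]
  intro r hr
  split_ifs <;> omega

/-- A bound on the number of steps of `edge`. -/
def edgeCost (P : Params) : ℕ := P.sourceCount * (20 * (P.k + 1) + 9) + 2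

theorem blockEdge_wp {src dst weight offset base bits : ℕ} {ℓ : EdgeLabel}
    (h : P.LoopInv ptr σ N vec s) (hs : s.Bounded P.bound) (hfits : P.Fits ℓ)
    (hreg : ∀ r ∈ [src, dst, weight, offset, base, bits], r < rSrc ∨ rTmp₃ < r)
    (hu : u < N) (hv : v < N) (huv : u ≠ v)
    (hsrc : s.reg src = P.addr u) (hdst : s.reg dst = P.addr v)
    (hℓ : ℓ = ⟨s.reg weight, s.reg offset, s.reg base, s.reg bits⟩) :
    (blockEdge src dst weight offset base bits).wp P.bound s fun s' n =>
      P.LoopInv ptr σ N (Function.update vec v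
        (vec v + ℓ.op (ZMod P.modulus) P.sourceCount (vec u))) s' ∧
      (∀ r, ¬ (rSrc ≤ r ∧ r ≤ rTmp₃) → s'.reg r = s.reg r) ∧ n ≤ P.edgeCost + 6 := by
  have hN := h.next_le
  unfold blockEdge Prog.wp
  refine Prog.wp_mono hs (loadEdge_wp hs h.zero hreg) ?_
  rintro s₁ n₁ hs₁ ⟨hmem, hframe, hsrc₁, hdst₁, hweight, hoffset, hbase, hbits, rfl⟩
  have h₁ : P.Constants s₁ := h.toConstants.congr fun r hr => hframe r (by omega)
  have hregs : EdgeRegs P.modulus P.sourceCount (P.addr u) (P.addr v) ℓ s₁ :=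
    ⟨h₁.zero, h₁.one, h₁.two, h₁.mod, h₁.sources, hsrc₁.trans hsrc, hdst₁.trans hdst,
      hℓ ▸ hweight, hℓ ▸ hoffset, hℓ ▸ hbase, hℓ ▸ hbits⟩
  refine Prog.wp_mono hs₁ (edge_wp hregs (hfits.edgeBounds (by omega) (by omega) huv) hs₁
    (hmem ▸ h.cells)) ?_
  rintro s₂ n₂ - ⟨hframe₂, hcells, hn⟩
  have hframe' : ∀ r, ¬ (rSrc ≤ r ∧ r ≤ rTmp₃) → s₂.reg r = s.reg r := fun r hr =>
    (hframe₂.reg_eq r (by omega)).trans (hframe r (by omega))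
  refine ⟨h.edge (fun r hr => hframe' r (by omega)) (fun a ha => ?_) (fun a ha => ?_)
    (fun i hi => ?_), hframe', ?_⟩
  · rw [hframe₂.mem_eq a ha, hmem]
  · rw [← hfits.memory_add_sum_scatter vec ha]
    exact hcells a ha
  · rw [Function.update_of_ne (by omega), h.fresh i hi]
  · have : P.sourceCount * (20 * ℓ.bits + 9) ≤ P.sourceCount * (20 * (P.k + 1) + 9) := by
      gcongr
      exact hfits.bits_le
    unfold edgeCost
    omega

end Params

end LoopState

section Cases

open Finset EdgeLabel RAM

namespace RAM

/-- Runs the program with the index `rToken`. -/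
def dispatch : List Prog → Prog
  | [] => .skip
  | C :: Cs => .ite rToken (.op .sub rToken rToken rOne ;; dispatch Cs) C

/-- The edge is replaced by one labelled with the constant `1`. -/
def caseOne : Prog := blockEdge rFrom rTo rZero rZero rOne rOne

/-- The edge is replaced by one labelled with `z`. -/
def caseZ : Prog := blockEdge rFrom rTo rZero rFourPowK rOne rOne

/-- Replaces the edge by a path through a new node for one of the letters of a variable. -/
def copyStep : Prog :=
  .op .sub rIndex rIndex rOne ;; .op .add rArg rFirst rIndex ;; allocate ;;
  blockEdge rFrom rNode rOne rOne rArg rK ;; blockEdge rNode rTo rTwoPowK rTwoPowK rArg rK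

/-- The edge is replaced by parallel paths for the letters of a variable. -/
def caseX : Prog :=
  .load rArg rPtr ;; .op .add rPtr rPtr rOne ;; .op .mul rFirst rArg rQPred ;;
  .op .add rIndex rQPred rZero ;; .loop rIndex copyStep

/-- The edge is replaced by two consecutive edges, to be processed one after the other. -/
def caseMul : Prog := allocate ;; push rNode rTo ;; push rFrom rNode

/-- The edge is replaced by parallel edges, to be processed one after the other. -/
def caseAdd : Prog :=
  .load rIndex rPtr ;; .op .add rPtr rPtr rOne ;;
  .loop rIndex (.op .sub rIndex rIndex rOne ;; push rFrom rTo)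

/-- Processes the edges on the stack until it is empty. -/
def mainLoop : Prog :=
  .loop rDepth (fetch ;; dispatch [caseOne, caseZ, caseX, caseMul, caseAdd])

theorem dispatch_wp {Y i : ℕ} {Cs : List Prog} {C : Prog} {s : State} {Q : State → ℕ → Prop}
    (hC : Cs[i]? = some C) (hone : s.reg rOne = 1) (htok : s.reg rToken = i)
    (h : C.wp Y (s.setReg rToken 0) fun s' n => Q s' (n + (2 * i + 1))) :
    (dispatch Cs).wp Y s Q := by
  induction Cs generalizing i s Q with
  | nil => simp at hC
  | cons D Cs ih =>
    cases i with
    | zero =>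
      obtain rfl : D = C := by simpa using hC
      rw [State.setReg_eq_self htok] at h
      exact ⟨fun h0 => absurd htok h0, fun _ => h⟩
    | succ i =>
      refine ⟨fun _ => ?_, fun h0 => absurd (htok.symm.trans h0) (Nat.succ_ne_zero i)⟩
      refine ih (by simpa using hC) (by simpa using hone) (by simp [htok, hone]) ?_
      rw [State.setReg_setReg]
      convert h using 4
      ring

end RAM

/-- In passing from `vec` to `vec'`, the map `A` has been applied from the node `u` to the node `v`,
and no other node below `N` has changed. -/
structure ActsOn {R M : Type*} [Semiring R] [AddCommMonoid M] [Module R M] (A : Module.End R M)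
    (u v N : ℕ) (vec vec' : ℕ → M) : Prop where
  apply_dst : vec' v = vec v + A (vec u)
  apply_ne : ∀ i < N, i ≠ v → vec' i = vec i

namespace ActsOn

variable {R M : Type*} [Semiring R] [AddCommMonoid M] [Module R M] {A B : Module.End R M}
  {u v N N₁ : ℕ} {vec vec₁ vec₂ : ℕ → M}

theorem zero (u v N : ℕ) (vec : ℕ → M) : ActsOn (0 : Module.End R M) u v N vec vec :=
  ⟨(add_zero _).symm, fun _ _ _ => rfl⟩

theorem update (A : Module.End R M) (u v N : ℕ) (vec : ℕ → M) :
    ActsOn A u v N vec (Function.update vec v (vec v + A (vec u))) :=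
  ⟨Function.update_self .., fun _ _ hi => Function.update_of_ne hi ..⟩

theorem add (h : ActsOn A u v N vec vec₁) (h₁ : ActsOn B u v N₁ vec₁ vec₂) (hN : N ≤ N₁)
    (hu : u < N) (huv : u ≠ v) : ActsOn (A + B) u v N vec vec₂ where
  apply_dst := by
    rw [h₁.apply_dst, h.apply_dst, h.apply_ne u hu huv, LinearMap.add_apply, add_assoc]
  apply_ne i hi hiv := (h₁.apply_ne i (hi.trans_le hN) hiv).trans (h.apply_ne i hi hiv)

theorem comp (h : ActsOn A u N (N + 1) vec vec₁) (h₁ : ActsOn B N v N₁ vec₁ vec₂)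
    (hN : N < N₁) (hv : v < N) (hfresh : vec N = 0) : ActsOn (B ∘ₗ A) u v N vec vec₂ where
  apply_dst := by
    rw [h₁.apply_dst, h.apply_dst, hfresh, zero_add, h.apply_ne v (hv.trans N.lt_succ_self) hv.ne,
      LinearMap.comp_apply]
  apply_ne i hi hiv :=
    (h₁.apply_ne i (hi.trans hN) hiv).trans (h.apply_ne i (hi.trans N.lt_succ_self) hi.ne)

end ActsOn

namespace Params

variable {P : Params} {ptr N u v : ℕ} {σ : List (ℕ × ℕ)} {vec : ℕ → ℕ → ZMod P.modulus}
  {s : State} {Q : State → ℕ → Prop}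

theorem caseOne_wp (h : P.AtEdge ptr σ N vec u v s) (hs : s.Bounded P.bound) :
    caseOne.wp P.bound s fun s' n => ∃ vec', P.LoopInv ptr σ N vec' s' ∧
      ActsOn (Letter.one.act (ZMod P.modulus) P.k P.t) u v N vec vec' ∧ n ≤ P.edgeCost + 6 := by
  refine Prog.wp_mono hs (blockEdge_wp h.toLoopInv hs (fits_shift (Nat.zero_le _)) (by simp)
    h.src_lt h.dst_lt h.ne h.src h.dst (by rw [h.zero, h.one]; rfl)) ?_
  exact fun s' n _ ⟨h', _, hn⟩ => ⟨_, h', ActsOn.update _ _ _ _ _, hn⟩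

theorem caseZ_wp (h : P.AtEdge ptr σ N vec u v s) (hs : s.Bounded P.bound) :
    caseZ.wp P.bound s fun s' n => ∃ vec', P.LoopInv ptr σ N vec' s' ∧
      ActsOn (Letter.z.act (ZMod P.modulus) P.k P.t) u v N vec vec' ∧ n ≤ P.edgeCost + 6 := by
  refine Prog.wp_mono hs (blockEdge_wp h.toLoopInv hs (fits_shift le_rfl) (by simp)
    h.src_lt h.dst_lt h.ne h.src h.dst (by rw [h.zero, h.one, h.fourPowK]; rfl)) ?_
  exact fun s' n _ ⟨h', _, hn⟩ => ⟨_, h', ActsOn.update _ _ _ _ _, hn⟩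

theorem copyStep_wp {α : ℕ} (h : P.AtEdge ptr σ N vec u v s) (hs : s.Bounded P.bound)
    (hN : N + 1 ≤ P.maxBlocks) (hα : s.reg rFirst + (s.reg rIndex - 1) = α)
    (hαP : α ≤ P.letterBound) :
    copyStep.wp P.bound s fun s' n => ∃ vec', P.AtEdge ptr σ (N + 1) vec' u v s' ∧
      ActsOn ((Letter.x α).act (ZMod P.modulus) P.k P.t) u v N vec vec' ∧
      s'.reg rIndex = s.reg rIndex - 1 ∧ s'.reg rFirst = s.reg rFirst ∧
      n ≤ 2 * P.edgeCost + 16 := by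
  have hu := h.src_lt
  have hv := h.dst_lt
  simp only [copyStep, Prog.wp, State.setReg_reg, Nat.reduceEqDiff, if_true, if_false, h.one, hα]
  have hα_lt := hαP.trans_lt P.letterBound_lt_bound
  have hs₁ : ((s.setReg rIndex (s.reg rIndex - 1)).setReg rArg α).Bounded P.bound :=
    (hs.setReg ((Nat.sub_le _ _).trans_lt (hs.reg_lt _))).setReg hα_lt
  refine ⟨hα_lt, Prog.wp_mono hs₁ (allocate_wp ((h.toLoopInv.setReg (by omega) _).setReg
    (by omega) _) hN) ?_⟩
  rintro s₂ _ hs₂ ⟨h₂, hnode, hframe₂, rfl⟩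
  have harg : s₂.reg rArg = α := by rw [hframe₂ _ (by omega) (by omega)]; simp
  refine Prog.wp_mono hs₂ (blockEdge_wp h₂ hs₂ (fits_wedge (Nat.zero_le _) hαP) (by simp)
    (u := u) (v := N) (by omega) (by omega) hu.ne ?_ hnode
    (by rw [harg, h₂.k, h₂.one]; rfl)) ?_
  · rw [hframe₂ _ (by omega) (by omega)]; simp [h.src]
  rintro s₃ n₃ hs₃ ⟨h₃, hframe₃, hn₃⟩
  refine Prog.wp_mono hs₃ (blockEdge_wp h₃ hs₃ (fits_wedge le_rfl hαP) (by simp)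
    (u := N) (v := v) (by omega) (by omega) hv.ne' ?_ ?_
    (by rw [hframe₃ rArg (by omega), harg, h₃.k, h₃.twoPowK]; rfl)) ?_
  · rw [hframe₃ _ (by omega), hnode]
  · rw [hframe₃ _ (by omega), hframe₂ _ (by omega) (by omega)]; simp [h.dst]
  rintro s₄ n₄ - ⟨h₄, hframe₄, hn₄⟩
  have hframe : ∀ r, r ≤ rTo ∨ rNode < r → r ≠ rNext → s₄.reg r =
      ((s.setReg rIndex (s.reg rIndex - 1)).setReg rArg α).reg r := fun r hr hr' => by
    rw [hframe₄ r (by omega), hframe₃ r (by omega), hframe₂ r (by omega) hr']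
  refine ⟨_, h.of_loopInv h₄ (Nat.le_succ N) ?_ ?_,
    (ActsOn.update _ u N _ vec).comp (ActsOn.update _ N v (N + 1) _) N.lt_succ_self hv
      (h.fresh N le_rfl), ?_, ?_, by omega⟩
  all_goals rw [hframe _ (by omega) (by omega)]; simp

/-- The state of `caseX` for the variable `i` when the copies with an index below `j` are still to
be made, where `N` and `vec` describe the state before the first copy. -/
structure CopyInv (P : Params) (ptr : ℕ) (σ : List (ℕ × ℕ)) (N : ℕ)
    (vec vec' : ℕ → ℕ → ZMod P.modulus) (u v i j : ℕ) (s : State) : Prop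
    extends P.AtEdge ptr σ (N + (P.q - 1 - j)) vec' u v s where
  index : s.reg rIndex = j
  first : s.reg rFirst = i * (P.q - 1)
  acts : ActsOn (∑ l ∈ Ico j (P.q - 1),
    (Letter.x (i * (P.q - 1) + l)).act (ZMod P.modulus) P.k P.t) u v N vec vec'

theorem add_le_letterBound {i j : ℕ} (hi : i < P.n) (hj : j < P.q - 1) :
    i * (P.q - 1) + j ≤ P.letterBound := by
  have : (i + 1) * (P.q - 1) ≤ (P.n + 1) * P.q :=
    Nat.mul_le_mul (by omega) (Nat.sub_le _ _)
  unfold letterBound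
  linarith

theorem CopyInv.copyStep_wp {vec' : ℕ → ℕ → ZMod P.modulus} {i j : ℕ}
    (h : P.CopyInv ptr σ N vec vec' u v i (j + 1) s) (hs : s.Bounded P.bound) (hu : u < N)
    (hi : i < P.n) (hj : j < P.q - 1) (hN : N + P.q ≤ P.maxBlocks) :
    copyStep.wp P.bound s fun s' n => (∃ vec', P.CopyInv ptr σ N vec vec' u v i j s') ∧
      n ≤ 2 * P.edgeCost + 16 := by
  have hnew : N + (P.q - 1 - (j + 1)) + 1 = N + (P.q - 1 - j) := by omega
  refine Prog.wp_mono hs (Params.copyStep_wp h.toAtEdge hs (by omega)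
    (by rw [h.first, h.index, Nat.add_sub_cancel]) (add_le_letterBound hi hj)) ?_
  rintro s' n - ⟨vec'', h', hacts, hindex, hfirst, hn⟩
  refine ⟨⟨vec'', ⟨hnew ▸ h', hindex.trans (by rw [h.index, Nat.add_sub_cancel]),
    hfirst.trans h.first, ?_⟩⟩, hn⟩
  rw [sum_eq_sum_Ico_succ_bot hj, add_comm]
  exact h.acts.add hacts (Nat.le_add_right _ _) hu h.ne

theorem caseX_wp {i : ℕ} (h : P.AtEdge ptr σ N vec u v s) (hs : s.Bounded P.bound)
    (hi : P.input[ptr]? = some i) (hin : i < P.n) (hq : 2 ≤ P.q)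
    (hN : N + P.q ≤ P.maxBlocks) :
    caseX.wp P.bound s fun s' n => ∃ N' vec', P.LoopInv (ptr + 1) σ N' vec' s' ∧
      N ≤ N' ∧ N' ≤ N + P.q ∧
      ActsOn (∑ j ∈ range (P.q - 1), (Letter.x (i * (P.q - 1) + j)).act (ZMod P.modulus) P.k P.t)
        u v N vec vec' ∧ n ≤ P.q * (2 * P.edgeCost + 17) + 5 := by
  have hlen := P.three_mul_length_lt_bound
  have := (List.getElem?_eq_some_iff.1 hi).1
  have hfirst := (add_le_letterBound hin (j := 0) (by omega)).trans_lt P.letterBound_lt_bound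
  have hq_lt := hs.reg_lt rQPred
  rw [h.qPred] at hq_lt
  simp only [caseX, Prog.wp, State.setReg_reg, Nat.reduceEqDiff, if_true, if_false,
    h.one, h.zero, h.qPred, h.ptr, h.mem_eq hi, add_zero]
  refine ⟨by omega, hfirst, hq_lt, HaltsWith.countdown
    (fun j s => ∃ vec', P.CopyInv (ptr + 1) σ N vec vec' u v i j s) (2 * P.edgeCost + 16)
    (P.q - 1) (fun j s ⟨_, h'⟩ => h'.index)
    (fun j s hj ⟨_, h'⟩ hs => h'.copyStep_wp hs h.src_lt hin hj hN) ⟨vec, ?_⟩ ?_⟩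
  · refine ⟨?_, by simp, by simp, by simpa using ActsOn.zero u v N vec⟩
    rw [Nat.sub_self]
    exact (((h.setReg (by omega) _).setPtr _).setReg (by omega) _).setReg (by omega) _
  · rintro s' n ⟨vec', h'⟩ hn
    refine ⟨_, vec', h'.toLoopInv, Nat.le_add_right _ _, by omega, ?_, ?_⟩
    · simpa only [range_eq_Ico] using h'.acts
    · have : (P.q - 1) * (2 * P.edgeCost + 16 + 1) ≤ P.q * (2 * P.edgeCost + 17) :=
        Nat.mul_le_mul_right _ (Nat.sub_le _ _)
      omega

theorem caseMul_wp (h : P.AtEdge ptr σ N vec u v s) (hs : s.Bounded P.bound)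
    (hσ : σ.length + 2 ≤ P.input.length) (hN : N + 1 ≤ P.maxBlocks) :
    caseMul.wp P.bound s fun s' n =>
      P.LoopInv ptr ((u, N) :: (N, v) :: σ) (N + 1) vec s' ∧ n = 14 := by
  simp only [caseMul, Prog.wp]
  refine Prog.wp_mono hs (allocate_wp h.toLoopInv hN) ?_
  rintro s₁ _ hs₁ ⟨h₁, hnode, hframe, rfl⟩
  refine Prog.wp_mono hs₁ (push_wp h₁ (by omega) (by omega) (by omega) hnode
    ((hframe _ (by omega) (by omega)).trans h.dst)) ?_
  rintro s₂ _ hs₂ ⟨h₂, hframe₂, rfl⟩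
  refine Prog.wp_mono hs₂ (push_wp h₂ (u := u) (v := N) (by simp; omega) (by omega) (by omega)
    ?_ ?_) ?_
  · rw [hframe₂ _ (by omega) (by omega), hframe _ (by omega) (by omega), h.src]
  · rw [hframe₂ _ (by omega) (by omega), hnode]
  · rintro s₃ _ - ⟨h₃, -, rfl⟩
    exact ⟨h₃, rfl⟩

theorem caseAdd_wp {m : ℕ} (h : P.AtEdge ptr σ N vec u v s)
    (hm : P.input[ptr]? = some m) (hσ : σ.length + m ≤ P.input.length) :
    caseAdd.wp P.bound s fun s' n =>
      P.LoopInv (ptr + 1) (List.replicate m (u, v) ++ σ) N vec s' ∧ n ≤ 8 * m + 3 := by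
  have hlen := P.three_mul_length_lt_bound
  have := (List.getElem?_eq_some_iff.1 hm).1
  simp only [caseAdd, Prog.wp, State.setReg_reg, Nat.reduceEqDiff, if_false, h.one, h.ptr,
    h.mem_eq hm]
  refine ⟨by omega, HaltsWith.countdown (fun j s =>
    P.AtEdge (ptr + 1) (List.replicate (m - j) (u, v) ++ σ) N vec u v s ∧ s.reg rIndex = j) 7 m
    (fun j s h' => h'.2) ?_ ⟨?_, by simp⟩ ?_⟩
  · rintro j s hj ⟨h', hindex⟩ hs
    simp only [Prog.wp, h'.one, hindex, Nat.add_sub_cancel]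
    refine Prog.wp_mono (hs.setReg (by omega)) (push_wp (h'.toLoopInv.setReg (by omega) j)
      (u := u) (v := v) (by simp; omega) (by omega) (by omega) (by simp [h'.src])
      (by simp [h'.dst])) ?_
    rintro s₁ _ - ⟨h₁, hframe, rfl⟩
    refine ⟨⟨h'.of_loopInv ?_ le_rfl ?_ ?_, ?_⟩, by omega⟩
    · rwa [show m - j = m - (j + 1) + 1 by omega, List.replicate_succ]
    all_goals rw [hframe _ (by omega) (by omega)]; simp
  · rw [Nat.sub_self]
    exact (h.setReg (by omega) _).setPtr _
  · exact fun s' n h' hn => ⟨h'.1.toLoopInv, by omega⟩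

end Params

end Cases

section Processing

open Finset RAM

theorem cons_prefix_drop_iff {α : Type*} {l c : List α} {p : ℕ} {x : α} :
    x :: c <+: l.drop p ↔ l[p]? = some x ∧ c <+: l.drop (p + 1) := by
  rw [← List.drop_drop, ← List.head?_drop, List.drop_one]
  cases l.drop p <;> simp [List.cons_prefix_cons, eq_comm]

theorem append_prefix_drop_iff {α : Type*} {l c d : List α} {p : ℕ} :
    c ++ d <+: l.drop p ↔ c <+: l.drop p ∧ d <+: l.drop (p + c.length) := by
  induction c generalizing p with
  | nil => simp
  | cons x c ih =>
    rw [List.cons_append, cons_prefix_drop_iff, cons_prefix_drop_iff, ih, and_assoc,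
      List.length_cons, add_right_comm, add_assoc]

namespace Params

/-- A bound on the number of steps of the main loop for a number of the input. -/
def tokenCost (P : Params) : ℕ := P.q * (2 * P.edgeCost + 17) + 40

/-- The state `s` of the main loop in which the edge from `u` to `v` is to be processed with `e`
formulas in turn, described by `code`, which comes next in the input. -/
structure Ready (P : Params) (code : List ℕ) (e p u v : ℕ) (σ : List (ℕ × ℕ)) (N : ℕ)
    (vec : ℕ → ℕ → ZMod P.modulus) (s : State) : Prop
    extends P.LoopInv p (List.replicate e (u, v) ++ σ) N vec s where
  prefix_drop : code <+: P.input.drop p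
  src_lt : u < N
  dst_lt : v < N
  ne : u ≠ v
  depth_add_le : σ.length + code.length ≤ P.input.length
  next_add_le : N + P.q * code.length ≤ P.maxBlocks

/-- The state `s` of the main loop, with nodes `N'` and vectors `vec'`, that arises from a state as
in `Ready` by processing the formulas, which together act by `A`. -/
structure Finished (P : Params) (code : List ℕ)
    (A : Module.End (ZMod P.modulus) (ℕ → ZMod P.modulus)) (ptr u v : ℕ) (σ : List (ℕ × ℕ)) (N : ℕ)
    (vec : ℕ → ℕ → ZMod P.modulus) (N' : ℕ) (vec' : ℕ → ℕ → ZMod P.modulus) (s : State) : Prop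
    extends P.LoopInv (ptr + code.length) σ N' vec' s where
  le_next : N ≤ N'
  next_le' : N' ≤ N + P.q * code.length
  acts : ActsOn A u v N vec vec'

/-- Processing the formulas described by `code`, which together act by `A`, takes the main loop from
a state as in `Ready` to one as in `Finished`. The bound on the number `n` of steps leaves `8` steps
for each of the `e` edges, which pay for putting them on the stack. -/
def Processes (P : Params) (code : List ℕ) (e : ℕ)
    (A : Module.End (ZMod P.modulus) (ℕ → ZMod P.modulus)) : Prop :=
  ∀ ⦃ptr u v σ N vec s⦄ ⦃Q : State → ℕ → Prop⦄, P.Ready code e ptr u v σ N vec s →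
    (∀ s' N' vec' n, P.Finished code A ptr u v σ N vec N' vec' s' →
      n + 8 * e ≤ P.tokenCost * code.length →
      HaltsWith P.bound mainLoop s' fun s₂ n₂ => Q s₂ (n + n₂)) →
    HaltsWith P.bound mainLoop s Q

variable {P : Params}

theorem mainLoop_step {ptr N u v x : ℕ} {σ : List (ℕ × ℕ)} {vec : ℕ → ℕ → ZMod P.modulus}
    {s : State} {Q : State → ℕ → Prop} {C : Prog} (h : P.LoopInv ptr ((u, v) :: σ) N vec s)
    (hu : u < N) (hv : v < N) (huv : u ≠ v) (hx : P.input[ptr]? = some x)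
    (hC : [caseOne, caseZ, caseX, caseMul, caseAdd][x]? = some C)
    (H : ∀ s₁, P.AtEdge (ptr + 1) σ N vec u v s₁ → s₁.Bounded P.bound →
      C.wp P.bound s₁ fun s₂ n =>
        HaltsWith P.bound mainLoop s₂ fun s' n' => Q s' (n + (2 * x + 10) + n')) :
    HaltsWith P.bound mainLoop s Q := by
  refine .loop_step (by rw [h.depth]; simp) fun hs => ?_
  simp only [Prog.wp]
  refine Prog.wp_mono hs (fetch_wp h hu hv huv hx) ?_
  rintro s₁ _ hs₁ ⟨h₁, htok, rfl⟩
  refine dispatch_wp hC h₁.one htok ?_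
  have hpos := (Nat.zero_le _).trans_lt (hs₁.reg_lt 0)
  refine Prog.wp_mono (hs₁.setReg hpos) (H _ (h₁.setReg (by omega) 0) (hs₁.setReg hpos)) ?_
  exact fun s₂ n _ hn => hn.mono fun s' n' _ h' => by convert h' using 1; ring

theorem edgeCost_add_le_tokenCost (hq : 2 ≤ P.q) : P.edgeCost + 57 ≤ P.tokenCost := by
  have := Nat.mul_le_mul_right (2 * P.edgeCost + 17) (one_le_two.trans hq)
  unfold tokenCost
  omega

theorem processes_one (hq : 2 ≤ P.q) :
    P.Processes [0] 1 (Letter.one.act (ZMod P.modulus) P.k P.t) := by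
  intro ptr u v σ N vec s Q h hQ
  have hcost := edgeCost_add_le_tokenCost hq
  refine mainLoop_step h.toLoopInv h.src_lt h.dst_lt h.ne
    (cons_prefix_drop_iff.1 h.prefix_drop).1 (C := caseOne) rfl fun s₁ h₁ hs₁ => ?_
  refine Prog.wp_mono hs₁ (caseOne_wp h₁ hs₁) ?_
  rintro s₂ n - ⟨vec', h₂, hacts, hn⟩
  exact hQ s₂ N vec' _ ⟨h₂, le_rfl, Nat.le_add_right _ _, hacts⟩ (by simp; omega)

theorem processes_z (hq : 2 ≤ P.q) :
    P.Processes [1] 1 (Letter.z.act (ZMod P.modulus) P.k P.t) := by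
  intro ptr u v σ N vec s Q h hQ
  have hcost := edgeCost_add_le_tokenCost hq
  refine mainLoop_step h.toLoopInv h.src_lt h.dst_lt h.ne
    (cons_prefix_drop_iff.1 h.prefix_drop).1 (C := caseZ) rfl fun s₁ h₁ hs₁ => ?_
  refine Prog.wp_mono hs₁ (caseZ_wp h₁ hs₁) ?_
  rintro s₂ n - ⟨vec', h₂, hacts, hn⟩
  exact hQ s₂ N vec' _ ⟨h₂, le_rfl, Nat.le_add_right _ _, hacts⟩ (by simp; omega)

theorem processes_x {i : ℕ} (hq : 2 ≤ P.q) (hi : i < P.n) :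
    P.Processes [2, i] 1
      (∑ j ∈ range (P.q - 1), (Letter.x (i * (P.q - 1) + j)).act (ZMod P.modulus) P.k P.t) := by
  intro ptr u v σ N vec s Q h hQ
  have hN := h.next_add_le
  simp only [List.length_cons, List.length_nil, zero_add, Nat.reduceAdd] at hN
  obtain ⟨htok, harg⟩ := cons_prefix_drop_iff.1 h.prefix_drop
  refine mainLoop_step h.toLoopInv h.src_lt h.dst_lt h.ne htok (C := caseX) rfl
    fun s₁ h₁ hs₁ => ?_
  refine Prog.wp_mono hs₁ (caseX_wp h₁ hs₁ (cons_prefix_drop_iff.1 harg).1 hi hq (by omega)) ?_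
  rintro s₂ n - ⟨N', vec', h₂, hN', hN'', hacts, hn⟩
  refine hQ s₂ N' vec' _ ⟨h₂, hN', by simp; omega, hacts⟩ ?_
  simp only [tokenCost, List.length_cons, List.length_nil]
  omega

theorem Processes.mul {c d : List ℕ} {A B : Module.End (ZMod P.modulus) (ℕ → ZMod P.modulus)}
    (hc : P.Processes c 1 A) (hd : P.Processes d 1 B) (hq : 2 ≤ P.q) (hc0 : 0 < c.length)
    (hd0 : 0 < d.length) : P.Processes (3 :: (c ++ d)) 1 (B ∘ₗ A) := by
  intro ptr u v σ N vec s Q h hQ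
  have hinv : P.LoopInv ptr ((u, v) :: σ) N vec s := h.toLoopInv
  have hu := h.src_lt
  have hv := h.dst_lt
  have hσ := h.depth_add_le
  have hN := h.next_add_le
  have hcost := edgeCost_add_le_tokenCost hq
  obtain ⟨htok, hargs⟩ := cons_prefix_drop_iff.1 h.prefix_drop
  obtain ⟨hc_drop, hd_drop⟩ := append_prefix_drop_iff.1 hargs
  have hlen : (3 :: (c ++ d)).length = c.length + d.length + 1 := by simp
  simp only [hlen, mul_add, mul_one] at hσ hN hQ
  refine mainLoop_step hinv hu hv h.ne htok (C := caseMul) rfl fun s₁ h₁ hs₁ => ?_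
  refine Prog.wp_mono hs₁ (caseMul_wp h₁ hs₁ (by omega) (by omega)) ?_
  rintro s₂ _ - ⟨h₂, rfl⟩
  refine hc (σ := (N, v) :: σ) ⟨h₂, hc_drop, by omega, by omega, by omega, by simp; omega,
    by omega⟩ ?_
  rintro s₃ N₃ vec₃ n₃ h₃ hn₃
  have hN₃ := h₃.le_next
  have hN₃' := h₃.next_le'
  refine hd ⟨h₃.toLoopInv, hd_drop, by omega, by omega, by omega, by omega, by omega⟩ ?_
  rintro s₄ N₄ vec₄ n₄ h₄ hn₄
  have hN₄ := h₄.le_next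
  have hN₄' := h₄.next_le'
  have hfinal : P.LoopInv (ptr + (3 :: (c ++ d)).length) σ N₄ vec₄ s₄ := by
    convert h₄.toLoopInv using 1
    omega
  have hacts := h₃.acts.comp h₄.acts (by omega) hv (hinv.fresh N le_rfl)
  refine (hQ s₄ N₄ vec₄ (n₃ + n₄ + 30) ⟨hfinal, by omega, ?_, hacts⟩ (by omega)).mono ?_
  · rw [hlen, mul_add, mul_add]
    omega
  · exact fun _ _ _ h' => by convert h' using 1; ring

theorem processes_nil : P.Processes [] 0 0 := by
  intro ptr u v σ N vec s Q h hQ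
  refine (hQ s N vec 0 ⟨h.toLoopInv, le_rfl, Nat.le_add_right _ _, .zero _ _ _ _⟩ (by simp)).mono ?_
  simp

theorem Processes.append {c d : List ℕ} {e e' : ℕ}
    {A B : Module.End (ZMod P.modulus) (ℕ → ZMod P.modulus)} (hc : P.Processes c e A)
    (hd : P.Processes d e' B) (he' : e' ≤ d.length) : P.Processes (c ++ d) (e + e') (A + B) := by
  intro ptr u v σ N vec s Q h hQ
  have hu := h.src_lt
  have hv := h.dst_lt
  have hσ := h.depth_add_le
  have hN := h.next_add_le
  obtain ⟨hc_drop, hd_drop⟩ := append_prefix_drop_iff.1 h.prefix_drop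
  simp only [List.length_append, mul_add] at hσ hN hQ
  have hinv :
      P.LoopInv ptr (List.replicate e (u, v) ++ (List.replicate e' (u, v) ++ σ)) N vec s := by
    rw [← List.append_assoc, List.replicate_append_replicate]
    exact h.toLoopInv
  refine hc ⟨hinv, hc_drop, hu, hv, h.ne, by simp; omega, by omega⟩ ?_
  rintro s₁ N₁ vec₁ n₁ h₁ hn₁
  have hN₁ := h₁.le_next
  have hN₁' := h₁.next_le'
  refine hd ⟨h₁.toLoopInv, hd_drop, by omega, by omega, h.ne, by omega, by omega⟩ ?_
  rintro s₂ N₂ vec₂ n₂ h₂ hn₂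
  have hN₂ := h₂.le_next
  have hN₂' := h₂.next_le'
  have hfinal : P.LoopInv (ptr + (c ++ d).length) σ N₂ vec₂ s₂ := by
    rw [List.length_append, ← add_assoc]
    exact h₂.toLoopInv
  have hacts := h₁.acts.add h₂.acts hN₁ hu h.ne
  refine (hQ s₂ N₂ vec₂ (n₁ + n₂) ⟨hfinal, by omega, ?_, hacts⟩ (by omega)).mono ?_
  · rw [List.length_append, mul_add]
    omega
  · exact fun _ _ _ h' => by rwa [← add_assoc]

theorem processes_flatten_encode {L : List (Formula P.n)}
    (h : ∀ φ ∈ L, P.Processes φ.encode 1 (φ.act (ZMod P.modulus) P.k P.t (P.q - 1))) :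
    P.Processes (L.map Formula.encode).flatten L.length
      (L.map (Formula.act (ZMod P.modulus) P.k P.t (P.q - 1))).sum := by
  induction L with
  | nil => exact processes_nil
  | cons φ L ih =>
    rw [List.forall_mem_cons] at h
    rw [List.map_cons, List.flatten_cons, List.length_cons, List.map_cons, List.sum_cons,
      add_comm L.length]
    exact h.1.append (ih h.2) (Formula.length_le_length_flatten_encode L)

theorem Processes.add {m : ℕ} {code : List ℕ}
    {A : Module.End (ZMod P.modulus) (ℕ → ZMod P.modulus)} (h : P.Processes code m A)
    (hq : 2 ≤ P.q) (hm : m ≤ code.length) : P.Processes (4 :: m :: code) 1 A := by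
  intro ptr u v σ N vec s Q hs hQ
  have hinv : P.LoopInv ptr ((u, v) :: σ) N vec s := hs.toLoopInv
  have hσ := hs.depth_add_le
  have hN := hs.next_add_le
  have hcost := edgeCost_add_le_tokenCost hq
  obtain ⟨htok, hargs⟩ := cons_prefix_drop_iff.1 hs.prefix_drop
  obtain ⟨harg, hcode⟩ := cons_prefix_drop_iff.1 hargs
  have hlen : (4 :: m :: code).length = code.length + 2 := by simp
  simp only [hlen, mul_add] at hσ hN hQ
  refine mainLoop_step hinv hs.src_lt hs.dst_lt hs.ne htok (C := caseAdd) rfl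
    fun s₁ h₁ hs₁ => ?_
  refine Prog.wp_mono hs₁ (caseAdd_wp h₁ harg (by omega)) ?_
  rintro s₂ n₂ - ⟨h₂, hn₂⟩
  refine h ⟨h₂, hcode, hs.src_lt, hs.dst_lt, hs.ne, by omega, by omega⟩ ?_
  rintro s₃ N₃ vec₃ n₃ h₃ hn₃
  have hN₃ := h₃.next_le'
  have hfinal : P.LoopInv (ptr + (4 :: m :: code).length) σ N₃ vec₃ s₃ := by
    convert h₃.toLoopInv using 1
    omega
  refine (hQ s₃ N₃ vec₃ (n₂ + n₃ + 18) ⟨hfinal, h₃.le_next, ?_, h₃.acts⟩ (by omega)).mono ?_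
  · rw [hlen, mul_add]
    omega
  · exact fun _ _ _ h' => by convert h' using 1; ring

theorem processes_encode (hq : 2 ≤ P.q) (φ : Formula P.n) :
    P.Processes φ.encode 1 (φ.act (ZMod P.modulus) P.k P.t (P.q - 1)) := by
  induction φ with
  | one => exact processes_one hq
  | z => exact processes_z hq
  | x i => exact processes_x hq i.2
  | mul a b iha ihb => exact iha.mul ihb hq a.length_encode_pos b.length_encode_pos
  | add m f ih =>
    have hlist := processes_flatten_encode (L := List.ofFn f) (by simpa using ih)
    have hlen := Formula.length_le_length_flatten_encode (List.ofFn f)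
    rw [List.map_ofFn, List.length_ofFn] at hlen
    rw [List.map_ofFn, List.map_ofFn, List.sum_ofFn, List.length_ofFn] at hlist
    exact hlist.add hq hlen

end Params

end Processing

section Scan

open RAM

namespace RAM

/-- How to skip the argument of the first number of the code of a formula, by that number. -/
def scanCases : List Prog :=
  [.skip, .skip, .op .add rPtr rPtr rOne, .op .add rDepth rDepth rTwo,
    .load rIndex rPtr ;; .op .add rPtr rPtr rOne ;; .op .add rDepth rDepth rIndex]

/-- Skips the first number of the code of a formula and its argument; the register `rDepth` holds
the number of formulas yet to be skipped. -/
def scanStep : Prog :=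
  .op .sub rDepth rDepth rOne ;; .load rToken rPtr ;; .op .add rPtr rPtr rOne ;;
  dispatch scanCases

/-- Finds the end of the input. -/
def scanLoop : Prog := .loop rDepth scanStep

end RAM

/-- The list `head` can start the code of a formula and continues with the codes of `e` formulas. -/
inductive IsHead : (head : List ℕ) → (e : ℕ) → Prop
  | one : IsHead [0] 0
  | z : IsHead [1] 0
  | x (i : ℕ) : IsHead [2, i] 0
  | mul : IsHead [3] 2
  | add (m : ℕ) : IsHead [4, m] m

namespace Params

/-- The states after the parameters have been read. -/
structure ParamsRead (P : Params) (s : State) : Prop where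
  zero : s.reg rZero = 0
  n : s.reg rN = P.n
  k : s.reg rK = P.k
  t : s.reg rT = P.t
  qPred : s.reg rQPred = P.q - 1
  one : s.reg rOne = 1
  two : s.reg rTwo = 2
  mem : s.mem = fun a => P.input.getD a 0

/-- The states of the scan: the input from `ptr` on is still to be read, and it starts with the
codes of `d` formulas. -/
structure Scanning (P : Params) (ptr d : ℕ) (s : State) : Prop extends P.ParamsRead s where
  ptr : s.reg rPtr = ptr
  depth : s.reg rDepth = d

/-- Skipping the codes of `e` formulas, which make up `code`. -/
def Scans (P : Params) (code : List ℕ) (e : ℕ) : Prop :=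
  ∀ ⦃ptr d s⦄ ⦃Q : State → ℕ → Prop⦄, P.Scanning ptr (e + d) s → code <+: P.input.drop ptr →
    d + code.length ≤ P.input.length →
    (∀ s' n, P.Scanning (ptr + code.length) d s' → n ≤ 16 * code.length →
      HaltsWith P.bound scanLoop s' fun s₂ n₂ => Q s₂ (n + n₂)) →
    HaltsWith P.bound scanLoop s Q

variable {P : Params} {s s' : State}

theorem ParamsRead.congr (h : P.ParamsRead s) (hreg : ∀ r ≤ rTwo, s'.reg r = s.reg r)
    (hmem : s'.mem = s.mem) : P.ParamsRead s' := by
  constructor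
  case mem => exact hmem.trans h.mem
  all_goals rw [hreg _ (by omega)]
  exacts [h.zero, h.n, h.k, h.t, h.qPred, h.one, h.two]

theorem ParamsRead.setReg {r : ℕ} (h : P.ParamsRead s) (hr : rTwo < r) (x : ℕ) :
    P.ParamsRead (s.setReg r x) :=
  h.congr (fun r' hr' => by rw [State.setReg_reg, if_neg (by omega)]) rfl

theorem ParamsRead.mem_eq {ptr x : ℕ} (h : P.ParamsRead s) (hx : P.input[ptr]? = some x) :
    s.mem ptr = x := by
  simp only [h.mem, List.getD_eq_getElem?_getD, hx, Option.getD_some]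

theorem scanStep_wp_of_getElem? {x ptr d : ℕ} {C : Prog} {Q : State → ℕ → Prop}
    (h : P.Scanning ptr (d + 1) s) (hx : P.input[ptr]? = some x)
    (hC : scanCases[x]? = some C)
    (H : ∀ s₁, P.Scanning (ptr + 1) d s₁ → C.wp P.bound s₁ fun s' n =>
      Q s' (1 + (1 + (1 + (n + (2 * x + 1)))))) :
    scanStep.wp P.bound s Q := by
  have hlen := P.three_mul_length_lt_bound
  have hptr := (List.getElem?_eq_some_iff.1 hx).1
  simp only [scanStep, Prog.wp, State.setReg_reg, State.setReg_mem, Nat.reduceEqDiff, if_false,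
    h.one, h.depth, h.ptr, h.mem_eq hx, Nat.add_sub_cancel]
  refine ⟨by omega, dispatch_wp hC (by simp [h.one]) (by simp) (H _ ⟨?_, by simp, by simp⟩)⟩
  refine (((h.toParamsRead.setReg ?_ _).setReg ?_ _).setReg ?_ _).setReg ?_ _ <;> simp

theorem scanStep_wp {head : List ℕ} {e ptr d : ℕ} (h : P.Scanning ptr (d + 1) s)
    (hhead : IsHead head e) (hdrop : head <+: P.input.drop ptr)
    (hd : d + e + 1 ≤ P.input.length) :
    scanStep.wp P.bound s fun s' n => P.Scanning (ptr + head.length) (e + d) s' ∧ n ≤ 15 := by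
  have hlen := P.three_mul_length_lt_bound
  cases hhead with
  | one =>
    refine scanStep_wp_of_getElem? h (cons_prefix_drop_iff.1 hdrop).1 rfl fun s₁ h₁ => ?_
    exact ⟨by simpa using h₁, by simp⟩
  | z =>
    refine scanStep_wp_of_getElem? h (cons_prefix_drop_iff.1 hdrop).1 rfl fun s₁ h₁ => ?_
    exact ⟨by simpa using h₁, by simp⟩
  | x i =>
    obtain ⟨htok, harg⟩ := cons_prefix_drop_iff.1 hdrop
    have hptr := (List.getElem?_eq_some_iff.1 (cons_prefix_drop_iff.1 harg).1).1
    refine scanStep_wp_of_getElem? h htok rfl fun s₁ h₁ => ?_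
    simp only [Prog.wp, h₁.one, h₁.ptr]
    refine ⟨by omega, ⟨h₁.toParamsRead.setReg (by simp) _, ?_, ?_⟩, by simp⟩
    · simp
    · simp [h₁.depth]
  | mul =>
    refine scanStep_wp_of_getElem? h (cons_prefix_drop_iff.1 hdrop).1 rfl fun s₁ h₁ => ?_
    simp only [Prog.wp, h₁.two, h₁.depth]
    refine ⟨by omega, ⟨h₁.toParamsRead.setReg (by simp) _, ?_, ?_⟩, by simp⟩
    · simp [h₁.ptr]
    · simp [add_comm]
  | add m =>
    obtain ⟨htok, harg⟩ := cons_prefix_drop_iff.1 hdrop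
    have harg := (cons_prefix_drop_iff.1 harg).1
    have hptr := (List.getElem?_eq_some_iff.1 harg).1
    refine scanStep_wp_of_getElem? h htok rfl fun s₁ h₁ => ?_
    simp only [Prog.wp, State.setReg_reg, Nat.reduceEqDiff, if_true, if_false, h₁.one, h₁.ptr,
      h₁.depth, h₁.mem_eq harg]
    refine ⟨by omega, by omega, ⟨?_, by simp [add_assoc], by simp [add_comm]⟩, by simp⟩
    refine ((h₁.toParamsRead.setReg ?_ _).setReg ?_ _).setReg ?_ _ <;> simp

theorem scans_nil : P.Scans [] 0 := by
  intro ptr d s Q h _ _ hQ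
  rw [zero_add] at h
  simpa using hQ s 0 h le_rfl

theorem Scans.append {b c : List ℕ} {e e' : ℕ} (hb : P.Scans b e) (hc : P.Scans c e')
    (he' : e' ≤ c.length) : P.Scans (b ++ c) (e + e') := by
  intro ptr d s Q h hdrop hd hQ
  obtain ⟨hb_drop, hc_drop⟩ := append_prefix_drop_iff.1 hdrop
  simp only [List.length_append, ← add_assoc] at hd hQ
  rw [add_assoc] at h
  refine hb h hb_drop (by omega) fun s₁ n₁ h₁ hn₁ => ?_
  refine hc h₁ hc_drop (by omega) fun s₂ n₂ h₂ hn₂ => (hQ s₂ (n₁ + n₂) h₂ (by omega)).mono ?_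
  exact fun _ _ _ h' => by rwa [← add_assoc]

theorem Scans.head_append {head code : List ℕ} {e : ℕ} (hcode : P.Scans code e)
    (hhead : IsHead head e) (he : e ≤ code.length) : P.Scans (head ++ code) 1 := by
  intro ptr d s Q h hdrop hd hQ
  obtain ⟨hhead_drop, hcode_drop⟩ := append_prefix_drop_iff.1 hdrop
  have hpos : 0 < head.length := by cases hhead <;> simp
  simp only [List.length_append, ← add_assoc] at hd hQ
  rw [add_comm] at h
  refine .loop_step (by rw [h.depth]; simp) fun hs => ?_
  refine Prog.wp_mono hs (scanStep_wp h hhead hhead_drop (by omega)) ?_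
  rintro s₁ n₁ - ⟨h₁, hn₁⟩
  refine hcode h₁ hcode_drop (by omega) fun s₂ n₂ h₂ hn₂ => ?_
  refine (hQ s₂ (1 + n₁ + n₂) h₂ (by omega)).mono ?_
  exact fun _ _ _ h' => by rwa [← add_assoc]

theorem scans_flatten_encode {n : ℕ} {L : List (Formula n)} (h : ∀ φ ∈ L, P.Scans φ.encode 1) :
    P.Scans (L.map Formula.encode).flatten L.length := by
  induction L with
  | nil => exact scans_nil
  | cons φ L ih =>
    rw [List.forall_mem_cons] at h
    rw [List.map_cons, List.flatten_cons, List.length_cons, add_comm L.length]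
    exact h.1.append (ih h.2) (Formula.length_le_length_flatten_encode L)

theorem scans_encode {n : ℕ} (φ : Formula n) : P.Scans φ.encode 1 := by
  induction φ with
  | one => exact scans_nil.head_append .one le_rfl
  | z => exact scans_nil.head_append .z le_rfl
  | x i => exact scans_nil.head_append (.x i) le_rfl
  | mul a b iha ihb =>
    have ha := a.length_encode_pos
    have hb := b.length_encode_pos
    exact (iha.append ihb hb).head_append .mul (by rw [List.length_append]; omega)
  | add m f ih =>
    have hlist := scans_flatten_encode (L := List.ofFn f) (by simpa using ih)
    have hlen := Formula.length_le_length_flatten_encode (List.ofFn f)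
    rw [List.map_ofFn, List.length_ofFn] at hlist hlen
    exact hlist.head_append (.add m) hlen

end Params

end Scan

section Algorithm

open Finset RAM

namespace RAM

/-- Puts the power of the contents of `a` to the contents of `l` into the register `r`. -/
def power (r a l : ℕ) : Prog :=
  .const r 1 ;; .loop l (.op .sub l l rOne ;; .op .mul r r a)

/-- Reads the parameters, and points at the formula. -/
def readParams (q : ℕ) : Prog :=
  .const rOne 1 ;; .const rTwo 2 ;; .const rQPred (q - 1) ;; .load rN rZero ;; .load rK rOne ;;
  .load rT rTwo ;; .op .add rPtr rOne rTwo ;; .const rDepth 1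

/-- Computes the modulus from the parameters and the length of the input. -/
def computeModulus : Prog :=
  .op .add rLen rPtr rZero ;; .op .add rTmp₁ rN rOne ;; .op .add rTmp₂ rQPred rOne ;;
  .op .mul rTmp₁ rTmp₁ rTmp₂ ;; .op .add rTmp₁ rTmp₁ rOne ;; .op .mul rIter rK rK ;;
  .op .mul rIter rIter rTwo ;; .op .add rIter rIter rLen ;; .op .add rIter rIter rOne ;;
  power rMod rTmp₁ rIter

/-- Computes the sizes of the blocks and of their parts. -/
def computeSizes : Prog :=
  .op .add rIter rK rZero ;; power rTwoPowK rTwo rIter ;; .op .mul rFourPowK rTwoPowK rTwoPowK ;;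
  .op .add rSources rT rOne ;; .op .mul rSources rSources rFourPowK ;;
  .op .add rBlock rSources rFourPowK

/-- Points at the formula, creates the first node, and puts the vector `Pi.single 0 1` there. -/
def firstNode : Prog :=
  .op .add rPtr rOne rTwo ;; .op .mul rFrom rLen rTwo ;; .op .add rFrom rFrom rLen ;;
  .store rFrom rOne ;; .op .add rNext rFrom rBlock

/-- Creates two nodes, and puts the edge between them on the stack. -/
def start : Prog := firstNode ;; allocate ;; push rFrom rNode

/-- Reads off from the second block whether its vector has a nonzero top coefficient. -/
def answer : Prog :=
  .op .mul rCell rLen rTwo ;; .op .add rCell rCell rLen ;; .op .add rCell rCell rBlock ;;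
  .op .sub rTmp₁ rSources rOne ;; .op .add rCell rCell rTmp₁ ;; .load rVal rCell ;;
  .ite rVal (.const rZero 1) .skip

/-- The decision procedure. -/
def algorithm (q : ℕ) : Prog :=
  readParams q ;; scanLoop ;; computeModulus ;; computeSizes ;; start ;; mainLoop ;; answer

theorem power_wp {Y r a l : ℕ} {s : State} {Q : State → ℕ → Prop} (hone : s.reg rOne = 1)
    (hr : r ≠ rOne) (hl : l ≠ rOne) (hra : r ≠ a) (hrl : r ≠ l) (hla : l ≠ a) (ha : 0 < s.reg a)
    (hY : s.reg a ^ s.reg l < Y)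
    (hQ : ∀ s' n, s'.reg r = s.reg a ^ s.reg l → (∀ r', r' ≠ r → r' ≠ l → s'.reg r' = s.reg r') →
      s'.mem = s.mem → n ≤ 3 * s.reg l + 2 → Q s' n) :
    (power r a l).wp Y s Q := by
  have hpow {i : ℕ} (hi : i ≤ s.reg l) : s.reg a ^ i < Y :=
    (Nat.pow_le_pow_right ha hi).trans_lt hY
  refine ⟨by simpa using hpow (Nat.zero_le _), ?_⟩
  refine HaltsWith.countdown (fun i s' => s'.reg l = i ∧ s'.reg r = s.reg a ^ (s.reg l - i) ∧
    (∀ r', r' ≠ r → r' ≠ l → s'.reg r' = s.reg r') ∧ s'.mem = s.mem) 2 (s.reg l)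
    (fun _ _ h => h.1) ?_ ?_ ?_
  · rintro i s' hi ⟨hcount, hval, hframe, hmem⟩ -
    have hsucc : s.reg a ^ (s.reg l - (i + 1)) * s.reg a = s.reg a ^ (s.reg l - i) := by
      rw [← pow_succ]
      congr 1
      omega
    simp only [Prog.wp, State.setReg_reg, State.setReg_mem, hrl, hrl.symm, hla.symm,
      if_true, if_false, hcount, hval, hmem, hframe _ hr.symm hl.symm,
      hframe _ hra.symm hla.symm, hone, hsucc, Nat.add_sub_cancel, true_and, and_true, le_refl,
      hpow (Nat.sub_le (s.reg l) i)]
    exact fun r' hr' hl' => by rw [if_neg hr', if_neg hl', hframe _ hr' hl']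
  · simp +contextual [hrl.symm]
  · rintro s' n ⟨-, hval, hframe, hmem⟩ hn
    exact hQ s' _ (by rw [hval, Nat.sub_zero]) hframe hmem (by omega)

end RAM

namespace Params

variable {P : Params} {s : State} {φ : Formula P.n}

theorem readParams_wp (hq : 2 ≤ P.q) (hinput : P.input = inputWord P.k P.t φ) :
    (readParams P.q).wp P.bound (State.init P.input) fun s' n => P.Scanning 3 1 s' ∧ n = 8 := by
  have hlen := P.three_mul_length_lt_bound
  have hle : P.q ≤ P.letterBound := by unfold letterBound; nlinarith
  have hlt := P.letterBound_lt_bound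
  have hpos : 3 ≤ P.input.length := by simp [hinput, inputWord]
  simp only [readParams, Prog.wp, State.setReg_reg, State.setReg_mem, Nat.reduceEqDiff, if_true,
    if_false]
  refine ⟨by omega, by omega, by omega, by omega, by omega,
    ⟨⟨?_, ?_, ?_, ?_, ?_, ?_, ?_, ?_⟩, ?_, ?_⟩, trivial⟩
  all_goals simp [State.init, hinput, inputWord]

theorem scanLoop_wp (hinput : P.input = inputWord P.k P.t φ) (h : P.Scanning 3 1 s) :
    scanLoop.wp P.bound s fun s' n => P.Scanning P.input.length 0 s' ∧
      n ≤ 16 * P.input.length := by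
  have hlen : P.input.length = 3 + φ.encode.length := by
    rw [hinput, inputWord]
    simp only [List.length_cons]
    omega
  refine P.scans_encode φ (d := 0) h (by rw [hinput, inputWord]; rfl)
    (by omega) fun s' n h' hn => ?_
  rw [← hlen] at h'
  have := φ.length_encode_pos
  exact .loop_done h'.depth ⟨h', by omega⟩

theorem computeModulus_wp (hq : 2 ≤ P.q) (h : P.Scanning P.input.length 0 s) :
    computeModulus.wp P.bound s fun s' n => P.ParamsRead s' ∧ s'.reg rMod = P.modulus ∧
      s'.reg rLen = P.input.length ∧ s'.reg rDepth = 0 ∧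
      n ≤ 3 * P.input.length + 6 * (P.k * P.k) + 14 := by
  have hbase : (P.n + 1) * (P.q - 1 + 1) + 1 = P.letterBound := by
    rw [Nat.sub_add_cancel (by omega)]
    rfl
  have hn : P.n + 1 ≤ (P.n + 1) * (P.q - 1 + 1) := Nat.le_mul_of_pos_right _ (by omega)
  have hqn : P.q - 1 + 1 ≤ (P.n + 1) * (P.q - 1 + 1) := Nat.le_mul_of_pos_left _ (by omega)
  have hexp : P.input.length + 2 * (P.k * P.k) + 1 < P.modulus := Nat.lt_pow_self (by omega)
  have hlt := P.letterBound_lt_bound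
  have hmod := P.modulus_lt_bound
  have hpow : P.letterBound ^ (P.input.length + 2 * (P.k * P.k) + 1) = P.modulus := rfl
  have hexp_eq : P.k * P.k * 2 + P.input.length = P.input.length + 2 * (P.k * P.k) := by ring
  simp only [computeModulus, Prog.wp, State.setReg_reg, Nat.reduceEqDiff, if_true, if_false,
    h.zero, h.n, h.k, h.one, h.two, h.qPred, h.ptr, add_zero, hbase, hexp_eq]
  refine ⟨by omega, by omega, by omega, by omega, by omega, by omega, by omega, by omega, by omega,
    ?_⟩
  refine power_wp (by simp [h.one]) (by simp) (by simp) (by simp) (by simp) (by simp)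
    (by simp [P.letterBound_pos]) (by simpa [hpow] using hmod) fun s' n hval hframe hmem hn => ?_
  simp only [State.setReg_reg, State.setReg_mem, Nat.reduceEqDiff, if_true, if_false]
    at hval hframe hmem hn
  refine ⟨h.toParamsRead.congr (fun r hr => ?_) hmem, hval, ?_, ?_, by omega⟩
  · rw [hframe r (by omega) (by omega)]
    split_ifs <;> first | rfl | omega
  · simp [hframe]
  · simp [hframe, h.depth]

theorem computeSizes_wp (h : P.ParamsRead s) (hmod : s.reg rMod = P.modulus)
    (hlen : s.reg rLen = P.input.length) (hdepth : s.reg rDepth = 0) (hk : P.k < P.bound) :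
    computeSizes.wp P.bound s fun s' n => P.Constants s' ∧ s'.mem = s.mem ∧ s'.reg rDepth = 0 ∧
      n ≤ 3 * P.k + 7 := by
  have hpow : 2 ^ P.k * 2 ^ P.k = 4 ^ P.k := (mul_pow 2 2 P.k).symm
  have hle : 2 ^ P.k ≤ 4 ^ P.k := Nat.pow_le_pow_left (by omega) _
  have hblock := P.two_mul_four_pow_le_blockSize
  have hsources_eq : (P.t + 1) * 4 ^ P.k = P.sourceCount := rfl
  have hsources := P.sourceCount_le_blockSize
  have ht : P.t + 2 ≤ P.blockSize := Nat.le_mul_of_pos_right _ (by positivity)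
  have hlt := P.blockSize_lt_bound
  simp only [computeSizes, Prog.wp, State.setReg_reg, Nat.reduceEqDiff, if_false, h.zero, h.k,
    add_zero]
  refine ⟨hk, ?_⟩
  refine power_wp (by simp [h.one]) (by simp) (by simp) (by simp) (by simp) (by simp)
    (by simp [h.two]) (by simp [h.two]; omega) fun s' n hval hframe hmem hn => ?_
  simp only [State.setReg_reg, State.setReg_mem, Nat.reduceEqDiff, if_true, if_false,
    h.two] at hval hframe hmem hn
  simp only [State.setReg_mem, Nat.reduceEqDiff, if_true, if_false, hval, hframe, h.t, h.one,
    hpow, hsources_eq, P.sourceCount_add, ne_eq, not_false_eq_true]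
  refine ⟨by omega, by omega, by omega, hlt, ⟨?_, ?_, ?_, ?_, ?_, ?_, ?_, ?_, ?_, ?_, ?_⟩, hmem,
    hdepth, by omega⟩
  all_goals simp [hval, hframe, h.zero, h.k, h.qPred, h.one, h.two, hmod, hlen]

theorem memory_single_single {R : Type*} [Zero R] (x : R) {a : ℕ} (ha : P.blocksStart ≤ a) :
    P.memory (Pi.single 0 (Pi.single 0 x)) a = if a = P.addr 0 then x else 0 := by
  obtain ⟨i, y, hy, rfl⟩ := exists_eq_addr_add ha
  have hiff := addr_add_eq_addr_add_iff (i := i) (j := 0) hy P.blockSize_pos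
  rw [memory_addr_add _ _ hy, ← add_zero (P.addr 0), if_congr hiff rfl rfl]
  rcases eq_or_ne i 0 with rfl | hi
  · simp [Pi.single_apply]
  · simp [hi]

theorem firstNode_wp (h : P.Constants s) (hmem : s.mem = fun a => P.input.getD a 0)
    (hdepth : s.reg rDepth = 0) (hlen : 0 < P.input.length) (hmod : 1 < P.modulus) :
    firstNode.wp P.bound s fun s' n =>
      P.LoopInv 3 [] 1 (Pi.single 0 (Pi.single 0 1)) s' ∧ s'.reg rFrom = P.addr 0 ∧ n = 5 := by
  have hstart : P.input.length * 2 + P.input.length = P.addr 0 := by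
    rw [addr, blocksStart]
    ring
  have hmax : 1 ≤ P.maxBlocks := Nat.le_add_left 1 _
  have hlt := P.three_mul_length_lt_bound
  have hlt' := addr_lt_bound hmax
  simp only [firstNode, Prog.wp, State.setReg_reg, State.setMem_reg, h.one, h.two, h.block,
    h.len, Nat.reduceEqDiff, if_true, if_false, hstart, ← P.addr_succ, zero_add]
  refine ⟨by omega, by omega, by omega, by omega, ⟨?_, by simp, by simp [hdepth], by simp, by simp,
    hmax, trivial, fun a ha => ?_, fun a ha => ?_, fun i hi => ?_⟩, trivial, trivial⟩
  · exact h.congr fun r hr => by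
      simp only [State.setReg_reg, State.setMem_reg]
      split_ifs <;> omega
  · have : a ≠ P.addr 0 := by omega
    simp [hmem, this]
  · rw [memory_single_single _ ha]
    simp only [State.setReg_mem, State.setMem_mem, Function.update_apply, hmem]
    split_ifs
    · exact ⟨hmod, Nat.cast_one⟩
    · have : P.blocksStart = 3 * P.input.length := rfl
      rw [List.getD_eq_default _ _ (by omega)]
      exact ⟨P.modulus_pos, Nat.cast_zero⟩
  · exact Pi.single_eq_of_ne (by omega) _

theorem start_wp (h : P.Constants s) (hs : s.Bounded P.bound)
    (hmem : s.mem = fun a => P.input.getD a 0) (hdepth : s.reg rDepth = 0)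
    (hlen : 0 < P.input.length) (hmod : 1 < P.modulus) :
    start.wp P.bound s fun s' n =>
      P.LoopInv 3 [(0, 1)] 2 (Pi.single 0 (Pi.single 0 1)) s' ∧ n = 13 := by
  simp only [start, Prog.wp]
  refine Prog.wp_mono hs (firstNode_wp h hmem hdepth hlen hmod) ?_
  rintro s₁ _ hs₁ ⟨h₁, hfrom, rfl⟩
  refine Prog.wp_mono hs₁ (allocate_wp h₁ (Nat.le_add_left 2 _)) ?_
  rintro s₂ _ hs₂ ⟨h₂, hnode, hframe, rfl⟩
  refine Prog.wp_mono hs₂ (push_wp h₂ hlen (by simp) (by simp)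
    ((hframe _ (by simp) (by simp)).trans hfrom) hnode) ?_
  rintro s₃ _ - ⟨h₃, -, rfl⟩
  exact ⟨h₃, rfl⟩

theorem answer_wp {ptr N : ℕ} {vec : ℕ → ℕ → ZMod P.modulus} (h : P.LoopInv ptr [] N vec s) :
    answer.wp P.bound s fun s' n => (vec 1 (P.sourceCount - 1) = 0 → s'.reg 0 = 0) ∧
      (vec 1 (P.sourceCount - 1) ≠ 0 → s'.reg 0 = 1) ∧ n ≤ 8 := by
  have hlen := P.three_mul_length_lt_bound
  have hstart : P.input.length * 2 + P.input.length = P.addr 0 := by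
    rw [addr, blocksStart]
    ring
  have hmax : 1 ≤ P.maxBlocks := Nat.le_add_left 1 _
  have htop : P.sourceCount - 1 < P.blockSize := by
    have := P.sourceCount_le_blockSize
    have := P.blockSize_pos
    omega
  obtain ⟨hlt, hcell⟩ := h.cells (P.addr 1 + (P.sourceCount - 1))
    (Nat.le_add_right_of_le (P.blocksStart_le_addr 1))
  rw [memory_addr_add _ _ htop] at hcell
  have hzero : s.mem (P.addr 1 + (P.sourceCount - 1)) = 0 ↔ vec 1 (P.sourceCount - 1) = 0 := by
    rw [← hcell, ZMod.natCast_eq_zero_iff]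
    exact ⟨fun h => h ▸ dvd_zero _, fun h => Nat.eq_zero_of_dvd_of_lt h hlt⟩
  simp only [answer, Prog.wp, State.setReg_reg, State.setReg_mem, h.one, h.two, h.sources, h.block,
    h.len, Nat.reduceEqDiff, if_true, if_false, hstart, ← P.addr_succ, zero_add]
  refine ⟨by omega, ?_, addr_lt_bound hmax, addr_add_lt_bound hmax htop.le, fun hne => ?_,
    fun heq => ?_⟩
  · exact hstart ▸ addr_lt_bound (Nat.zero_le _)
  · exact ⟨P.one_lt_bound, fun h0 => absurd (hzero.2 h0) hne, fun _ => trivial, le_rfl⟩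
  · exact ⟨fun _ => h.zero, fun h0 => absurd (hzero.1 heq) h0, by norm_num⟩

end Params

end Algorithm

end Programs

section Correctness

open Finset RAM

theorem mask_range_add_one (k : ℕ) : mask (range k) + 1 = 2 ^ k := by
  rw [mask, Nat.geomSum_eq le_rfl]
  have := Nat.one_le_two_pow (n := k)
  omega

namespace Params

/-- A bound on the number of steps of the decision procedure. -/
def steps (P : Params) : ℕ :=
  (P.tokenCost + 19) * P.input.length + 6 * (P.k * P.k) + 3 * P.k + 50

variable {P : Params} {s : State} {φ : Formula P.n}

theorem sourceCount_sub_one (P : Params) :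
    P.sourceCount - 1 = cell P.k P.t (range P.k) (range P.k) := by
  have hmask := mask_range_add_one P.k
  have hpow : 2 ^ P.k * 2 ^ P.k = 4 ^ P.k := (mul_pow 2 2 P.k).symm
  refine Nat.sub_eq_of_eq_add ?_
  rw [sourceCount, cell, ← hpow, ← hmask]
  ring

theorem length_input (hinput : P.input = inputWord P.k P.t φ) :
    P.input.length = φ.encode.length + 3 := by
  rw [hinput, inputWord]
  rfl

theorem lt_letterBound (hq : 2 ≤ P.q) : P.n < P.letterBound ∧ P.q < P.letterBound := by
  unfold letterBound
  constructor <;> nlinarith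

theorem exponent_lt_modulus (hq : 2 ≤ P.q) :
    P.input.length + 2 * (P.k * P.k) + 1 < P.modulus :=
  Nat.lt_pow_self ((lt_letterBound hq).2.trans' (by omega))

theorem k_lt_modulus (hq : 2 ≤ P.q) : P.k < P.modulus := by
  have := Nat.le_mul_self P.k
  have := exponent_lt_modulus hq
  omega

theorem init_bounded (hq : 2 ≤ P.q) (hinput : P.input = inputWord P.k P.t φ) :
    (State.init P.input).Bounded P.bound := by
  have hbound := P.one_lt_bound
  have hk := (k_lt_modulus hq).trans P.modulus_lt_bound
  have hn := (lt_letterBound hq).1.trans P.letterBound_lt_bound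
  have ht : P.t + 2 ≤ P.blockSize := Nat.le_mul_of_pos_right _ (by positivity)
  have hblock : P.blockSize < P.bound := blockSize_lt_bound
  have hentry : ∀ a ∈ P.input, a < P.bound := by
    intro a ha
    simp only [hinput, inputWord, List.mem_cons] at ha
    rcases ha with rfl | rfl | rfl | ha
    · exact hn
    · exact hk
    · omega
    · have hle := Formula.le_of_mem_encode ha
      have hlen := length_input hinput
      have hexp := exponent_lt_modulus hq
      have hmod := P.letterBound_le_modulus
      have hn' := (lt_letterBound hq).1
      have hsum := P.modulus_mul_pow_add_le
      have hmul := Nat.le_mul_of_pos_right P.modulus (Nat.pow_pos P.letterBound_pos (n := P.k))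
      omega
  refine ⟨fun _ => hbound.pos, fun a => ?_⟩
  rcases lt_or_ge a P.input.length with ha | ha
  · simpa only [State.init, List.getD_eq_getElem _ _ ha] using hentry _ (List.getElem_mem ha)
  · simpa only [State.init, List.getD_eq_default _ _ ha] using hbound.pos

theorem mainLoop_wp (hq : 2 ≤ P.q) (hinput : P.input = inputWord P.k P.t φ)
    (h : P.LoopInv 3 [(0, 1)] 2 (Pi.single 0 (Pi.single 0 1)) s) :
    mainLoop.wp P.bound s fun s' n =>
      (∃ ptr N vec, P.LoopInv ptr [] N vec s' ∧
        vec 1 = φ.act (ZMod P.modulus) P.k P.t (P.q - 1) (Pi.single 0 1)) ∧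
      n ≤ P.tokenCost * P.input.length := by
  have hlen := length_input hinput
  have hmax : P.maxBlocks = P.q * φ.encode.length + 3 * P.q + 2 := by
    rw [maxBlocks, hlen]
    ring
  have hready : P.Ready φ.encode 1 3 0 1 [] 2 (Pi.single 0 (Pi.single 0 1)) s :=
    ⟨h, by rw [hinput]; exact List.prefix_rfl, two_pos, one_lt_two, zero_ne_one, by simp [hlen],
      by omega⟩
  refine processes_encode hq φ hready fun s' N vec n h' hn => .loop_done h'.depth ?_
  refine ⟨⟨_, N, vec, h'.toLoopInv, ?_⟩, ?_⟩
  · simpa using h'.acts.apply_dst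
  · rw [hlen, mul_add]
    omega

theorem apply_top_eq_zero_iff (hq : 2 ≤ P.q) (hinput : P.input = inputWord P.k P.t φ) :
    φ.act (ZMod P.modulus) P.k P.t (P.q - 1) (Pi.single 0 1) (P.sourceCount - 1) = 0 ↔
      ¬ HasMarkedQMonomial P.q P.k P.t φ.poly := by
  have hpred : P.n * (P.q - 1) ≤ P.n * P.q := Nat.mul_le_mul_left _ (Nat.sub_le _ _)
  rw [sourceCount_sub_one]
  refine Formula.act_apply_top_cell_eq_zero_iff (B := P.letterBound) hq φ ?_
    (lt_letterBound hq).2.le ?_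
  · rw [letterBound, add_mul]
    omega
  · refine Nat.pow_lt_pow_right ((lt_letterBound hq).2.trans' (by omega)) ?_
    rw [length_input hinput]
    omega

theorem algorithm_wp (hq : 2 ≤ P.q) (hinput : P.input = inputWord P.k P.t φ) :
    (algorithm P.q).wp P.bound (State.init P.input) fun s' n =>
      (HasMarkedQMonomial P.q P.k P.t φ.poly → s'.reg 0 = 1) ∧
      (¬ HasMarkedQMonomial P.q P.k P.t φ.poly → s'.reg 0 = 0) ∧ n ≤ P.steps := by
  have hmod : 1 < P.modulus := (Nat.le_add_left 1 _).trans_lt (exponent_lt_modulus hq)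
  have hlen : 0 < P.input.length := by rw [length_input hinput]; omega
  simp only [algorithm, Prog.wp]
  refine Prog.wp_mono (init_bounded hq hinput) (readParams_wp hq hinput) ?_
  rintro s₁ _ hs₁ ⟨h₁, rfl⟩
  refine Prog.wp_mono hs₁ (scanLoop_wp hinput h₁) ?_
  rintro s₂ n₂ hs₂ ⟨h₂, hn₂⟩
  refine Prog.wp_mono hs₂ (computeModulus_wp hq h₂) ?_
  rintro s₃ n₃ hs₃ ⟨h₃, hmodulus, hlength, hdepth₃, hn₃⟩
  refine Prog.wp_mono hs₃ (computeSizes_wp h₃ hmodulus hlength hdepth₃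
    ((k_lt_modulus hq).trans P.modulus_lt_bound)) ?_
  rintro s₄ n₄ hs₄ ⟨h₄, hmem, hdepth₄, hn₄⟩
  refine Prog.wp_mono hs₄ (start_wp h₄ hs₄ (hmem.trans h₃.mem) hdepth₄ hlen hmod) ?_
  rintro s₅ _ hs₅ ⟨h₅, rfl⟩
  refine Prog.wp_mono hs₅ (mainLoop_wp hq hinput h₅) ?_
  rintro s₆ n₆ hs₆ ⟨⟨_, _, vec, h₆, hvec⟩, hn₆⟩
  refine Prog.wp_mono hs₆ (answer_wp h₆) ?_
  rintro s₇ n₇ - ⟨hzero, hone, hn₇⟩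
  rw [hvec, apply_top_eq_zero_iff hq hinput] at hzero
  rw [hvec, ne_eq, apply_top_eq_zero_iff hq hinput, not_not] at hone
  refine ⟨hone, hzero, ?_⟩
  unfold steps
  rw [add_mul]
  omega

end Params

end Correctness

section RunningTime

open RAM

theorem RAM.len_le_of_lt_two_pow {a e : ℕ} (h : a < 2 ^ e) : len a ≤ e + 1 :=
  Nat.add_le_add_right (Nat.size_le.2 h) 1

theorem sq_le_two_pow_succ (m : ℕ) : m ^ 2 ≤ 2 ^ (m + 1) := by
  induction m with
  | zero => norm_num
  | succ m ih =>
    rcases Nat.lt_or_ge m 3 with h | h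
    · interval_cases m <;> norm_num
    · rw [pow_succ 2 (m + 1)]
      nlinarith

theorem size_add_two_sq_le (t : ℕ) : Nat.size (t + 2) ^ 2 ≤ 12 * max t 1 := by
  obtain ⟨m, hm⟩ : ∃ m, Nat.size (t + 2) = m + 1 :=
    Nat.exists_eq_succ_of_ne_zero (Nat.size_pos.2 (Nat.succ_pos _)).ne'
  have hpow : 2 ^ m ≤ t + 2 := Nat.lt_size.1 (by omega)
  calc Nat.size (t + 2) ^ 2 ≤ 2 ^ (m + 1 + 1) := hm ▸ sq_le_two_pow_succ (m + 1)
    _ = 4 * 2 ^ m := by ring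
    _ ≤ 12 * max t 1 := by omega

theorem Formula.length_inputWord_le {n : ℕ} {φ : Formula n} (h : φ.IsSimple) (k t : ℕ) :
    (inputWord k t φ).length ≤ 9 * ((n + k + 1) * max φ.size 1) := by
  have := length_encode_le_mul h
  have := le_max_right φ.size 1
  simp only [inputWord, List.length_cons]
  nlinarith

namespace Params

variable {P : Params}

theorem modulus_mul_pow_le (P : Params) : P.modulus * P.letterBound ^ P.k ≤
    2 ^ (P.letterBound * (P.input.length + 2 * (P.k * P.k) + 1 + P.k)) := by
  rw [modulus, ← pow_add, pow_mul]
  exact Nat.pow_le_pow_left Nat.lt_two_pow_self.le _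

theorem addr_maxBlocks_succ_le (P : Params) : P.addr (P.maxBlocks + 1) ≤
    2 ^ ((P.q + 3) * P.input.length + 3 + Nat.size (P.t + 2) + 2 * P.k) := by
  have hblock : P.blockSize ≤ 2 ^ Nat.size (P.t + 2) * 2 ^ (2 * P.k) := by
    rw [pow_mul]
    exact Nat.mul_le_mul_right _ (Nat.lt_size_self _).le
  have hstart : 3 * P.input.length * 1 ≤ 3 * P.input.length * P.blockSize :=
    Nat.mul_le_mul_left _ P.blockSize_pos
  calc P.addr (P.maxBlocks + 1) ≤ ((P.q + 3) * P.input.length + 3) * P.blockSize := by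
        unfold addr maxBlocks blocksStart
        linarith
    _ ≤ 2 ^ ((P.q + 3) * P.input.length + 3) * (2 ^ Nat.size (P.t + 2) * 2 ^ (2 * P.k)) :=
        Nat.mul_le_mul Nat.lt_two_pow_self.le hblock
    _ = _ := by rw [← mul_assoc, ← pow_add, ← pow_add]

theorem len_bound_le (P : Params) : len P.bound ≤
    P.letterBound * (P.input.length + 2 * (P.k * P.k) + 1 + P.k) +
      ((P.q + 3) * P.input.length + 3 + Nat.size (P.t + 2) + 2 * P.k) + 3 := by
  have hmod := P.modulus_mul_pow_le
  have hmod_le : P.modulus ≤ P.modulus * P.letterBound ^ P.k :=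
    Nat.le_mul_of_pos_right _ (Nat.pow_pos P.letterBound_pos)
  have haddr := P.addr_maxBlocks_succ_le
  generalize P.letterBound * (P.input.length + 2 * (P.k * P.k) + 1 + P.k) = a at *
  generalize (P.q + 3) * P.input.length + 3 + Nat.size (P.t + 2) + 2 * P.k = b at *
  have ha : 2 ^ a ≤ 2 ^ (a + b) := Nat.pow_le_pow_right two_pos (Nat.le_add_right _ _)
  have hb : 2 ^ b ≤ 2 ^ (a + b) := Nat.pow_le_pow_right two_pos (Nat.le_add_left _ _)
  have hpos : 0 < 2 ^ (a + b) := by positivity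
  refine len_le_of_lt_two_pow (e := a + b + 2) ?_
  rw [pow_add 2 (a + b), bound]
  omega

theorem len_bound_le_mul {s : ℕ} (hs : 1 ≤ s)
    (hL : P.input.length ≤ 9 * ((P.n + P.k + 1) * s)) :
    len P.bound ≤ (21 * P.q + 60) * ((P.n + P.k + 1) ^ 3 * s * Nat.size (P.t + 2)) := by
  refine (len_bound_le P).trans ?_
  have hB : P.letterBound ≤ (P.q + 1) * (P.n + P.k + 1) := by
    unfold letterBound
    nlinarith
  have hkA : P.k + 1 ≤ P.n + P.k + 1 := by omega
  have hτ : 1 ≤ Nat.size (P.t + 2) := Nat.size_pos.2 (Nat.succ_pos _)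
  generalize P.n + P.k + 1 = A at *
  generalize Nat.size (P.t + 2) = τ at *
  have hA : 1 ≤ A := by omega
  have hAA : A * s ≤ A ^ 2 * s := Nat.mul_le_mul_right _ (Nat.le_self_pow two_ne_zero _)
  have hAs : A ≤ A * s := Nat.le_mul_of_pos_right _ hs
  have hkk : P.k * P.k ≤ A ^ 2 * s :=
    calc P.k * P.k ≤ A * A := Nat.mul_le_mul (by omega) (by omega)
      _ = A ^ 2 := (pow_two A).symm
      _ ≤ A ^ 2 * s := Nat.le_mul_of_pos_right _ hs
  have hX : A ^ 2 * s ≤ A ^ 3 * s * τ :=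
    calc A ^ 2 * s ≤ A ^ 3 * s := Nat.mul_le_mul_right _ (Nat.pow_le_pow_right hA (by norm_num))
      _ ≤ A ^ 3 * s * τ := Nat.le_mul_of_pos_right _ hτ
  have hτX : τ ≤ A ^ 3 * s * τ := Nat.le_mul_of_pos_left _ (by positivity)
  have hmod : P.letterBound * (P.input.length + 2 * (P.k * P.k) + 1 + P.k) ≤
      12 * (P.q + 1) * (A ^ 3 * s * τ) :=
    calc _ ≤ (P.q + 1) * A * (12 * (A ^ 2 * s)) := Nat.mul_le_mul hB (by omega)
      _ = 12 * (P.q + 1) * (A ^ 3 * s) := by ring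
      _ ≤ _ := Nat.mul_le_mul_left _ (Nat.le_mul_of_pos_right _ hτ)
  have haddr : (P.q + 3) * P.input.length ≤ (P.q + 3) * (9 * (A ^ 3 * s * τ)) :=
    Nat.mul_le_mul_left _ (by omega)
  generalize A ^ 3 * s * τ = X at *
  linarith

theorem max_mul_four_pow_pos (P : Params) : 0 < max P.t 1 * 4 ^ P.k :=
  Nat.mul_pos (lt_max_of_lt_right one_pos) (by positivity)

theorem edgeCost_le (P : Params) :
    P.edgeCost ≤ 60 * ((P.n + P.k + 1) * (max P.t 1 * 4 ^ P.k)) := by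
  have hpos : 0 < (P.n + P.k + 1) * (max P.t 1 * 4 ^ P.k) :=
    Nat.mul_pos (Nat.succ_pos _) P.max_mul_four_pow_pos
  have hsources : P.sourceCount ≤ 2 * (max P.t 1 * 4 ^ P.k) := by
    rw [sourceCount, ← mul_assoc]
    exact Nat.mul_le_mul_right _ (by omega)
  have hsteps : P.sourceCount * (20 * (P.k + 1) + 9) ≤
      58 * ((P.n + P.k + 1) * (max P.t 1 * 4 ^ P.k)) :=
    calc _ ≤ 2 * (max P.t 1 * 4 ^ P.k) * (29 * (P.n + P.k + 1)) :=
          Nat.mul_le_mul hsources (by omega)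
      _ = _ := by ring
  unfold edgeCost
  omega

theorem tokenCost_add_le (P : Params) : P.tokenCost + 19 ≤
    (137 * P.q + 59) * ((P.n + P.k + 1) * (max P.t 1 * 4 ^ P.k)) := by
  have hpos : 0 < (P.n + P.k + 1) * (max P.t 1 * 4 ^ P.k) :=
    Nat.mul_pos (Nat.succ_pos _) P.max_mul_four_pow_pos
  have hedge := P.edgeCost_le
  unfold tokenCost
  generalize (P.n + P.k + 1) * (max P.t 1 * 4 ^ P.k) = X at *
  have hq : P.q * (2 * P.edgeCost + 17) ≤ P.q * (137 * X) := Nat.mul_le_mul_left _ (by omega)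
  linarith

theorem steps_le_mul {s : ℕ} (hs : 1 ≤ s)
    (hL : P.input.length ≤ 9 * ((P.n + P.k + 1) * s)) :
    P.steps ≤ (1233 * P.q + 600) * ((P.n + P.k + 1) ^ 2 * s * (max P.t 1 * 4 ^ P.k)) := by
  have htoken := P.tokenCost_add_le
  have hk : P.k + 1 ≤ P.n + P.k + 1 := by omega
  have hV := P.max_mul_four_pow_pos
  unfold steps
  generalize P.n + P.k + 1 = A at *
  generalize max P.t 1 * 4 ^ P.k = V at *
  have hkk : (P.k + 1) * (P.k + 1) ≤ A ^ 2 * s * V :=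
    calc (P.k + 1) * (P.k + 1) ≤ A * A := Nat.mul_le_mul hk hk
      _ = A ^ 2 := (pow_two A).symm
      _ ≤ A ^ 2 * s := Nat.le_mul_of_pos_right _ hs
      _ ≤ A ^ 2 * s * V := Nat.le_mul_of_pos_right _ hV
  have htokens : (P.tokenCost + 19) * P.input.length ≤
      (1233 * P.q + 531) * (A ^ 2 * s * V) :=
    calc _ ≤ (137 * P.q + 59) * (A * V) * (9 * (A * s)) := Nat.mul_le_mul htoken hL
      _ = _ := by ring
  nlinarith

end Params

end RunningTime

/-- The exponential factor is `4 ^ k`, from the `4 ^ k` pairs of subsets of a set of `k` positions,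
and the size of the formula enters with its third power only. -/
theorem corollary1_general (q : ℕ) (hq : 2 ≤ q) :
    ∃ (P : RAM.Prog) (C c : ℕ), ∀ (n k t : ℕ) (φ : Formula n), φ.IsSimple →
      ∃ (s' : RAM.State) (T : ℕ),
        RAM.Exec P (RAM.State.init (inputWord k t φ)) s' T ∧
        (HasMarkedQMonomial q k t φ.poly → s'.reg 0 = 1) ∧
        (¬ HasMarkedQMonomial q k t φ.poly → s'.reg 0 = 0) ∧
        T ≤ C * (n + k + 1) ^ c * max t 1 ^ 2 * 4 ^ k * max φ.size 1 ^ 3 := by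
  refine ⟨RAM.algorithm q, 12 * (21 * q + 60) ^ 2 * (1233 * q + 600), 8, fun n k t φ hφ => ?_⟩
  let P : Params := ⟨n, k, t, q, inputWord k t φ⟩
  obtain ⟨s', N, T, exec, cost, -, hone, hzero, hN⟩ :=
    RAM.Prog.haltsWith_of_wp (P.algorithm_wp (φ := φ) hq rfl) (P.init_bounded (φ := φ) hq rfl)
  have hs : 1 ≤ max φ.size 1 := le_max_right _ _
  have hL : P.input.length ≤ 9 * ((n + k + 1) * max φ.size 1) := φ.length_inputWord_le hφ k t
  have hsteps : N ≤ (1233 * q + 600) * ((n + k + 1) ^ 2 * max φ.size 1 * (max t 1 * 4 ^ k)) :=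
    hN.trans (P.steps_le_mul hs hL)
  have hlen : RAM.len P.bound ^ 2 ≤ (21 * q + 60) ^ 2 * ((n + k + 1) ^ 3 * max φ.size 1) ^ 2 *
      (12 * max t 1) :=
    calc _ ≤ ((21 * q + 60) * ((n + k + 1) ^ 3 * max φ.size 1 * Nat.size (t + 2))) ^ 2 :=
          Nat.pow_le_pow_left (P.len_bound_le_mul hs hL) 2
      _ = (21 * q + 60) ^ 2 * ((n + k + 1) ^ 3 * max φ.size 1) ^ 2 * Nat.size (t + 2) ^ 2 := by ring
      _ ≤ _ := Nat.mul_le_mul_left _ (size_add_two_sq_le t)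
  exact ⟨s', T, exec, hone, hzero, (cost.trans (Nat.mul_le_mul hsteps hlen)).trans_eq (by ring)⟩

/-- The time bound suppresses a factor polynomial in `n` and `k`; `max t 1` and `max φ.size 1` only
matter for `t = 0` and for a formula that is a single terminal. The answer is left in register `0`. -/
theorem corollary1 (q : ℕ) (hq : 2 ≤ q) :
    ∃ (P : RAM.Prog) (C c : ℕ), ∀ (n k t : ℕ) (φ : Formula n), φ.IsSimple →
      ∃ (s' : RAM.State) (T : ℕ),
        RAM.Exec P (RAM.State.init (inputWord k t φ)) s' T ∧
        (HasMarkedQMonomial q k t φ.poly → s'.reg 0 = 1) ∧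
        (¬ HasMarkedQMonomial q k t φ.poly → s'.reg 0 = 0) ∧
        (T : ℝ) ≤ C * ((n : ℝ) + k + 1) ^ c *
          ((max t 1 : ℕ) : ℝ) ^ 2 * (5.44 : ℝ) ^ k * ((max φ.size 1 : ℕ) : ℝ) ^ 4 := by
  obtain ⟨P, C, c, h⟩ := corollary1_general q hq
  refine ⟨P, C, c, fun n k t φ hφ => ?_⟩
  obtain ⟨s', T, exec, hone, hzero, hT⟩ := h n k t φ hφ
  have hs : (1 : ℝ) ≤ (max φ.size 1 : ℕ) := mod_cast le_max_right _ _
  refine ⟨s', T, exec, hone, hzero, (Nat.cast_le.2 hT).trans ?_⟩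
  push_cast at hs ⊢
  gcongr <;> norm_num
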